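/- Let $P_n$ ($n\ge 0$) be polynomials with $P_0=1$ and \[P_{n+1}(x)=A_n(x)P_n'(x)+B_n(x)P_n(x),\qquad n\ge 0,\] where $A_n,B_n$ are polynomials of degree at most $2$ and $1$ respectively. Assume that $P_n$ has degree exactly $n$, that all its zeros $x_{1,n}\le\dots\le x_{n,n}$ are real, and that the zeros interlace: $x_{k,n+1}\le x_{k,n}\le x_{k+1,n+1}$ for $1\le k\le n$. Let $\phi(n)$, $n\ge1$, be a positive nondecreasing sequence such that $x_{k,n}/\phi(n)\in[\alpha,\beta]$ for all $1\le k\le n$, and assume that $\phi$ is regularly varying: $\phi(n)=n^{\sigma}L(n)$ with $\sigma\ge 0$ and $L([nt])/L(n)\to1$ for every $t>0$. Assume that for all $x\in\mathbb C$ \[\lim_{n\to\infty}\frac{n}{\phi(n)^2}A_n(\phi(n)x)=a(x),\qquad \lim_{n\to\infty}\frac1{\phi(n)}B_n(\phi(n)x)=b(x),\] where $a(x)=a_2x^2+a_1x+a_0$ and $b(x)=b_1x+b_0$ satisfy the non-degeneracy condition $a_2+b_1\neq0$. Put $\Omega=\mathbb C\setminus[\alpha^*,\beta^*]$, where $[\alpha^*,\beta^*]=[\alpha,\beta]$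 if $\phi$ is constant and $\alpha^*=\min\{0,\alpha\}$, $\beta^*=\max\{0,\beta\}$ otherwise, and \[f_n(t,x)=\frac{\phi(n)}{n}\,\frac{P_{[nt]}'(\phi(n)x)}{P_{[nt]}(\phi(n)x)},\qquad t\in[0,1],\ x\in\Omega .\] Then the subsequential limits of $(f_n)$ do not depend on the subsequence: there is a function $f$, continuous on $[0,1]\times\Omega$ and holomorphic in $x\in\Omega$, such that $f_n\to f$ uniformly on $[0,1]\times K$ for every compact $K\subset\Omega$, and whenever $\Lambda\subset\mathbb N$ is infinite and $f_n\to g$ pointwise on $[0,1]\times\Omega$ as $n\to\infty$, $n\in\Lambda$, then $g=f$. Moreover, for $0<t\le1$ and $x\in\Omega$ the function $t^{2\sigma-1}a(xt^{-\sigma})f(t,x)+t^{\sigma}b(xt^{-\sigma})$ does not vanish, and for all $s\in[0,1]$ and $x\in\Omega$ the following integrand is integrable on $(0,s)$ and \[f(s,x)=\int_0^s\frac{\frac{\partial}{\partial x}\left[t^{2\sigma-1}a(xt^{-\sigma})f(t,x)+t^{\sigma}b(xt^{-\sigma})\right]}{t^{2\sigma-1}a(xt^{-\sigma})f(t,x)+t^{\sigma}b(xt^{-\sigma})}\,dt,\]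 with $f(0,x)=0$ for $x\in\Omega$ and $\lim_{|x|\to\infty}x f(s,x)=s$ for every $s\in[0,1]$. -/

import Mathlib

open Filter Topology Polynomial

noncomputable section

/-- `P n` has degree exactly `n`, and `x n 1, …, x n n` are its zeros, all real
(repeated according to multiplicity). -/
def HasRealZeros (P : ℕ → ℂ[X]) (x : ℕ → ℕ → ℝ) : Prop :=
  ∀ n, ∃ κ : ℂ, κ ≠ 0 ∧ P n = C κ * ∏ k ∈ Finset.Icc 1 n, (X - C ((x n k : ℝ) : ℂ))

/-- The zeros of consecutive polynomials interlace:
`x_{k,n+1} ≤ x_{k,n} ≤ x_{k+1,n+1}` for `1 ≤ k ≤ n`.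
This also says that the zeros are listed in increasing order. -/
def ZerosInterlace (x : ℕ → ℕ → ℝ) : Prop :=
  ∀ n k, 1 ≤ k → k ≤ n → x (n + 1) k ≤ x n k ∧ x n k ≤ x (n + 1) (k + 1)

/-- `φ(n) = n^σ L(n)` for `n ≥ 1`, with `σ ≥ 0` and `L([nt]) / L(n) → 1` for every `t > 0`. -/
def IsRegularlyVarying (φ : ℕ → ℝ) (σ : ℝ) : Prop :=
  0 ≤ σ ∧ ∃ L : ℕ → ℝ, (∀ n, 1 ≤ n → φ n = (n : ℝ) ^ σ * L n) ∧
    ∀ t : ℝ, 0 < t → Tendsto (fun n : ℕ => L ⌊(n : ℝ) * t⌋₊ / L n) atTop (𝓝 1)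

open Classical in
/-- The set `ℂ \ [α*, β*]`, where `[α*, β*] = [α, β]` if `φ` is constant (on `n ≥ 1`), and
`α* = min {0, α}`, `β* = max {0, β}` otherwise. -/
def limitDomain (φ : ℕ → ℝ) (α β : ℝ) : Set ℂ :=
  (((↑) : ℝ → ℂ) '' (if ∀ n, 1 ≤ n → φ n = φ 1 then Set.Icc α β
    else Set.Icc (min 0 α) (max 0 β)))ᶜ

/-- `f_n(t, x) = (φ(n) / n) * P'_{[nt]}(φ(n) x) / P_{[nt]}(φ(n) x)`. -/
def scaledLogDeriv (φ : ℕ → ℝ) (P : ℕ → ℂ[X]) (n : ℕ) (t : ℝ) (x : ℂ) : ℂ :=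
  ((φ n / n : ℝ) : ℂ) *
    ((derivative (P ⌊(n : ℝ) * t⌋₊)).eval ((φ n : ℂ) * x) /
      (P ⌊(n : ℝ) * t⌋₊).eval ((φ n : ℂ) * x))

/-- The expression `t^{2σ-1} a(x t^{-σ}) f(t, x) + t^σ b(x t^{-σ})`. -/
def ratioExpr (a b : ℂ[X]) (σ : ℝ) (f : ℝ → ℂ → ℂ) (t : ℝ) (x : ℂ) : ℂ :=
  ((t ^ (2 * σ - 1) : ℝ) : ℂ) * a.eval (x * ((t ^ (-σ) : ℝ) : ℂ)) * f t x +
    ((t ^ σ : ℝ) : ℂ) * b.eval (x * ((t ^ (-σ) : ℝ) : ℂ))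

end

/-- Partial fractions of the reciprocal of `z - d - ∑ w j / (z - y j)`, obtained from the spectral
theorem for the bordered diagonal matrix with corner `d`, border `√(w j)` and diagonal `y j`. -/
theorem exists_partialFraction_inv {ι : Type*} [Fintype ι] (w y : ι → ℝ) (hw : ∀ j, 0 ≤ w j)
    (d : ℝ) :
    ∃ η ζ : Option ι → ℝ, (∀ i, 0 ≤ η i) ∧ ∑ i, η i = 1 ∧
      (∀ i, η i ≠ 0 → (∀ j, ζ i ≠ y j) → ζ i - d - ∑ j, w j / (ζ i - y j) = 0) ∧
      ∀ x : ℂ, 0 < x.im →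
        (∑ i, (η i : ℂ) / (x - ζ i)) * (x - d - ∑ j, (w j : ℂ) / (x - y j)) = 1 := by
  classical
  let J : Matrix (Option ι) (Option ι) ℝ := fun i j =>
    match i, j with
    | none, none => d
    | none, some j => √(w j)
    | some i, none => √(w i)
    | some i, some j => if i = j then y i else 0
  have hJ : J.IsHermitian := by
    refine Matrix.IsHermitian.ext fun i j => ?_
    match i, j with
    | none, none => simp [J]
    | none, some j => simp [J]
    | some i, none => simp [J]
    | some i, some j =>
      by_cases h : i = j
      · subst h; simp [J]
      · simp [J, h, Ne.symm h]
  let u : Option ι → Option ι → ℝ := fun i k => (hJ.eigenvectorBasis i).ofLp k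
  let ζ : Option ι → ℝ := hJ.eigenvalues
  have heig : ∀ i, J.mulVec (u i) = ζ i • u i := fun i => hJ.mulVec_eigenvectorBasis i
  have h0 : ∀ i, d * u i none + ∑ j, √(w j) * u i (some j) = ζ i * u i none := by
    intro i
    have := congrFun (heig i) none
    simpa [Matrix.mulVec, dotProduct, Fintype.sum_option, J] using this
  have hs : ∀ i j, √(w j) * u i none + y j * u i (some j) = ζ i * u i (some j) := by
    intro i j
    have := congrFun (heig i) (some j)
    simpa [Matrix.mulVec, dotProduct, Fintype.sum_option, J] using this
  have hon : ∀ k l, ∑ i, u i k * u i l = if k = l then 1 else 0 := by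
    intro k l
    have := hJ.eigenvectorBasis.sum_inner_mul_inner (EuclideanSpace.single k (1 : ℝ))
      (EuclideanSpace.single l (1 : ℝ))
    simp only [EuclideanSpace.inner_single_left, EuclideanSpace.inner_single_right] at this
    simp only [map_one, one_mul, conj_trivial] at this
    rw [show (∑ i, u i k * u i l) = _ from this]
    simp [PiLp.single_apply, eq_comm]
  refine ⟨fun i => u i none ^ 2, ζ, fun i => sq_nonneg _, ?_, ?_, ?_⟩
  · have := hon none none
    simpa [sq] using this
  · intro i hi hne
    have hu : u i none ≠ 0 := fun h => hi (by simp [h])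
    have h1 : ∀ j, u i (some j) = √(w j) * u i none / (ζ i - y j) := by
      intro j
      rw [eq_div_iff (sub_ne_zero.2 (hne j))]
      linarith [hs i j]
    have h2 : ∑ j, √(w j) * u i (some j) = (∑ j, w j / (ζ i - y j)) * u i none := by
      rw [Finset.sum_mul]
      refine Finset.sum_congr rfl fun j _ => ?_
      rw [h1 j]
      have := Real.mul_self_sqrt (hw j)
      rw [← mul_div_assoc, ← mul_assoc, this]
      ring
    have h3 := h0 i
    rw [h2] at h3
    have : (ζ i - d - ∑ j, w j / (ζ i - y j)) * u i none = 0 := by linarith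
    exact (mul_eq_zero.1 this).resolve_right hu
  · intro x hx
    have hne : ∀ s : ℝ, x - (s : ℂ) ≠ 0 := by
      intro s h
      have := congrArg Complex.im h
      simp at this
      exact hx.ne' this
    let ψ : Option ι → ℂ := fun k => ∑ i, (u i none : ℂ) * u i k / (x - ζ i)
    have hψ : ∀ k, x * ψ k - ∑ i, (u i none : ℂ) * (ζ i * u i k) / (x - ζ i) =
        if none = k then 1 else 0 := by
      intro k
      have : x * ψ k - ∑ i, (u i none : ℂ) * (ζ i * u i k) / (x - ζ i) =
          ((∑ i, u i none * u i k : ℝ) : ℂ) := by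
        simp only [ψ]
        rw [Finset.mul_sum, ← Finset.sum_sub_distrib]
        push_cast
        refine Finset.sum_congr rfl fun i _ => ?_
        have := hne (ζ i)
        field_simp
      rw [this, hon]
      split_ifs <;> simp
    have e1 : ∀ j, (x - y j) * ψ (some j) = (√(w j) : ℝ) * ψ none := by
      intro j
      have h := hψ (some j)
      have : ∑ i, (u i none : ℂ) * (ζ i * u i (some j)) / (x - ζ i) =
          (√(w j) : ℝ) * ψ none + y j * ψ (some j) := by
        simp only [ψ]
        rw [Finset.mul_sum, Finset.mul_sum, ← Finset.sum_add_distrib]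
        refine Finset.sum_congr rfl fun i _ => ?_
        have h' : (ζ i * u i (some j) : ℂ) = (√(w j) : ℝ) * u i none + y j * u i (some j) := by
          exact_mod_cast (hs i j).symm
        rw [h']; ring
      rw [this] at h
      simp at h
      linear_combination h
    have e0 : (x - d) * ψ none - ∑ j, (√(w j) : ℝ) * ψ (some j) = 1 := by
      have h := hψ none
      have : ∑ i, (u i none : ℂ) * (ζ i * u i none) / (x - ζ i) =
          d * ψ none + ∑ j, (√(w j) : ℝ) * ψ (some j) := by
        simp only [ψ]
        simp_rw [Finset.mul_sum]
        rw [Finset.sum_comm, ← Finset.sum_add_distrib]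
        refine Finset.sum_congr rfl fun i _ => ?_
        have h' : (ζ i * u i none : ℂ) = d * u i none + ((∑ j, √(w j) * u i (some j) : ℝ) : ℂ) := by
          exact_mod_cast (h0 i).symm
        rw [h', mul_add, add_div]
        push_cast
        rw [Finset.mul_sum, Finset.sum_div]
        congr 1
        · ring
        · exact Finset.sum_congr rfl fun j _ => by ring
      rw [this] at h
      simp at h
      linear_combination h
    have hψ0 : ψ none = ∑ i, ((u i none ^ 2 : ℝ) : ℂ) / (x - ζ i) := by
      simp [ψ, sq]
    have hsum : ∑ j, (√(w j) : ℝ) * ψ (some j) = ψ none * ∑ j, (w j : ℂ) / (x - y j) := by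
      rw [Finset.mul_sum]
      refine Finset.sum_congr rfl fun j _ => ?_
      have h1 : ψ (some j) = (√(w j) : ℝ) * ψ none / (x - y j) := by
        rw [eq_div_iff (hne _), mul_comm, e1]
      have h2 : ((√(w j) : ℝ) : ℂ) * (√(w j) : ℝ) = w j := by
        exact_mod_cast Real.mul_self_sqrt (hw j)
      rw [h1, ← h2]; ring
    rw [← hψ0, ← e0, hsum]
    ring

/-- A real quadratic that is nonpositive at the poles and at the zeros of the Pick function
`z - d - ∑ w j / (z - y j)`, divided by this function. -/
theorem mul_im_le_im_quadratic_div {ι : Type*} [Fintype ι] (w y : ι → ℝ) (hw : ∀ j, 0 ≤ w j)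
    (d c₂ c₁ c₀ : ℝ) (hy : ∀ j, c₂ * y j ^ 2 + c₁ * y j + c₀ ≤ 0)
    (hF : ∀ ζ : ℝ, 0 < c₂ * ζ ^ 2 + c₁ * ζ + c₀ → ζ - d - ∑ j, w j / (ζ - y j) ≠ 0)
    (x : ℂ) (hx : 0 < x.im) :
    c₂ * x.im ≤
      ((c₂ * x ^ 2 + c₁ * x + c₀) / (x - d - ∑ j, (w j : ℂ) / (x - y j))).im := by
  obtain ⟨η, ζ, hη, hsum, hroot, hinv⟩ := exists_partialFraction_inv w y hw d
  have hne : ∀ s : ℝ, x - (s : ℂ) ≠ 0 := by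
    intro s h
    have := congrArg Complex.im h
    simp at this
    exact hx.ne' this
  have hq : ∀ i, η i ≠ 0 → c₂ * ζ i ^ 2 + c₁ * ζ i + c₀ ≤ 0 := by
    intro i hi
    by_contra! h
    refine hF _ h (hroot i hi fun j hj => ?_)
    have := hy j
    rw [← hj] at this
    linarith
  rw [div_eq_mul_inv, ← eq_inv_of_mul_eq_one_left (hinv x hx), Finset.mul_sum, Complex.im_sum]
  calc c₂ * x.im = ∑ i, η i * (c₂ * x.im) := by rw [← Finset.sum_mul, hsum, one_mul]
    _ ≤ _ := Finset.sum_le_sum fun i _ => ?_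
  by_cases hi : η i = 0
  · simp [hi]
  have e : (c₂ * x ^ 2 + c₁ * x + c₀ : ℂ) * (η i / (x - ζ i)) =
      ((η i : ℝ) : ℂ) * (((c₂ * ζ i ^ 2 + c₁ * ζ i + c₀ : ℝ) : ℂ) * (x - ζ i)⁻¹ +
        (c₂ * x + ((c₂ * ζ i + c₁ : ℝ) : ℂ))) := by
    have := hne (ζ i)
    field_simp
    push_cast
    ring
  rw [e, Complex.im_ofReal_mul]
  refine mul_le_mul_of_nonneg_left ?_ (hη i)
  rw [Complex.add_im, Complex.add_im, Complex.im_ofReal_mul, Complex.im_ofReal_mul,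
    Complex.ofReal_im, Complex.inv_im]
  have h1 : 0 ≤ (x - ζ i).im / Complex.normSq (x - ζ i) :=
    div_nonneg (by simpa using hx.le) (Complex.normSq_nonneg _)
  have h2 := mul_nonneg (neg_nonneg.2 (hq i hi)) h1
  rw [neg_div]
  linarith

/-- Gradient estimate for the real part of a holomorphic function bounded above on a ball. -/
theorem norm_deriv_le_of_re_le {D : ℂ → ℂ} {c : ℂ} {R M : ℝ} (hR : 0 < R)
    (hD : DifferentiableOn ℂ D (Metric.ball c R)) (hM : ∀ z ∈ Metric.ball c R, (D z).re ≤ M)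
    {D' : ℂ} (hD' : HasDerivAt D D' c) : ‖D'‖ * R ≤ 2 * (M - (D c).re) := by
  have hmem : ∀ z ∈ Metric.ball (0 : ℂ) R, c + z ∈ Metric.ball c R := fun z hz => by
    simpa using hz
  have key : ∀ e : ℝ, 0 < e → ‖D'‖ * R ≤ 2 * (M - (D c).re + e) := by
    intro e he
    have hpos : 0 < M - (D c).re + e := by
      have := hM c (Metric.mem_ball_self hR)
      linarith
    have hg : HasDerivAt (fun z => D (c + z) - D c) D' 0 := by
      have h1 : HasDerivAt D D' (c + 0) := by simpa using hD'
      have := h1.comp_const_add c 0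
      simpa using this.sub_const (D c)
    have hs := hg.tendsto_slope
    have hev : ∀ᶠ z : ℂ in 𝓝[≠] 0, ‖slope (fun z => D (c + z) - D c) 0 z‖ * (R - ‖z‖) ≤
        2 * (M - (D c).re + e) := by
      have : ∀ᶠ z : ℂ in 𝓝[≠] 0, z ∈ Metric.ball (0 : ℂ) R :=
        nhdsWithin_le_nhds (Metric.ball_mem_nhds _ hR)
      filter_upwards [this, self_mem_nhdsWithin] with z hz hz0
      have hb := Complex.borelCaratheodory (f := fun z => D (c + z) - D c) (R := R) (z := z) hpos
        ?_ ?_ hR hz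
      · simp only [add_zero, sub_self, norm_zero, zero_mul, zero_div] at hb
        have hzn : 0 < ‖z‖ := norm_pos_iff.2 hz0
        have hRz : 0 < R - ‖z‖ := by simpa using hz
        simp only [slope, vsub_eq_sub, sub_zero, add_zero, sub_self, smul_eq_mul, norm_mul, norm_inv]
        rw [le_div_iff₀ hRz] at hb
        rw [inv_mul_eq_div, div_mul_eq_mul_div, div_le_iff₀ hzn]
        exact hb
      · exact (hD.comp (by fun_prop) hmem).sub_const _
      · intro w hw
        have := hM _ (hmem w hw)
        simp only [Set.mem_ofPred_eq, Complex.sub_re]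
        linarith
    have hlim : Tendsto (fun z : ℂ => ‖slope (fun z => D (c + z) - D c) 0 z‖ * (R - ‖z‖)) (𝓝[≠] 0)
        (𝓝 (‖D'‖ * (R - ‖(0 : ℂ)‖))) :=
      hs.norm.mul (tendsto_const_nhds.sub (tendsto_norm.mono_left nhdsWithin_le_nhds |>.trans
        (by simp)))
    simpa using le_of_tendsto hlim hev
  refine le_of_forall_pos_le_add fun e he => ?_
  have := key (e / 2) (by positivity)
  linarith

theorem norm_log_sub_log_le {ε : ℝ} (hε : 0 < ε) {a b : ℂ} (ha : ε ≤ a.im) (hb : ε ≤ b.im) :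
    ‖Complex.log a - Complex.log b‖ ≤ ε⁻¹ * ‖a - b‖ := by
  have hconv : Convex ℝ {z : ℂ | ε ≤ z.im} := convex_halfSpace_im_ge ε
  refine hconv.norm_image_sub_le_of_norm_hasDerivWithin_le (f' := fun z => z⁻¹)
    (fun z hz => ?_) (fun z hz => ?_) hb ha
  · refine (Complex.hasDerivAt_log ?_).hasDerivWithinAt
    exact Or.inr (hε.trans_le hz).ne'
  · rw [norm_inv]
    exact inv_anti₀ hε (hz.trans ((le_abs_self _).trans (Complex.abs_im_le_norm z)))

theorem norm_log_sub_log_sub_le {ε : ℝ} (hε : 0 < ε) {a b : ℂ} (ha : ε ≤ a.im) (hb : ε ≤ b.im) :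
    ‖Complex.log a - Complex.log b - (a - b) / b‖ ≤ ε⁻¹ ^ 2 * ‖a - b‖ ^ 2 := by
  have hle : ∀ z : ℂ, ε ≤ z.im → ε ≤ ‖z‖ := fun z hz =>
    hz.trans ((le_abs_self _).trans (Complex.abs_im_le_norm z))
  have hne : ∀ z : ℂ, ε ≤ z.im → z ≠ 0 := fun z hz h => by simp [h] at hz; linarith
  have hconv : Convex ℝ (segment ℝ b a) := convex_segment _ _
  have hsub : segment ℝ b a ⊆ {z : ℂ | ε ≤ z.im} :=
    (convex_halfSpace_im_ge ε).segment_subset hb ha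
  have h := hconv.norm_image_sub_le_of_norm_hasDerivWithin_le
    (f := fun z => Complex.log z - z / b) (f' := fun z => z⁻¹ - 1 / b)
    (C := ε⁻¹ ^ 2 * ‖a - b‖)
    (fun z hz => ?_) (fun z hz => ?_) (left_mem_segment ℝ b a) (right_mem_segment ℝ b a)
  · refine le_trans (le_of_eq ?_) (h.trans_eq (by ring))
    congr 1
    ring
  · refine ((Complex.hasDerivAt_log ?_).sub ((hasDerivAt_id z).div_const b)).hasDerivWithinAt
    exact Or.inr (hε.trans_le (hsub hz)).ne'
  · have hz' := hsub hz
    have e : z⁻¹ - 1 / b = (b - z) * z⁻¹ * b⁻¹ := by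
      have := hne z hz'
      have := hne b hb
      field_simp
    rw [e, norm_mul, norm_mul, norm_inv, norm_inv]
    have h1 : ‖b - z‖ ≤ ‖a - b‖ := by
      obtain ⟨θ, hθ, rfl⟩ := (segment_eq_image' ℝ b a) ▸ hz
      simp only [sub_add_cancel_left, norm_neg, norm_smul, Real.norm_eq_abs, abs_of_nonneg hθ.1]
      exact mul_le_of_le_one_left (norm_nonneg _) hθ.2
    calc ‖b - z‖ * ‖z‖⁻¹ * ‖b‖⁻¹ ≤ ‖a - b‖ * ε⁻¹ * ε⁻¹ := by
          gcongr
          · exact hle z hz'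
          · exact hle b hb
      _ = _ := by ring

/-- A quadratic remainder bound, uniform along a filter, passes to the limit as a derivative. -/
theorem hasDerivAt_of_sq_bound {D : ℂ → ℂ} {c D' : ℂ} {C : ℝ}
    (h : ∀ᶠ z in 𝓝 c, ‖D z - D c - D' * (z - c)‖ ≤ C * ‖z - c‖ ^ 2) : HasDerivAt D D' c := by
  rw [hasDerivAt_iff_isLittleO]
  have h1 : (fun z => D z - D c - (z - c) • D') =O[𝓝 c] fun z => ‖z - c‖ ^ 2 := by
    refine Asymptotics.IsBigO.of_bound C ?_
    filter_upwards [h] with z hz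
    simpa [mul_comm] using hz
  refine h1.trans_isLittleO ?_
  have h2 : (fun z : ℂ => ‖z - c‖ ^ 2) =o[𝓝 c] fun z => ‖z - c‖ ^ 1 :=
    (Asymptotics.isLittleO_pow_pow one_lt_two).comp_tendsto
      (k := fun z : ℂ => ‖z - c‖) (by
        have : Continuous fun z : ℂ => ‖z - c‖ := by fun_prop
        simpa using this.tendsto c)
  simpa using h2.trans_isBigO (by simpa using Asymptotics.isBigO_refl _ _)

/-- Interlacing zeros `x` and a monotone, regularly varying scale `φ` such that the zeros of index
at most `n`, divided by `φ n`, lie in `[p, q]`. -/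
structure ScaledZeros (x : ℕ → ℕ → ℝ) (φ : ℕ → ℝ) (σ p q : ℝ) : Prop where
  interlace : ZerosInterlace x
  pos : ∀ n, 1 ≤ n → 0 < φ n
  mono : ∀ m n, 1 ≤ m → m ≤ n → φ m ≤ φ n
  regvar : IsRegularlyVarying φ σ
  mem : ∀ n N j, N ≤ n → 1 ≤ j → j ≤ N → x N j / φ n ∈ Set.Icc p q

/-- The function `ψ` integrated against `1 / n` times the counting measure of the zeros of index
`N`, divided by `φ n`. -/
noncomputable def scaledMean (x : ℕ → ℕ → ℝ) (φ : ℕ → ℝ) (n N : ℕ) (ψ : ℝ → ℂ) : ℂ :=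
  (n : ℂ)⁻¹ * ∑ j ∈ Finset.Icc 1 N, ψ (x N j / φ n)

/-- `ψ` is bounded by `M` and `Λ`-Lipschitz on `[p, q]`. -/
structure BddLipschitz (p q M Λ : ℝ) (ψ : ℝ → ℂ) : Prop where
  nonneg : 0 ≤ Λ
  bound : ∀ u ∈ Set.Icc p q, ‖ψ u‖ ≤ M
  lip : ∀ u ∈ Set.Icc p q, ∀ v ∈ Set.Icc p q, ‖ψ u - ψ v‖ ≤ Λ * |u - v|

theorem norm_sum_sub_sum_le_of_interlace {y z : ℕ → ℝ} {k : ℕ}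
    (hyz : ∀ j, 1 ≤ j → j ≤ k → z j ≤ y j ∧ y j ≤ z (j + 1)) {ψ : ℝ → ℂ} {p q M Λ : ℝ} (hΛ : 0 ≤ Λ)
    (hp : p ≤ z 1) (hq : z (k + 1) ≤ q) (hM : ‖ψ (z (k + 1))‖ ≤ M)
    (hlip : ∀ j, 1 ≤ j → j ≤ k → ‖ψ (z j) - ψ (y j)‖ ≤ Λ * |z j - y j|) :
    ‖∑ j ∈ Finset.Icc 1 (k + 1), ψ (z j) - ∑ j ∈ Finset.Icc 1 k, ψ (y j)‖ ≤ M + Λ * (q - p) := by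
  have h : ∀ m, m ≤ k → ‖∑ j ∈ Finset.Icc 1 m, (ψ (z j) - ψ (y j))‖ ≤ Λ * (z (m + 1) - z 1) := by
    intro m
    induction m with
    | zero => simp
    | succ m ih =>
      intro hm
      rw [Finset.sum_Icc_succ_top (by omega)]
      obtain ⟨h1, h2⟩ := hyz (m + 1) (by omega) hm
      have h3 := hlip (m + 1) (by omega) hm
      rw [abs_of_nonpos (by linarith)] at h3
      have h4 : Λ * -(z (m + 1) - y (m + 1)) ≤ Λ * (z (m + 1 + 1) - z (m + 1)) :=
        mul_le_mul_of_nonneg_left (by linarith) hΛ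
      calc _ ≤ _ := norm_add_le _ _
        _ ≤ Λ * (z (m + 1) - z 1) + Λ * (z (m + 1 + 1) - z (m + 1)) :=
          add_le_add (ih (by omega)) (h3.trans h4)
        _ = _ := by ring
  rw [Finset.sum_Icc_succ_top (by omega), add_sub_right_comm, ← Finset.sum_sub_distrib, add_comm]
  refine (norm_add_le _ _).trans (add_le_add hM ((h k le_rfl).trans ?_))
  exact mul_le_mul_of_nonneg_left (by linarith) hΛ

namespace ScaledZeros

variable {x : ℕ → ℕ → ℝ} {φ : ℕ → ℝ} {σ p q : ℝ}

theorem le (h : ScaledZeros x φ σ p q) : p ≤ q := by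
  have := h.mem 1 1 1 le_rfl le_rfl le_rfl
  exact this.1.trans this.2

theorem scaled_interlace (h : ScaledZeros x φ σ p q) {n : ℕ} (hn : 1 ≤ n) (k j : ℕ) (hj : 1 ≤ j)
    (hjk : j ≤ k) : x (k + 1) j / φ n ≤ x k j / φ n ∧ x k j / φ n ≤ x (k + 1) (j + 1) / φ n := by
  obtain ⟨h1, h2⟩ := h.interlace k j hj hjk
  have := (h.pos n hn).le
  exact ⟨div_le_div_of_nonneg_right h1 this, div_le_div_of_nonneg_right h2 this⟩

theorem norm_scaledMean_le (h : ScaledZeros x φ σ p q) {M Λ : ℝ} {ψ : ℝ → ℂ}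
    (hψ : BddLipschitz p q M Λ ψ) {n N : ℕ} (hN : N ≤ n) :
    ‖scaledMean x φ n N ψ‖ ≤ M * (N / n) := by
  rw [scaledMean, norm_mul, norm_inv, Complex.norm_natCast]
  have : ‖∑ j ∈ Finset.Icc 1 N, ψ (x N j / φ n)‖ ≤ N * M := by
    have h1 : ∀ j ∈ Finset.Icc 1 N, ‖ψ (x N j / φ n)‖ ≤ M := fun j hj => by
      rw [Finset.mem_Icc] at hj
      exact hψ.bound _ (h.mem n N j hN hj.1 hj.2)
    simpa using norm_sum_le_of_le _ h1
  calc _ ≤ (n : ℝ)⁻¹ * (N * M) := by gcongr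
    _ = _ := by ring

theorem norm_sum_succ_sub_le (h : ScaledZeros x φ σ p q) {M Λ : ℝ} {ψ : ℝ → ℂ}
    (hψ : BddLipschitz p q M Λ ψ) {n k : ℕ} (hk : k + 1 ≤ n) :
    ‖∑ j ∈ Finset.Icc 1 (k + 1), ψ (x (k + 1) j / φ n) - ∑ j ∈ Finset.Icc 1 k, ψ (x k j / φ n)‖ ≤
      M + Λ * (q - p) := by
  refine norm_sum_sub_sum_le_of_interlace (y := fun j => x k j / φ n)
    (z := fun j => x (k + 1) j / φ n) (fun j => h.scaled_interlace (by omega) k j) hψ.nonneg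
    (h.mem n (k + 1) 1 hk le_rfl (by omega)).1 (h.mem n (k + 1) (k + 1) hk (by omega) le_rfl).2
    (hψ.bound _ (h.mem n (k + 1) (k + 1) hk (by omega) le_rfl)) fun j hj hjk => ?_
  exact hψ.lip _ (h.mem n (k + 1) j hk hj (by omega)) _ (h.mem n k j (by omega) hj hjk)

theorem norm_scaledMean_sub_le_of_le (h : ScaledZeros x φ σ p q) {M Λ : ℝ} {ψ : ℝ → ℂ}
    (hψ : BddLipschitz p q M Λ ψ) {n N N' : ℕ} (hN : N ≤ N') (hN' : N' ≤ n) :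
    ‖scaledMean x φ n N' ψ - scaledMean x φ n N ψ‖ ≤ (M + Λ * (q - p)) * (((N' : ℝ) - N) / n) := by
  induction N', hN using Nat.le_induction with
  | base => simp
  | succ m hm ih =>
    have h1 := ih (by omega)
    have h2 : ‖scaledMean x φ n (m + 1) ψ - scaledMean x φ n m ψ‖ ≤
        (M + Λ * (q - p)) * (1 / n) := by
      rw [scaledMean, scaledMean, ← mul_sub, norm_mul, norm_inv, Complex.norm_natCast]
      rw [mul_comm, mul_one_div, div_eq_mul_inv]
      exact mul_le_mul_of_nonneg_right (h.norm_sum_succ_sub_le hψ hN') (by positivity)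
    calc _ = ‖(scaledMean x φ n (m + 1) ψ - scaledMean x φ n m ψ) +
          (scaledMean x φ n m ψ - scaledMean x φ n N ψ)‖ := by congr 1; ring
      _ ≤ _ := (norm_add_le _ _).trans (add_le_add h2 h1)
      _ = _ := by push_cast; ring

theorem norm_scaledMean_sub_le (h : ScaledZeros x φ σ p q) {M Λ : ℝ} {ψ : ℝ → ℂ}
    (hψ : BddLipschitz p q M Λ ψ) {n N N' : ℕ} (hN : N ≤ n) (hN' : N' ≤ n) :
    ‖scaledMean x φ n N' ψ - scaledMean x φ n N ψ‖ ≤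
      (M + Λ * (q - p)) * |(N' : ℝ) / n - N / n| := by
  rcases le_total N N' with hle | hle
  · rw [← sub_div, abs_of_nonneg (by
      have : (N : ℝ) ≤ N' := by exact_mod_cast hle
      have := sub_nonneg.2 this
      positivity)]
    exact h.norm_scaledMean_sub_le_of_le hψ hle hN'
  · rw [norm_sub_rev, abs_sub_comm, ← sub_div, abs_of_nonneg (by
      have : (N' : ℝ) ≤ N := by exact_mod_cast hle
      have := sub_nonneg.2 this
      positivity)]
    exact h.norm_scaledMean_sub_le_of_le hψ hle hN

/-- The defining limit of regular variation is uniform. -/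
theorem tendsto_scale_div (h : ScaledZeros x φ σ p q) {ι : Type*} {l : Filter ι} {n k : ι → ℕ}
    {t : ℝ} (ht : 0 < t) (hn : Tendsto n l atTop)
    (hk : Tendsto (fun i => (k i : ℝ) / n i) l (𝓝 t)) :
    Tendsto (fun i => φ (k i) / φ (n i)) l (𝓝 (t ^ σ)) := by
  obtain ⟨hσ, L, hL, hlim⟩ := h.regvar
  have hfl : ∀ s : ℝ, 0 < s →
      Tendsto (fun i => φ ⌊(n i : ℝ) * s⌋₊ / φ (n i)) l (𝓝 (s ^ σ)) := by
    intro s hs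
    have h1 : Tendsto (fun m : ℕ => (⌊(m : ℝ) * s⌋₊ : ℝ) / m) atTop (𝓝 s) := by
      have := (tendsto_nat_floor_mul_div_atTop (R := ℝ) hs.le).comp tendsto_natCast_atTop_atTop
      refine this.congr fun m => ?_
      simp [mul_comm]
    have h2 : Tendsto (fun m : ℕ => ((⌊(m : ℝ) * s⌋₊ : ℝ) / m) ^ σ *
        (L ⌊(m : ℝ) * s⌋₊ / L m)) atTop (𝓝 (s ^ σ * 1)) :=
      (h1.rpow_const (Or.inl hs.ne')).mul (hlim s hs)
    rw [mul_one] at h2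
    refine (h2.comp hn).congr' ?_
    have hge : ∀ᶠ m : ℕ in atTop, 1 ≤ m ∧ 1 ≤ ⌊(m : ℝ) * s⌋₊ := by
      have : Tendsto (fun m : ℕ => ⌊(m : ℝ) * s⌋₊) atTop atTop :=
        tendsto_nat_floor_atTop.comp (tendsto_natCast_atTop_atTop.atTop_mul_const hs)
      exact (eventually_ge_atTop 1).and (this.eventually_ge_atTop 1)
    filter_upwards [hn.eventually hge] with i hi
    simp only [Function.comp]
    rw [hL _ hi.1, hL _ hi.2, Real.div_rpow (by positivity) (by positivity)]
    ring
  have hge : ∀ s : ℝ, 0 < s → ∀ᶠ i in l, 1 ≤ n i ∧ 1 ≤ ⌊(n i : ℝ) * s⌋₊ := by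
    intro s hs
    have : Tendsto (fun i => ⌊(n i : ℝ) * s⌋₊) l atTop :=
      tendsto_nat_floor_atTop.comp ((tendsto_natCast_atTop_atTop.comp hn).atTop_mul_const hs)
    exact (hn.eventually_ge_atTop 1).and (this.eventually_ge_atTop 1)
  have hcont : ContinuousAt (fun s : ℝ => s ^ σ) t := Real.continuousAt_rpow_const _ _ (Or.inl ht.ne')
  rw [tendsto_order]
  constructor
  · intro c hc
    obtain ⟨s, hs0, hst, hsc⟩ : ∃ s, 0 < s ∧ s < t ∧ c < s ^ σ := by
      have h1 : ∀ᶠ s in 𝓝[<] t, c < s ^ σ ∧ 0 < s ∧ s < t :=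
        ((hcont.eventually (lt_mem_nhds hc)).filter_mono nhdsWithin_le_nhds).and
          ((Filter.Eventually.filter_mono nhdsWithin_le_nhds (lt_mem_nhds ht)).and
            self_mem_nhdsWithin)
      obtain ⟨s, hs⟩ := h1.exists
      exact ⟨s, hs.2.1, hs.2.2, hs.1⟩
    filter_upwards [(hfl s hs0).eventually (lt_mem_nhds hsc), hk.eventually (lt_mem_nhds hst),
      hge s hs0] with i h1 h2 h3
    refine h1.trans_le (div_le_div_of_nonneg_right (h.mono _ _ h3.2 ?_) (h.pos _ h3.1).le)
    have hpos : (0 : ℝ) < n i := by exact_mod_cast h3.1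
    rw [lt_div_iff₀ hpos] at h2
    exact Nat.floor_le_of_le (by linarith)
  · intro c hc
    obtain ⟨s, hst, hsc⟩ : ∃ s, t < s ∧ s ^ σ < c := by
      have h1 : ∀ᶠ s in 𝓝[>] t, s ^ σ < c ∧ t < s :=
        ((hcont.eventually (gt_mem_nhds hc)).filter_mono nhdsWithin_le_nhds).and
          self_mem_nhdsWithin
      obtain ⟨s, hs⟩ := h1.exists
      exact ⟨s, hs.2, hs.1⟩
    have hs0 := ht.trans hst
    filter_upwards [(hfl s hs0).eventually (gt_mem_nhds hsc), hk.eventually (gt_mem_nhds hst),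
      hk.eventually (lt_mem_nhds ht), hge s hs0] with i h1 h2 h4 h3
    have hpos : (0 : ℝ) < n i := by exact_mod_cast h3.1
    refine lt_of_le_of_lt (div_le_div_of_nonneg_right (h.mono _ _ ?_ ?_) (h.pos _ h3.1).le) h1
    · by_contra! h0
      have : k i = 0 := by omega
      simp [this] at h4
    · rw [div_lt_iff₀ hpos] at h2
      exact Nat.le_floor (by linarith)

end ScaledZeros

theorem BddLipschitz.cauchyKernel {p q δ : ℝ} (hδ : 0 < δ) {z : ℂ}
    (hz : ∀ u ∈ Set.Icc p q, δ ≤ ‖z - u‖) :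
    BddLipschitz p q δ⁻¹ (δ⁻¹ ^ 2) fun u => (z - u)⁻¹ := by
  refine ⟨by positivity, fun u hu => ?_, fun u hu v hv => ?_⟩
  · rw [norm_inv]
    exact inv_anti₀ hδ (hz u hu)
  · have hu' := hz u hu
    have hv' := hz v hv
    have hu0 : z - u ≠ 0 := norm_pos_iff.1 (hδ.trans_le hu')
    have hv0 : z - v ≠ 0 := norm_pos_iff.1 (hδ.trans_le hv')
    have e : (z - u)⁻¹ - (z - v)⁻¹ = ((u - v : ℝ) : ℂ) * (z - u)⁻¹ * (z - v)⁻¹ := by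
      push_cast; field_simp; ring
    rw [e, norm_mul, norm_mul, norm_inv, norm_inv, Complex.norm_real, Real.norm_eq_abs]
    calc _ ≤ |u - v| * δ⁻¹ * δ⁻¹ := by gcongr
      _ = _ := by ring

theorem le_norm_sub_ofReal {ε : ℝ} {z : ℂ} (hz : ε ≤ z.im) (u : ℝ) : ε ≤ ‖z - u‖ := by
  have := (le_abs_self _).trans (Complex.abs_im_le_norm (z - u))
  simp at this
  exact hz.trans this

theorem BddLipschitz.logKernel {p q ε T : ℝ} (hε : 0 < ε) {z : ℂ} (hz : ε ≤ z.im)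
    (hT : ‖z‖ ≤ T) :
    BddLipschitz p q (|Real.log ε| + |Real.log (T + max |p| |q|)| + Real.pi) ε⁻¹
      fun u => Complex.log (z - u) := by
  refine ⟨by positivity, fun u hu => ?_, fun u hu v hv => ?_⟩
  · have h1 := le_norm_sub_ofReal hz u
    have h2 : ‖z - u‖ ≤ T + max |p| |q| := by
      refine (norm_sub_le _ _).trans (add_le_add hT ?_)
      rw [Complex.norm_real, Real.norm_eq_abs]
      exact abs_le_max_abs_abs hu.1 hu.2
    refine (Complex.norm_le_abs_re_add_abs_im _).trans (add_le_add ?_ ?_)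
    · rw [Complex.log_re]
      have h3 := Real.log_le_log hε h1
      have h4 := Real.log_le_log (hε.trans_le h1) h2
      rw [abs_le]
      have := neg_abs_le (Real.log ε)
      have := le_abs_self (Real.log (T + max |p| |q|))
      have := abs_nonneg (Real.log ε)
      have := abs_nonneg (Real.log (T + max |p| |q|))
      constructor <;> linarith
    · rw [Complex.log_im]
      exact Complex.abs_arg_le_pi _
  · refine (norm_log_sub_log_le hε (by simpa using hz) (by simpa using hz)).trans_eq ?_
    rw [sub_sub_sub_cancel_left, ← Complex.ofReal_sub, Complex.norm_real, Real.norm_eq_abs,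
      abs_sub_comm]

/-- The coefficients of a real quadratic `a₂ z² + a₁ z + a₀` and a real affine function
`b₁ z + b₀`. -/
structure Coeffs where
  /-- the coefficient of `z²` in the quadratic -/
  a₂ : ℝ
  /-- the coefficient of `z` in the quadratic -/
  a₁ : ℝ
  /-- the constant coefficient of the quadratic -/
  a₀ : ℝ
  /-- the coefficient of `z` in the affine function -/
  b₁ : ℝ
  /-- the constant coefficient of the affine function -/
  b₀ : ℝ

namespace Coeffs

/-- The quadratic with the given coefficients on the real line. -/
def realQuad (c : Coeffs) (y : ℝ) : ℝ := c.a₂ * y ^ 2 + c.a₁ * y + c.a₀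

/-- The quadratic with the given coefficients. -/
def quad (c : Coeffs) (z : ℂ) : ℂ := c.a₂ * z ^ 2 + c.a₁ * z + c.a₀

/-- The affine function with the given coefficients. -/
def lin (c : Coeffs) (z : ℂ) : ℂ := c.b₁ * z + c.b₀

/-- The coefficients of `n / s² * A (s z)` and `1 / s * B (s z)`. -/
noncomputable def scale (c : Coeffs) (n : ℕ) (s : ℝ) : Coeffs :=
  ⟨n * c.a₂, n * c.a₁ / s, n * c.a₀ / s ^ 2, c.b₁, c.b₀ / s⟩

/-- The coefficients of `t^{2σ-1} a(z t^{-σ})` and `t^σ b(z t^{-σ})`. -/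
noncomputable def dilate (c : Coeffs) (σ t : ℝ) : Coeffs :=
  ⟨c.a₂ / t, c.a₁ * t ^ σ / t, c.a₀ * (t ^ σ) ^ 2 / t, c.b₁, c.b₀ * t ^ σ⟩

theorem quad_ofReal (c : Coeffs) (y : ℝ) : c.quad y = c.realQuad y := by
  simp [quad, realQuad]

/-- Convergence of all coefficients. -/
structure ConvergesTo {ι : Type*} (s : ι → Coeffs) (l : Filter ι) (c : Coeffs) : Prop where
  a₂ : Tendsto (fun i => (s i).a₂) l (𝓝 c.a₂)
  a₁ : Tendsto (fun i => (s i).a₁) l (𝓝 c.a₁)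
  a₀ : Tendsto (fun i => (s i).a₀) l (𝓝 c.a₀)
  b₁ : Tendsto (fun i => (s i).b₁) l (𝓝 c.b₁)
  b₀ : Tendsto (fun i => (s i).b₀) l (𝓝 c.b₀)

namespace ConvergesTo

variable {ι : Type*} {s : ι → Coeffs} {l : Filter ι} {c : Coeffs}

theorem quad (h : ConvergesTo s l c) (z : ℂ) : Tendsto (fun i => (s i).quad z) l (𝓝 (c.quad z)) :=
  ((((Complex.continuous_ofReal.tendsto _).comp h.a₂).mul_const _).add
    (((Complex.continuous_ofReal.tendsto _).comp h.a₁).mul_const _)).add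
    ((Complex.continuous_ofReal.tendsto _).comp h.a₀)

theorem lin (h : ConvergesTo s l c) (z : ℂ) : Tendsto (fun i => (s i).lin z) l (𝓝 (c.lin z)) :=
  (((Complex.continuous_ofReal.tendsto _).comp h.b₁).mul_const _).add
    ((Complex.continuous_ofReal.tendsto _).comp h.b₀)

theorem realQuad_sub_le (h : ConvergesTo s l c) {θ : ℝ} (hθ : 0 < θ) (R : ℝ) :
    ∀ᶠ i in l, ∀ y : ℝ, |y| ≤ R → |c.realQuad y - (s i).realQuad y| ≤ θ := by
  have h1 : Tendsto (fun i => |c.a₂ - (s i).a₂| * R ^ 2 + |c.a₁ - (s i).a₁| * R +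
      |c.a₀ - (s i).a₀|) l (𝓝 (|c.a₂ - c.a₂| * R ^ 2 + |c.a₁ - c.a₁| * R + |c.a₀ - c.a₀|)) :=
    (((h.a₂.const_sub _).abs.mul_const _).add ((h.a₁.const_sub _).abs.mul_const _)).add
      (h.a₀.const_sub _).abs
  simp only [sub_self, abs_zero, zero_mul, add_zero] at h1
  filter_upwards [h1.eventually (gt_mem_nhds hθ)] with i hi y hy
  have e : c.realQuad y - (s i).realQuad y =
      (c.a₂ - (s i).a₂) * y ^ 2 + (c.a₁ - (s i).a₁) * y + (c.a₀ - (s i).a₀) := by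
    simp only [realQuad]; ring
  have hsq : |y ^ 2| ≤ R ^ 2 := by
    rw [abs_pow]; gcongr
  rw [e]
  calc _ ≤ |c.a₂ - (s i).a₂| * |y ^ 2| + |c.a₁ - (s i).a₁| * |y| + |c.a₀ - (s i).a₀| := by
        rw [← abs_mul, ← abs_mul]
        exact (abs_add_le _ _).trans (add_le_add_left (abs_add_le _ _) _)
    _ ≤ _ := by
        refine le_trans ?_ hi.le
        gcongr

end ConvergesTo

end Coeffs

/-- The monic polynomials with zeros `x k 1, …, x k k` satisfy the differential-difference
equation with coefficients `c k`, and these have the scaling limits `C`. -/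
structure RealRecurrence (x : ℕ → ℕ → ℝ) (φ : ℕ → ℝ) (c : ℕ → Coeffs) (C : Coeffs) : Prop where
  eq : ∀ k (w : ℂ), (∀ j ∈ Finset.Icc 1 k, w - x k j ≠ 0) →
    ∏ j ∈ Finset.Icc 1 (k + 1), (w - x (k + 1) j) =
      ((c k).quad w * ∑ j ∈ Finset.Icc 1 k, (w - x k j)⁻¹ + (c k).lin w) *
        ∏ j ∈ Finset.Icc 1 k, (w - x k j)
  lead : ∀ k, k * (c k).a₂ + (c k).b₁ = 1
  tendsto : Coeffs.ConvergesTo (fun k => (c k).scale k (φ k)) atTop C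

/-- The quotient of the monic polynomials with zeros `x (k + 1) j / φ n` and `x k j / φ n`. -/
noncomputable def zeroRatio (x : ℕ → ℕ → ℝ) (φ : ℕ → ℝ) (n k : ℕ) (z : ℂ) : ℂ :=
  (∏ j ∈ Finset.Icc 1 (k + 1), (z - (x (k + 1) j / φ n : ℝ))) /
    ∏ j ∈ Finset.Icc 1 k, (z - (x k j / φ n : ℝ))

theorem sub_ofReal_ne_zero {z : ℂ} (hz : 0 < z.im) (u : ℝ) : z - (u : ℂ) ≠ 0 := by
  intro h
  have := congrArg Complex.im h
  simp at this
  exact hz.ne' this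

theorem monotone_im_log_sub {w : ℂ} (hw : 0 < w.im) :
    Monotone fun u : ℝ => (Complex.log (w - u)).im := by
  have hd : ∀ u : ℝ, HasDerivAt (fun u : ℝ => (Complex.log (w - u)).im)
      (-1 / (w - u) : ℂ).im u := by
    intro u
    have h1 : HasDerivAt (fun u : ℝ => w - (u : ℂ)) (-1) u := by
      simpa using (Complex.ofRealCLM.hasDerivAt (x := u)).const_sub w
    have h2 := h1.clog_real (Or.inr (by simpa using hw.ne'))
    exact (Complex.imCLM.hasFDerivAt.comp_hasDerivAt u h2)
  refine monotone_of_deriv_nonneg (fun u => (hd u).differentiableAt) fun u => ?_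
  rw [(hd u).deriv, neg_div, one_div, Complex.neg_im, Complex.inv_im]
  simp only [Complex.sub_im, Complex.ofReal_im, sub_zero, neg_div, neg_neg]
  exact div_nonneg hw.le (Complex.normSq_nonneg _)

theorem im_prod_div_prod_pos {y z : ℕ → ℝ} {k : ℕ}
    (hyz : ∀ j, 1 ≤ j → j ≤ k → z j ≤ y j ∧ y j ≤ z (j + 1)) {w : ℂ} (hw : 0 < w.im) :
    0 < ((∏ j ∈ Finset.Icc 1 (k + 1), (w - z j)) / ∏ j ∈ Finset.Icc 1 k, (w - y j)).im := by
  set A : ℝ → ℂ := fun u => Complex.log (w - u) with hA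
  have hmono : Monotone fun u => (A u).im := monotone_im_log_sub hw
  have hexp : ∀ u : ℝ, Complex.exp (A u) = w - u := fun u =>
    Complex.exp_log (sub_ofReal_ne_zero hw u)
  have hpos : ∀ u : ℝ, 0 < (A u).im ∧ (A u).im < Real.pi := by
    intro u
    simp only [hA, Complex.log_im]
    have him : 0 < (w - u : ℂ).im := by simpa using hw
    refine ⟨lt_of_le_of_ne (Complex.arg_nonneg_iff.2 him.le) fun h => ?_,
      lt_of_le_of_ne (Complex.arg_le_pi _) fun h => ?_⟩
    · exact him.ne' (Complex.arg_eq_zero_iff.1 h.symm).2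
    · exact him.ne' (Complex.arg_eq_pi_iff.1 h).2
  set B : ℂ := ∑ j ∈ Finset.Icc 1 (k + 1), A (z j) - ∑ j ∈ Finset.Icc 1 k, A (y j) with hB
  have e : (∏ j ∈ Finset.Icc 1 (k + 1), (w - z j)) / ∏ j ∈ Finset.Icc 1 k, (w - y j) =
      Complex.exp B := by
    rw [hB, Complex.exp_sub, Complex.exp_sum, Complex.exp_sum]
    simp_rw [hexp]
  have hlow : ∀ m, m ≤ k → 0 < (∑ j ∈ Finset.Icc 1 (m + 1), A (z j) -
      ∑ j ∈ Finset.Icc 1 m, A (y j)).im ∧ (∑ j ∈ Finset.Icc 1 (m + 1), A (z j) -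
      ∑ j ∈ Finset.Icc 1 m, A (y j)).im ≤ (A (z (m + 1))).im := by
    intro m
    induction m with
    | zero => intro _; simpa using (hpos _).1
    | succ m ih =>
      intro hm
      obtain ⟨h1, h2⟩ := ih (by omega)
      obtain ⟨h3, h4⟩ := hyz (m + 1) (by omega) hm
      have h3' := hmono h3
      have h4' := hmono h4
      rw [Finset.sum_Icc_succ_top (by omega), Finset.sum_Icc_succ_top (b := m) (by omega)]
      simp only [Complex.sub_im, Complex.add_im] at h1 h2 h3' h4' ⊢
      rw [Finset.sum_Icc_succ_top (by omega)] at h1 h2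
      simp only [Complex.add_im] at h1 h2
      rw [Finset.sum_Icc_succ_top (by omega)]
      simp only [Complex.add_im]
      constructor <;> linarith
  obtain ⟨h1, h2⟩ := hlow k le_rfl
  rw [e, Complex.exp_im]
  exact mul_pos (Real.exp_pos _) (Real.sin_pos_of_pos_of_lt_pi h1 (h2.trans_lt (hpos _).2))

section

variable {x : ℕ → ℕ → ℝ} {φ : ℕ → ℝ} {σ p q : ℝ} {c : ℕ → Coeffs} {C : Coeffs}

theorem zeroRatio_eq (hx : ScaledZeros x φ σ p q) (hr : RealRecurrence x φ c C) {n k : ℕ}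
    (hn : 1 ≤ n) {z : ℂ} (hz : ∀ j ∈ Finset.Icc 1 k, z - (x k j / φ n : ℝ) ≠ 0) :
    zeroRatio x φ n k z =
      ((c k).scale n (φ n)).quad z * scaledMean x φ n k (fun u => (z - u)⁻¹) +
        ((c k).scale n (φ n)).lin z := by
  have hφ : (φ n : ℂ) ≠ 0 := by exact_mod_cast (hx.pos n hn).ne'
  have hn0 : (n : ℂ) ≠ 0 := by exact_mod_cast (by omega : n ≠ 0)
  have hs : ∀ m j, (φ n : ℂ) * z - x m j = φ n * (z - (x m j / φ n : ℝ)) := by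
    intro m j
    push_cast
    field_simp
  have h := hr.eq k (φ n * z) fun j hj => by
    rw [hs]; exact mul_ne_zero hφ (hz j hj)
  simp_rw [hs, Finset.prod_mul_distrib, Finset.prod_const, mul_inv, ← Finset.mul_sum] at h
  have hprod : ∏ j ∈ Finset.Icc 1 k, (z - (x k j / φ n : ℝ)) ≠ 0 := Finset.prod_ne_zero_iff.2 hz
  rw [zeroRatio, div_eq_iff hprod]
  simp only [Nat.card_Icc, add_tsub_cancel_right] at h
  have h2 : (φ n : ℂ) ^ (k + 1) * ∏ j ∈ Finset.Icc 1 (k + 1), (z - (x (k + 1) j / φ n : ℝ)) =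
      (φ n : ℂ) ^ (k + 1) * ((((c k).scale n (φ n)).quad z *
        scaledMean x φ n k (fun u => (z - u)⁻¹) + ((c k).scale n (φ n)).lin z) *
        ∏ j ∈ Finset.Icc 1 k, (z - (x k j / φ n : ℝ))) := by
    rw [h]
    simp only [Coeffs.quad, Coeffs.lin, Coeffs.scale, scaledMean]
    push_cast
    field_simp
    ring
  exact mul_left_cancel₀ (pow_ne_zero _ hφ) h2

/-- The constant term in the partial fraction expansion of `zeroRatio`. -/
noncomputable def ratioShift (x : ℕ → ℕ → ℝ) (φ : ℕ → ℝ) (c : ℕ → Coeffs) (n k : ℕ) : ℝ :=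
  -((c k).b₀ / φ n + k * (c k).a₁ / φ n + (c k).a₂ * ∑ j ∈ Finset.Icc 1 k, x k j / φ n)

/-- The weights in the partial fraction expansion of `zeroRatio`. -/
noncomputable def ratioWeight (x : ℕ → ℕ → ℝ) (φ : ℕ → ℝ) (c : ℕ → Coeffs) (n k j : ℕ) : ℝ :=
  -((c k).scale n (φ n)).realQuad (x k j / φ n) / n

theorem zeroRatio_eq_partialFraction (hx : ScaledZeros x φ σ p q) (hr : RealRecurrence x φ c C)
    {n k : ℕ} (hn : 1 ≤ n) {z : ℂ} (hz : ∀ j ∈ Finset.Icc 1 k, z - (x k j / φ n : ℝ) ≠ 0) :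
    zeroRatio x φ n k z = z - ratioShift x φ c n k -
      ∑ j ∈ Finset.Icc 1 k, (ratioWeight x φ c n k j : ℂ) / (z - (x k j / φ n : ℝ)) := by
  have hn0 : (n : ℂ) ≠ 0 := by exact_mod_cast (by omega : n ≠ 0)
  have hφ : (φ n : ℂ) ≠ 0 := by exact_mod_cast (hx.pos n hn).ne'
  rw [zeroRatio_eq hx hr hn hz, scaledMean, ← mul_assoc, Finset.mul_sum]
  have h1 : ∀ j ∈ Finset.Icc 1 k, ((c k).scale n (φ n)).quad z * (n : ℂ)⁻¹ *
      (z - (x k j / φ n : ℝ))⁻¹ =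
      -((ratioWeight x φ c n k j : ℂ) / (z - (x k j / φ n : ℝ))) +
        ((c k).a₂ * z + (c k).a₁ / φ n + (c k).a₂ * (x k j / φ n : ℝ)) := by
    intro j hj
    have hne := hz j hj
    have e : (ratioWeight x φ c n k j : ℂ) = -((c k).scale n (φ n)).quad (x k j / φ n : ℝ) / n := by
      rw [Coeffs.quad_ofReal, ratioWeight]; push_cast; ring
    rw [e]
    simp only [Coeffs.quad, Coeffs.scale]
    generalize ((x k j / φ n : ℝ) : ℂ) = y at hne ⊢
    push_cast
    field_simp
    ring
  rw [Finset.sum_congr rfl h1, Finset.sum_add_distrib, Finset.sum_neg_distrib,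
    Finset.sum_add_distrib, Finset.sum_const, ← Finset.mul_sum]
  have hl : (k : ℂ) * (c k).a₂ + (c k).b₁ = 1 := by exact_mod_cast hr.lead k
  simp only [Nat.card_Icc, add_tsub_cancel_right, nsmul_eq_mul, Coeffs.lin, Coeffs.scale,
    ratioShift]
  push_cast
  linear_combination z * hl

theorem im_zeroRatio_pos (hx : ScaledZeros x φ σ p q) {n k : ℕ} (hn : 1 ≤ n) {z : ℂ}
    (hz : 0 < z.im) : 0 < (zeroRatio x φ n k z).im :=
  im_prod_div_prod_pos (fun j hj hjk => hx.scaled_interlace hn k j hj hjk) hz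

theorem im_zeroRatio (hx : ScaledZeros x φ σ p q) (hr : RealRecurrence x φ c C) {n k : ℕ}
    (hn : 1 ≤ n) {z : ℂ} (hz : 0 < z.im) :
    (zeroRatio x φ n k z).im = z.im + ∑ j ∈ Finset.Icc 1 k,
      ratioWeight x φ c n k j * (z.im / Complex.normSq (z - (x k j / φ n : ℝ))) := by
  rw [zeroRatio_eq_partialFraction hx hr hn fun j _ => sub_ofReal_ne_zero hz _,
    Complex.sub_im, Complex.sub_im, Complex.ofReal_im, sub_zero, Complex.im_sum, sub_eq_add_neg,
    ← Finset.sum_neg_distrib]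
  congr 1
  refine Finset.sum_congr rfl fun j _ => ?_
  rw [div_eq_mul_inv, Complex.im_ofReal_mul, Complex.inv_im, Complex.sub_im, Complex.ofReal_im]
  ring

theorem ratioWeight_nonneg (hx : ScaledZeros x φ σ p q) (hr : RealRecurrence x φ c C) {n k i : ℕ}
    (hn : 1 ≤ n) (hi : i ∈ Finset.Icc 1 k) : 0 ≤ ratioWeight x φ c n k i := by
  set y : ℕ → ℝ := fun j => x k j / φ n with hy
  set w : ℕ → ℝ := fun j => ratioWeight x φ c n k j with hw
  have hpos : ∀ᶠ ε : ℝ in 𝓝[>] 0,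
      0 ≤ ε ^ 2 + ∑ j ∈ Finset.Icc 1 k, w j * (ε ^ 2 / ((y i - y j) ^ 2 + ε ^ 2)) := by
    filter_upwards [self_mem_nhdsWithin] with ε hε
    have hε : 0 < ε := hε
    have him : 0 < ((y i : ℂ) + ε * Complex.I).im := by simpa using hε
    have h1 := im_zeroRatio_pos hx (k := k) hn him
    rw [im_zeroRatio hx hr hn him] at h1
    have h2 := mul_pos hε h1
    refine le_of_lt (h2.trans_eq ?_)
    rw [mul_add, Finset.mul_sum]
    congr 1
    · simp [sq]
    · refine Finset.sum_congr rfl fun j _ => ?_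
      simp only [hy, hw, Complex.normSq_apply]
      simp
      ring
  have hterm : ∀ j ∈ Finset.Icc 1 k, Tendsto (fun ε : ℝ => w j * (ε ^ 2 / ((y i - y j) ^ 2 + ε ^ 2)))
      (𝓝[>] 0) (𝓝 (if y i = y j then w i else 0)) := by
    intro j _
    split_ifs with h
    · have e : w j = w i := by
        simp only [hw, ratioWeight]
        rw [show x k j / φ n = x k i / φ n from h.symm]
      refine tendsto_const_nhds.congr' ?_
      filter_upwards [self_mem_nhdsWithin] with ε hε
      have hε : ε ^ 2 ≠ 0 := pow_ne_zero _ (ne_of_gt hε)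
      rw [h, sub_self, e]
      simp [hε]
    · have h0 : (y i - y j) ^ 2 + (0 : ℝ) ^ 2 ≠ 0 := by
        simpa [sub_eq_zero] using h
      have : ContinuousAt (fun ε : ℝ => w j * (ε ^ 2 / ((y i - y j) ^ 2 + ε ^ 2))) 0 := by
        fun_prop (disch := exact h0)
      have := this.tendsto.mono_left (nhdsWithin_le_nhds (s := Set.Ioi (0 : ℝ)))
      simpa using this
  have hlim : Tendsto (fun ε : ℝ => ε ^ 2 + ∑ j ∈ Finset.Icc 1 k,
      w j * (ε ^ 2 / ((y i - y j) ^ 2 + ε ^ 2))) (𝓝[>] 0)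
      (𝓝 (0 ^ 2 + ∑ j ∈ Finset.Icc 1 k, if y i = y j then w i else 0)) :=
    (((continuous_pow 2).tendsto (0 : ℝ)).mono_left nhdsWithin_le_nhds).add
      (tendsto_finsetSum _ hterm)
  have h0 := ge_of_tendsto hlim hpos
  rw [← Finset.sum_filter, Finset.sum_const, nsmul_eq_mul] at h0
  have hcard : (0 : ℝ) < ({j ∈ Finset.Icc 1 k | y i = y j} : Finset ℕ).card := by
    exact_mod_cast Finset.card_pos.2 ⟨i, by simpa using hi⟩
  by_contra! hneg
  have := mul_neg_of_pos_of_neg hcard hneg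
  linarith

theorem im_le_im_zeroRatio (hx : ScaledZeros x φ σ p q) (hr : RealRecurrence x φ c C) {n k : ℕ}
    (hn : 1 ≤ n) {z : ℂ} (hz : 0 < z.im) : z.im ≤ (zeroRatio x φ n k z).im := by
  rw [im_zeroRatio hx hr hn hz]
  refine le_add_of_nonneg_right (Finset.sum_nonneg fun j hj => ?_)
  exact mul_nonneg (ratioWeight_nonneg hx hr hn hj) (div_nonneg hz.le (Complex.normSq_nonneg _))

theorem realQuad_scale_nonpos (hx : ScaledZeros x φ σ p q) (hr : RealRecurrence x φ c C)
    {n k i : ℕ} (hn : 1 ≤ n) (hi : i ∈ Finset.Icc 1 k) :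
    ((c k).scale n (φ n)).realQuad (x k i / φ n) ≤ 0 := by
  have h := ratioWeight_nonneg hx hr hn hi
  have hpos : (0 : ℝ) < n := by exact_mod_cast hn
  rw [ratioWeight, neg_div, neg_nonneg] at h
  by_contra! h0
  exact absurd (div_pos h0 hpos) (not_lt.2 h)

theorem tendsto_scale (hx : ScaledZeros x φ σ p q)
    (hT : Coeffs.ConvergesTo (fun k => (c k).scale k (φ k)) atTop C) {ι : Type*} {l : Filter ι} {n k : ι → ℕ} {t : ℝ} (ht : 0 < t) (hn : Tendsto n l atTop)
    (hk : Tendsto (fun i => (k i : ℝ) / n i) l (𝓝 t)) :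
    Coeffs.ConvergesTo (fun i => (c (k i)).scale (n i) (φ (n i))) l (C.dilate σ t) := by
  have hφ := hx.tendsto_scale_div ht hn hk
  have hk0 : ∀ᶠ i in l, 1 ≤ n i ∧ 1 ≤ k i := by
    filter_upwards [hk.eventually (lt_mem_nhds ht), hn.eventually_ge_atTop 1] with i hi h1
    refine ⟨h1, ?_⟩
    by_contra! h0
    have : k i = 0 := by omega
    simp [this] at hi
  have hkt : Tendsto k l atTop := by
    have h1 : Tendsto (fun i => (k i : ℝ) / n i * n i) l atTop :=
      hk.pos_mul_atTop ht (tendsto_natCast_atTop_atTop.comp hn)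
    refine tendsto_natCast_atTop_iff.1 (h1.congr' ?_)
    filter_upwards [hk0] with i hi
    have : (n i : ℝ) ≠ 0 := by exact_mod_cast (by omega : n i ≠ 0)
    field_simp
  have aux : ∀ i, 1 ≤ n i ∧ 1 ≤ k i →
      (n i : ℝ) ≠ 0 ∧ (k i : ℝ) ≠ 0 ∧ φ (n i) ≠ 0 ∧ φ (k i) ≠ 0 := fun i hi =>
    ⟨by exact_mod_cast (by omega : n i ≠ 0), by exact_mod_cast (by omega : k i ≠ 0),
      (hx.pos _ hi.1).ne', (hx.pos _ hi.2).ne'⟩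
  refine ⟨?_, ?_, ?_, ?_, ?_⟩
  · refine ((hT.a₂.comp hkt).div hk ht.ne').congr' ?_
    filter_upwards [hk0] with i hi
    obtain ⟨h1, h2, h3, h4⟩ := aux i hi
    simp only [Coeffs.scale, Function.comp, Pi.div_apply]
    field_simp
  · refine (((hT.a₁.comp hkt).mul hφ).div hk ht.ne').congr' ?_
    filter_upwards [hk0] with i hi
    obtain ⟨h1, h2, h3, h4⟩ := aux i hi
    simp only [Coeffs.scale, Function.comp, Pi.div_apply]
    field_simp
  · refine (((hT.a₀.comp hkt).mul (hφ.pow 2)).div hk ht.ne').congr' ?_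
    filter_upwards [hk0] with i hi
    obtain ⟨h1, h2, h3, h4⟩ := aux i hi
    simp only [Coeffs.scale, Function.comp, Pi.div_apply]
    field_simp
  · exact hT.b₁.comp hkt
  · refine ((hT.b₀.comp hkt).mul hφ).congr' ?_
    filter_upwards [hk0] with i hi
    obtain ⟨h1, h2, h3, h4⟩ := aux i hi
    simp only [Coeffs.scale, Function.comp]
    field_simp

end

section

variable {x : ℕ → ℕ → ℝ} {φ : ℕ → ℝ} {σ p q : ℝ} {c : ℕ → Coeffs} {C : Coeffs}

theorem eventually_one_le_of_tendsto_div {ι : Type*} {l : Filter ι} {n k : ι → ℕ} {t : ℝ}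
    (ht : 0 < t) (hk : Tendsto (fun i => (k i : ℝ) / n i) l (𝓝 t)) : ∀ᶠ i in l, 1 ≤ k i := by
  filter_upwards [hk.eventually (lt_mem_nhds ht)] with i hi
  by_contra! h0
  have : k i = 0 := by omega
  simp [this] at hi

theorem tendsto_succ_div {ι : Type*} {l : Filter ι} {n k : ι → ℕ} {t : ℝ}
    (hn : Tendsto n l atTop) (hk : Tendsto (fun i => (k i : ℝ) / n i) l (𝓝 t)) :
    Tendsto (fun i => ((k i + 1 : ℕ) : ℝ) / n i) l (𝓝 t) := by
  have h1 : Tendsto (fun i => 1 / (n i : ℝ)) l (𝓝 0) :=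
    tendsto_one_div_atTop_nhds_zero_nat.comp hn
  have := hk.add h1
  rw [add_zero] at this
  refine this.congr fun i => ?_
  push_cast
  ring

theorem ScaledZeros.abs_div_le (hx : ScaledZeros x φ σ p q) {n k j : ℕ} (hn : 1 ≤ n)
    (hj : j ∈ Finset.Icc 1 k) : |x k j / φ n| ≤ max |p| |q| * (φ k / φ n) := by
  rw [Finset.mem_Icc] at hj
  have h1 := hx.mem k k j le_rfl hj.1 hj.2
  have h2 := hx.pos k (by omega)
  have h3 := hx.pos n hn
  have e : x k j / φ n = x k j / φ k * (φ k / φ n) := by field_simp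
  rw [e, abs_mul, abs_of_pos (div_pos h2 h3)]
  exact mul_le_mul_of_nonneg_right (abs_le_max_abs_abs h1.1 h1.2) (div_pos h2 h3).le

theorem ScaledZeros.eventually_abs_div_le (hx : ScaledZeros x φ σ p q) {ι : Type*} {l : Filter ι}
    {n k : ι → ℕ} {t : ℝ} (ht : 0 < t) (hn : Tendsto n l atTop)
    (hk : Tendsto (fun i => (k i : ℝ) / n i) l (𝓝 t)) :
    ∀ᶠ i in l, ∀ j ∈ Finset.Icc 1 (k i), |x (k i) j / φ (n i)| ≤ max |p| |q| * (t ^ σ + 1) := by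
  filter_upwards [(hx.tendsto_scale_div ht hn hk).eventually (gt_mem_nhds (lt_add_one _)),
    hn.eventually_ge_atTop 1] with i h1 h2 j hj
  exact (hx.abs_div_le h2 hj).trans
    (mul_le_mul_of_nonneg_left h1.le (le_max_of_le_left (abs_nonneg _)))

/-- In the limit, the rescaled zeros lie where the limit quadratic is nonpositive. -/
theorem eventually_realQuad_le (hx : ScaledZeros x φ σ p q) (hr : RealRecurrence x φ c C)
    {ι : Type*} {l : Filter ι} {n k : ι → ℕ} {t : ℝ} (ht : 0 < t) (hn : Tendsto n l atTop)
    (hk : Tendsto (fun i => (k i : ℝ) / n i) l (𝓝 t)) {θ : ℝ} (hθ : 0 < θ) :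
    ∀ᶠ i in l, ∀ j ∈ Finset.Icc 1 (k i),
      (C.dilate σ t).realQuad (x (k i) j / φ (n i)) ≤ θ := by
  filter_upwards [hx.eventually_abs_div_le ht hn hk, hn.eventually_ge_atTop 1,
    (tendsto_scale hx hr.tendsto ht hn hk).realQuad_sub_le hθ (max |p| |q| * (t ^ σ + 1))] with i h1 h2 h3 j hj
  have h4 := (abs_le.1 (h3 _ (h1 j hj))).2
  have h5 := realQuad_scale_nonpos hx hr h2 hj
  linarith

/-- `zeroRatio` on the real line. -/
noncomputable def realRatio (x : ℕ → ℕ → ℝ) (φ : ℕ → ℝ) (n k : ℕ) (u : ℝ) : ℝ :=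
  (∏ j ∈ Finset.Icc 1 (k + 1), (u - x (k + 1) j / φ n)) / ∏ j ∈ Finset.Icc 1 k, (u - x k j / φ n)

theorem zeroRatio_ofReal (n k : ℕ) (u : ℝ) :
    zeroRatio x φ n k u = realRatio x φ n k u := by
  simp [zeroRatio, realRatio]

theorem realRatio_eq_partialFraction (hx : ScaledZeros x φ σ p q) (hr : RealRecurrence x φ c C)
    {n k : ℕ} (hn : 1 ≤ n) {u : ℝ} (hu : ∀ j ∈ Finset.Icc 1 k, u ≠ x k j / φ n) :
    realRatio x φ n k u = u - ratioShift x φ c n k -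
      ∑ j ∈ Finset.Icc 1 k, ratioWeight x φ c n k j / (u - x k j / φ n) := by
  have h := zeroRatio_eq_partialFraction hx hr hn (k := k) (z := u) fun j hj => by
    rw [← Complex.ofReal_sub, Complex.ofReal_ne_zero, sub_ne_zero]
    exact hu j hj
  rw [zeroRatio_ofReal] at h
  exact_mod_cast h

theorem realRatio_pos {n k : ℕ} {u : ℝ} (h1 : ∀ j ∈ Finset.Icc 1 k, x k j / φ n < u)
    (h2 : ∀ j ∈ Finset.Icc 1 (k + 1), x (k + 1) j / φ n < u) : 0 < realRatio x φ n k u :=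
  div_pos (Finset.prod_pos fun j hj => sub_pos.2 (h2 j hj))
    (Finset.prod_pos fun j hj => sub_pos.2 (h1 j hj))

theorem realRatio_neg {n k : ℕ} {u : ℝ} (h1 : ∀ j ∈ Finset.Icc 1 k, u < x k j / φ n)
    (h2 : ∀ j ∈ Finset.Icc 1 (k + 1), u < x (k + 1) j / φ n) : realRatio x φ n k u < 0 := by
  have e : ∀ m, ∏ j ∈ Finset.Icc 1 m, (u - x m j / φ n) =
      (-1) ^ m * ∏ j ∈ Finset.Icc 1 m, (x m j / φ n - u) := by
    intro m
    have : ∀ j ∈ Finset.Icc 1 m, u - x m j / φ n = -1 * (x m j / φ n - u) := fun j _ => by ring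
    rw [Finset.prod_congr rfl this, Finset.prod_mul_distrib]
    simp
  have h3 : 0 < ∏ j ∈ Finset.Icc 1 k, (x k j / φ n - u) :=
    Finset.prod_pos fun j hj => sub_pos.2 (h1 j hj)
  have h4 : 0 < ∏ j ∈ Finset.Icc 1 (k + 1), (x (k + 1) j / φ n - u) :=
    Finset.prod_pos fun j hj => sub_pos.2 (h2 j hj)
  have e2 : realRatio x φ n k u = -((∏ j ∈ Finset.Icc 1 (k + 1), (x (k + 1) j / φ n - u)) /
      ∏ j ∈ Finset.Icc 1 k, (x k j / φ n - u)) := by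
    rw [realRatio, e, e, pow_succ]
    have : ((-1 : ℝ)) ^ k ≠ 0 := pow_ne_zero _ (by norm_num)
    field_simp
  rw [e2]
  exact neg_neg_of_pos (div_pos h4 h3)

theorem realRatio_mul_pos {n k : ℕ} {u v : ℝ}
    (h1 : ∀ j ∈ Finset.Icc 1 k, 0 < (u - x k j / φ n) * (v - x k j / φ n))
    (h2 : ∀ j ∈ Finset.Icc 1 (k + 1), 0 < (u - x (k + 1) j / φ n) * (v - x (k + 1) j / φ n)) :
    0 < realRatio x φ n k u * realRatio x φ n k v := by
  rw [realRatio, realRatio, div_mul_div_comm, ← Finset.prod_mul_distrib, ← Finset.prod_mul_distrib]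
  exact div_pos (Finset.prod_pos h2) (Finset.prod_pos h1)

theorem realRatio_rescale (hx : ScaledZeros x φ σ p q) {n k : ℕ} (hn : 1 ≤ n) (hk : 1 ≤ k)
    (u : ℝ) : realRatio x φ n k (φ k / φ n * u) = φ k / φ n * realRatio x φ k k u := by
  have h1 := (hx.pos n hn).ne'
  have h2 := (hx.pos k hk).ne'
  have e : ∀ m, ∏ j ∈ Finset.Icc 1 m, (φ k / φ n * u - x m j / φ n) =
      (φ k / φ n) ^ m * ∏ j ∈ Finset.Icc 1 m, (u - x m j / φ k) := by
    intro m
    have : ∀ j ∈ Finset.Icc 1 m, φ k / φ n * u - x m j / φ n = φ k / φ n * (u - x m j / φ k) :=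
      fun j _ => by field_simp
    rw [Finset.prod_congr rfl this, Finset.prod_mul_distrib, Finset.prod_const, Nat.card_Icc,
      add_tsub_cancel_right]
  rw [realRatio, realRatio, e, e, pow_succ]
  have : (φ k / φ n) ^ k ≠ 0 := pow_ne_zero _ (div_ne_zero h2 h1)
  rw [mul_assoc, mul_div_mul_left _ _ this, mul_div_assoc]

theorem sub_le_realRatio_sub (hx : ScaledZeros x φ σ p q) (hr : RealRecurrence x φ c C)
    {n k : ℕ} (hn : 1 ≤ n) {u v : ℝ} (huv : u ≤ v)
    (h : ∀ j ∈ Finset.Icc 1 k, 0 < (u - x k j / φ n) * (v - x k j / φ n)) :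
    v - u ≤ realRatio x φ n k v - realRatio x φ n k u := by
  have hne : ∀ j ∈ Finset.Icc 1 k, u ≠ x k j / φ n ∧ v ≠ x k j / φ n := fun j hj =>
    ⟨fun h0 => by have := h j hj; simp [h0] at this, fun h0 => by have := h j hj; simp [h0] at this⟩
  rw [realRatio_eq_partialFraction hx hr hn fun j hj => (hne j hj).1,
    realRatio_eq_partialFraction hx hr hn fun j hj => (hne j hj).2]
  have : ∑ j ∈ Finset.Icc 1 k, ratioWeight x φ c n k j / (v - x k j / φ n) ≤
      ∑ j ∈ Finset.Icc 1 k, ratioWeight x φ c n k j / (u - x k j / φ n) := by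
    refine Finset.sum_le_sum fun j hj => ?_
    have hw := ratioWeight_nonneg hx hr hn hj
    obtain ⟨h1, h2⟩ := hne j hj
    have h3 := h j hj
    have h1' := sub_ne_zero.2 h1
    have h2' := sub_ne_zero.2 h2
    have e : ratioWeight x φ c n k j / (u - x k j / φ n) - ratioWeight x φ c n k j /
        (v - x k j / φ n) = ratioWeight x φ c n k j * (v - u) /
          ((u - x k j / φ n) * (v - x k j / φ n)) := by
      field_simp
      ring
    have : 0 ≤ ratioWeight x φ c n k j * (v - u) / ((u - x k j / φ n) * (v - x k j / φ n)) :=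
      div_nonneg (mul_nonneg hw (sub_nonneg.2 huv)) h3.le
    linarith
  linarith

/-- The mean of the Cauchy kernel over rescaled zeros varies slowly at a point whose distance to
all of these zeros stays bounded below. -/
theorem tendsto_scaledMean_succ_sub (hx : ScaledZeros x φ σ p q) {m η : ℝ} (hη : 0 < η)
    (h1 : ∀ᶠ k in atTop, ∀ j ∈ Finset.Icc 1 k, η ≤ |m - x k j / φ k|)
    (h2 : ∀ᶠ k in atTop, ∀ j ∈ Finset.Icc 1 (k + 1), η ≤ |m - x (k + 1) j / φ k|) :
    Tendsto (fun k => scaledMean x φ (k + 1) (k + 1) (fun u => ((m : ℂ) - u)⁻¹) -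
      scaledMean x φ k k (fun u => ((m : ℂ) - u)⁻¹)) atTop (𝓝 0) := by
  set R := max |p| |q| with hR
  have hR0 : 0 ≤ R := le_max_of_le_left (abs_nonneg _)
  have hinv : ∀ u : ℝ, η ≤ |m - u| → ‖((m : ℂ) - u)⁻¹‖ ≤ η⁻¹ := by
    intro u hu
    rw [norm_inv, ← Complex.ofReal_sub, Complex.norm_real, Real.norm_eq_abs]
    exact inv_anti₀ hη hu
  have hlip : ∀ u v : ℝ, η ≤ |m - u| → η ≤ |m - v| →
      ‖((m : ℂ) - u)⁻¹ - ((m : ℂ) - v)⁻¹‖ ≤ η⁻¹ ^ 2 * |u - v| := by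
    intro u v hu hv
    have hu0 : (m : ℂ) - u ≠ 0 := by
      rw [← Complex.ofReal_sub, Complex.ofReal_ne_zero]
      exact abs_pos.1 (hη.trans_le hu)
    have hv0 : (m : ℂ) - v ≠ 0 := by
      rw [← Complex.ofReal_sub, Complex.ofReal_ne_zero]
      exact abs_pos.1 (hη.trans_le hv)
    have e : ((m : ℂ) - u)⁻¹ - ((m : ℂ) - v)⁻¹ =
        ((u - v : ℝ) : ℂ) * ((m : ℂ) - u)⁻¹ * ((m : ℂ) - v)⁻¹ := by
      push_cast; field_simp; ring
    rw [e, norm_mul, norm_mul, Complex.norm_real, Real.norm_eq_abs]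
    calc _ ≤ |u - v| * η⁻¹ * η⁻¹ := by
          gcongr
          · exact hinv u hu
          · exact hinv v hv
      _ = _ := by ring
  have hk1 : Tendsto (fun k : ℕ => ((k + 1 : ℕ) : ℝ) / (k : ℝ)) atTop (𝓝 1) := by
    have h0 : Tendsto (fun k : ℕ => (k : ℝ) / (k : ℝ)) atTop (𝓝 1) := by
      refine tendsto_const_nhds.congr' ?_
      filter_upwards [eventually_ge_atTop 1] with k hk
      have : (k : ℝ) ≠ 0 := by exact_mod_cast (by omega : k ≠ 0)
      rw [div_self this]
    exact tendsto_succ_div (n := fun k => k) (k := fun k => k) tendsto_id h0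
  have hφ := hx.tendsto_scale_div (n := fun k => k) (k := fun k => k + 1) one_pos tendsto_id hk1
  rw [Real.one_rpow] at hφ
  have hbound : Tendsto (fun k : ℕ => η⁻¹ ^ 2 * (R * |φ (k + 1) / φ k - 1|) +
      (η⁻¹ + η⁻¹ ^ 2 * (R * 2 - -(R * 2)) + η⁻¹) * (1 / ((k : ℝ) + 1))) atTop
      (𝓝 (η⁻¹ ^ 2 * (R * |(1 : ℝ) - 1|) + (η⁻¹ + η⁻¹ ^ 2 * (R * 2 - -(R * 2)) + η⁻¹) * 0)) :=
    (((hφ.sub_const 1).abs.const_mul R).const_mul _).add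
      (tendsto_one_div_add_atTop_nhds_zero_nat.const_mul _)
  simp only [sub_self, abs_zero, mul_zero, add_zero] at hbound
  refine squeeze_zero_norm' ?_ hbound
  have hφ2 : ∀ᶠ k : ℕ in atTop, φ (k + 1) / φ k < 2 := hφ.eventually (gt_mem_nhds one_lt_two)
  have h1s := (tendsto_add_atTop_nat 1).eventually h1
  filter_upwards [h1, h1s, h2, hφ2, eventually_ge_atTop 1] with k g1 g1s g2 g3 hk
  have hφk := hx.pos k hk
  have hφk1 := hx.pos (k + 1) (by omega)
  have hkpos : (0 : ℝ) < k := by exact_mod_cast hk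
  set ψ : ℝ → ℂ := fun u => ((m : ℂ) - u)⁻¹ with hψ
  set S1 := ∑ j ∈ Finset.Icc 1 (k + 1), ψ (x (k + 1) j / φ (k + 1)) with hS1
  set S2 := ∑ j ∈ Finset.Icc 1 (k + 1), ψ (x (k + 1) j / φ k) with hS2
  set S3 := ∑ j ∈ Finset.Icc 1 k, ψ (x k j / φ k) with hS3
  have e12 : ‖S1 - S2‖ ≤ ((k : ℝ) + 1) * (η⁻¹ ^ 2 * (R * |φ (k + 1) / φ k - 1|)) := by
    rw [hS1, hS2, ← Finset.sum_sub_distrib]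
    have : ∀ j ∈ Finset.Icc 1 (k + 1), ‖ψ (x (k + 1) j / φ (k + 1)) - ψ (x (k + 1) j / φ k)‖ ≤
        η⁻¹ ^ 2 * (R * |φ (k + 1) / φ k - 1|) := by
      intro j hj
      refine (hlip _ _ (g1s j hj) (g2 j hj)).trans ?_
      refine mul_le_mul_of_nonneg_left ?_ (by positivity)
      have e : x (k + 1) j / φ (k + 1) - x (k + 1) j / φ k =
          x (k + 1) j / φ (k + 1) * -(φ (k + 1) / φ k - 1) := by field_simp; ring
      rw [e, abs_mul, abs_neg]
      refine mul_le_mul_of_nonneg_right ?_ (abs_nonneg _)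
      have := hx.abs_div_le (n := k + 1) (by omega) hj
      rwa [div_self hφk1.ne', mul_one] at this
    have := norm_sum_le_of_le _ this
    simpa using this
  have hmem : ∀ j ∈ Finset.Icc 1 (k + 1), |x (k + 1) j / φ k| ≤ R * 2 := fun j hj =>
    (hx.abs_div_le hk hj).trans (mul_le_mul_of_nonneg_left g3.le hR0)
  have e23 : ‖S2 - S3‖ ≤ η⁻¹ + η⁻¹ ^ 2 * (R * 2 - -(R * 2)) := by
    refine norm_sum_sub_sum_le_of_interlace (y := fun j => x k j / φ k)
      (z := fun j => x (k + 1) j / φ k) (fun j => hx.scaled_interlace hk k j) (by positivity)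
      (abs_le.1 (hmem 1 (by simp))).1 (abs_le.1 (hmem (k + 1) (by simp))).2
      (hinv _ (g2 _ (by simp))) fun j hj hjk => ?_
    exact hlip _ _ (g2 j (by simp; omega)) (g1 j (by simp; omega))
  have e3 : ‖S3‖ ≤ k * η⁻¹ := by
    have : ∀ j ∈ Finset.Icc 1 k, ‖ψ (x k j / φ k)‖ ≤ η⁻¹ := fun j hj => hinv _ (g1 j hj)
    simpa using norm_sum_le_of_le _ this
  have e : scaledMean x φ (k + 1) (k + 1) ψ - scaledMean x φ k k ψ =
      ((k : ℂ) + 1)⁻¹ * ((S1 - S2) + (S2 - S3) - S3 / k) := by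
    have : (k : ℂ) ≠ 0 := by exact_mod_cast hkpos.ne'
    have : (k : ℂ) + 1 ≠ 0 := by exact_mod_cast (by positivity : (k : ℝ) + 1 ≠ 0)
    simp only [scaledMean, ← hS1, ← hS3]
    push_cast
    field_simp
    ring
  have hnk : ‖((k : ℂ) + 1)⁻¹‖ = ((k : ℝ) + 1)⁻¹ := by
    rw [norm_inv]
    congr 1
    exact_mod_cast Complex.norm_natCast (k + 1)
  rw [e, norm_mul, hnk]
  have e4 : ‖S3 / k‖ ≤ η⁻¹ := by
    rw [norm_div, Complex.norm_natCast, div_le_iff₀ hkpos, mul_comm]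
    exact e3
  have e5 : ‖(S1 - S2) + (S2 - S3) - S3 / k‖ ≤
      ((k : ℝ) + 1) * (η⁻¹ ^ 2 * (R * |φ (k + 1) / φ k - 1|)) +
        (η⁻¹ + η⁻¹ ^ 2 * (R * 2 - -(R * 2))) + η⁻¹ :=
    (norm_sub_le _ _).trans (add_le_add ((norm_add_le _ _).trans (add_le_add e12 e23)) e4)
  calc _ ≤ ((k : ℝ) + 1)⁻¹ * (((k : ℝ) + 1) * (η⁻¹ ^ 2 * (R * |φ (k + 1) / φ k - 1|)) +
        (η⁻¹ + η⁻¹ ^ 2 * (R * 2 - -(R * 2))) + η⁻¹) := by gcongr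
    _ = _ := by
      have : (k : ℝ) + 1 ≠ 0 := by positivity
      field_simp
      ring

end

namespace Coeffs

theorem realQuad_dilate_mul (C : Coeffs) {σ t : ℝ} (ht : 0 < t) (y : ℝ) :
    (C.dilate σ t).realQuad (t ^ σ * y) = (t ^ σ) ^ 2 / t * C.realQuad y := by
  simp only [realQuad, dilate]
  field_simp

theorem dilate_one (C : Coeffs) (σ : ℝ) : C.dilate σ 1 = C := by
  simp [dilate]

theorem continuous_realQuad (C : Coeffs) : Continuous C.realQuad := by
  unfold realQuad
  fun_prop

theorem lt_realQuad_of_concave {C : Coeffs} (hC : C.a₂ ≤ 0) {u v y θ : ℝ} (hu : θ < C.realQuad u)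
    (hv : θ < C.realQuad v) (hy : (u - y) * (v - y) ≤ 0) : θ < C.realQuad y := by
  wlog huv : u ≤ v generalizing u v
  · exact this hv hu (by linarith) (by linarith)
  rcases eq_or_lt_of_le huv with rfl | hlt
  · rwa [← sub_eq_zero.1 (mul_self_eq_zero.1 (le_antisymm hy (mul_self_nonneg (u - y))))]
  have h1 : u ≤ y ∧ y ≤ v := by
    constructor <;> by_contra! h
    · nlinarith [mul_pos (sub_pos.2 h) (sub_pos.2 (h.trans hlt))]
    · nlinarith [mul_pos (sub_pos.2 h) (sub_pos.2 (hlt.trans h))]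
  have e : (v - u) * (C.realQuad y - θ) = (v - y) * (C.realQuad u - θ) +
      (y - u) * (C.realQuad v - θ) - C.a₂ * ((v - u) * ((y - u) * (v - y))) := by
    simp only [realQuad]; ring
  have h2 : 0 ≤ -C.a₂ * ((v - u) * ((y - u) * (v - y))) :=
    mul_nonneg (by linarith) (mul_nonneg (by linarith) (mul_nonneg (by linarith) (by linarith)))
  have h3 : 0 < (v - y) * (C.realQuad u - θ) + (y - u) * (C.realQuad v - θ) := by
    rcases eq_or_lt_of_le h1.1 with h | h
    · rw [h, sub_self, zero_mul, add_zero]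
      exact mul_pos (by linarith) (by rw [← h]; linarith)
    · exact add_pos_of_nonneg_of_pos (mul_nonneg (by linarith) (by linarith))
        (mul_pos (by linarith) (by linarith))
  have h4 : 0 < (v - u) * (C.realQuad y - θ) := by linarith
  have := pos_of_mul_pos_right h4 (by linarith)
  linarith

end Coeffs

section

variable {x : ℕ → ℕ → ℝ} {φ : ℕ → ℝ} {σ p q : ℝ} {c : ℕ → Coeffs} {C : Coeffs}

/-- At a point where the limit quadratic is positive, the quotients of consecutive polynomials
eventually have constant sign. -/
theorem exists_sign_realRatio (hx : ScaledZeros x φ σ p q) (hr : RealRecurrence x φ c C) {m : ℝ}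
    (hm : 0 < C.realQuad m) : ∃ s : ℝ, ∀ᶠ k in atTop, 0 < s * realRatio x φ k k m := by
  obtain ⟨η, hη, hball⟩ : ∃ η > 0, ∀ y, |m - y| ≤ η → C.realQuad m / 2 < C.realQuad y := by
    have h1 : ∀ᶠ y in 𝓝 m, C.realQuad m / 2 < C.realQuad y :=
      C.continuous_realQuad.continuousAt.eventually (lt_mem_nhds (half_lt_self hm))
    obtain ⟨η, hη, h⟩ := Metric.eventually_nhds_iff.1 h1
    refine ⟨η / 2, by positivity, fun y hy => h ?_⟩
    rw [dist_comm, Real.dist_eq]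
    linarith
  have hk0 : Tendsto (fun k : ℕ => (k : ℝ) / (k : ℝ)) atTop (𝓝 1) := by
    refine tendsto_const_nhds.congr' ?_
    filter_upwards [eventually_ge_atTop 1] with k hk
    have : (k : ℝ) ≠ 0 := by exact_mod_cast (by omega : k ≠ 0)
    rw [div_self this]
  have hk1 := tendsto_succ_div (n := fun k => k) (k := fun k => k) tendsto_id hk0
  have hfar : ∀ y, C.realQuad y ≤ C.realQuad m / 2 → η < |m - y| := fun y hy => by
    by_contra! h
    exact absurd (hball y h) (not_lt.2 hy)
  have h1 : ∀ᶠ k in atTop, ∀ j ∈ Finset.Icc 1 k, η < |m - x k j / φ k| := by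
    have := eventually_realQuad_le hx hr (n := fun k => k) (k := fun k => k) one_pos tendsto_id hk0
      (half_pos hm)
    rw [C.dilate_one] at this
    exact this.mono fun k h j hj => hfar _ (h j hj)
  have h2 : ∀ᶠ k in atTop, ∀ j ∈ Finset.Icc 1 (k + 1), η < |m - x (k + 1) j / φ k| := by
    have := eventually_realQuad_le hx hr (n := fun k => k) (k := fun k => k + 1) one_pos tendsto_id
      hk1 (half_pos hm)
    rw [C.dilate_one] at this
    exact this.mono fun k h j hj => hfar _ (h j hj)
  have hbig : ∀ᶠ k in atTop, η ≤ |realRatio x φ k k m| := by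
    filter_upwards [h1, h2, eventually_ge_atTop 1] with k g1 g2 hk
    have hside : ∀ y v, η < |m - y| → |m - v| ≤ η → 0 < (m - y) * (v - y) := by
      intro y v hy hv
      rw [abs_le] at hv
      rcases lt_abs.1 hy with h | h
      · exact mul_pos (by linarith) (by linarith)
      · exact mul_pos_of_neg_of_neg (by linarith) (by linarith)
    have ha : |m - (m + η)| ≤ η := by simp [abs_of_pos hη]
    have hb : |m - (m - η)| ≤ η := by simp [abs_of_pos hη]
    have r1 := sub_le_realRatio_sub hx hr hk (by linarith : m ≤ m + η)
      fun j hj => hside _ _ (g1 j hj) ha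
    have r2 := sub_le_realRatio_sub hx hr hk (by linarith : m - η ≤ m)
      fun j hj => by rw [mul_comm]; exact hside _ _ (g1 j hj) hb
    have s1 := realRatio_mul_pos (x := x) (φ := φ) (n := k) (k := k) (u := m) (v := m + η)
      (fun j hj => hside _ _ (g1 j hj) ha) fun j hj => hside _ _ (g2 j hj) ha
    have s2 := realRatio_mul_pos (x := x) (φ := φ) (n := k) (k := k) (u := m) (v := m - η)
      (fun j hj => hside _ _ (g1 j hj) hb) fun j hj => hside _ _ (g2 j hj) hb
    rw [le_abs]
    rcases mul_pos_iff.1 s2 with h | h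
    · left; linarith [h.2]
    · right
      rcases mul_pos_iff.1 s1 with h' | h'
      · linarith [h.1, h'.1]
      · linarith [h'.2]
  have hmem : ∀ᶠ k in atTop, 1 ≤ k ∧ ∀ j ∈ Finset.Icc 1 k, (m : ℂ) - (x k j / φ k : ℝ) ≠ 0 := by
    filter_upwards [h1, eventually_ge_atTop 1] with k g1 hk
    refine ⟨hk, fun j hj => ?_⟩
    rw [← Complex.ofReal_sub, Complex.ofReal_ne_zero]
    exact abs_pos.1 (hη.trans (g1 j hj))
  have hdiff : Tendsto (fun k => zeroRatio x φ (k + 1) (k + 1) m - zeroRatio x φ k k m) atTop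
      (𝓝 0) := by
    set ψ : ℝ → ℂ := fun u => ((m : ℂ) - u)⁻¹ with hψ
    have hs := tendsto_scaledMean_succ_sub hx hη (h1.mono fun k h j hj => (h j hj).le)
      (h2.mono fun k h j hj => (h j hj).le)
    have hq := hr.tendsto.quad (m : ℂ)
    have hl := hr.tendsto.lin (m : ℂ)
    have hq1 := hq.comp (tendsto_add_atTop_nat 1)
    have hl1 := hl.comp (tendsto_add_atTop_nat 1)
    have hbdd : IsBoundedUnder (· ≤ ·) atTop (norm ∘ fun k => scaledMean x φ k k ψ) := by
      refine isBoundedUnder_of_eventually_le (a := η⁻¹) ?_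
      filter_upwards [h1, eventually_ge_atTop 1] with k g1 hk
      have hkpos : (0 : ℝ) < k := by exact_mod_cast hk
      have : ∀ j ∈ Finset.Icc 1 k, ‖ψ (x k j / φ k)‖ ≤ η⁻¹ := fun j hj => by
        rw [hψ, norm_inv, ← Complex.ofReal_sub, Complex.norm_real, Real.norm_eq_abs]
        exact inv_anti₀ hη (g1 j hj).le
      have := norm_sum_le_of_le _ this
      simp only [Function.comp, scaledMean, norm_mul, norm_inv, Complex.norm_natCast]
      rw [inv_mul_le_iff₀ hkpos]
      simpa using this
    have t1 : Tendsto (fun k => ((c (k + 1)).scale (k + 1) (φ (k + 1))).quad m *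
        (scaledMean x φ (k + 1) (k + 1) ψ - scaledMean x φ k k ψ) +
        (((c (k + 1)).scale (k + 1) (φ (k + 1))).quad m - ((c k).scale k (φ k)).quad m) *
          scaledMean x φ k k ψ +
        (((c (k + 1)).scale (k + 1) (φ (k + 1))).lin m - ((c k).scale k (φ k)).lin m)) atTop
        (𝓝 (C.quad m * 0 + 0 + (C.lin m - C.lin m))) := by
      refine ((hq1.mul hs).add ?_).add (hl1.sub hl)
      refine Tendsto.zero_mul_isBoundedUnder_le ?_ hbdd
      simpa using hq1.sub hq
    rw [mul_zero, add_zero, sub_self, add_zero] at t1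
    refine t1.congr' ?_
    have hmem1 := (tendsto_add_atTop_nat 1).eventually hmem
    filter_upwards [hmem, hmem1] with k g g1
    rw [zeroRatio_eq hx hr g.1 g.2, zeroRatio_eq hx hr g1.1 g1.2]
    ring
  have hsmall : ∀ᶠ k in atTop, |realRatio x φ (k + 1) (k + 1) m - realRatio x φ k k m| < η := by
    have := hdiff.norm
    rw [norm_zero] at this
    filter_upwards [this.eventually (gt_mem_nhds hη)] with k hk
    rwa [zeroRatio_ofReal, zeroRatio_ofReal, ← Complex.ofReal_sub, Complex.norm_real,
      Real.norm_eq_abs] at hk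
  obtain ⟨K, hK⟩ := eventually_atTop.1 (hbig.and hsmall)
  refine ⟨realRatio x φ K K m, eventually_atTop.2 ⟨K, fun k hk => ?_⟩⟩
  induction k, hk using Nat.le_induction with
  | base =>
    have := (hK K le_rfl).1
    exact mul_self_pos.2 (abs_pos.1 (hη.trans_le this))
  | succ k hk ih =>
    have g1 := (hK k hk).1
    have g2 := abs_lt.1 (hK k hk).2
    have g3 := (hK (k + 1) (by omega)).1
    rcases le_abs.1 g1 with h | h
    · have hK0 : 0 < realRatio x φ K K m := by
        by_contra! h0
        have := mul_nonpos_of_nonpos_of_nonneg h0 (hη.le.trans h)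
        linarith
      exact mul_pos hK0 (by linarith)
    · have hK0 : realRatio x φ K K m < 0 := by
        by_contra! h0
        have := mul_nonpos_of_nonneg_of_nonpos h0 (by linarith : realRatio x φ k k m ≤ 0)
        linarith
      exact mul_pos_of_neg_of_neg hK0 (by linarith)

/-- Where the limit quadratic exceeds `θ`, the sign of the quotients of consecutive polynomials
does not depend on the index. -/
theorem exists_sign_function (hx : ScaledZeros x φ σ p q) (hr : RealRecurrence x φ c C) {t : ℝ}
    (ht : 0 < t) : ∃ s : ℝ → ℝ, ∀ {ι : Type} {l : Filter ι} {n k : ι → ℕ}, Tendsto n l atTop →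
      Tendsto (fun i => (k i : ℝ) / n i) l (𝓝 t) → ∀ {θ : ℝ}, 0 < θ → ∀ᶠ i in l, ∀ ζ : ℝ,
        θ < (C.dilate σ t).realQuad ζ → 0 < s ζ * realRatio x φ (n i) (k i) ζ := by
  set Q := C.dilate σ t with hQ
  rcases le_or_gt 0 C.a₂ with ha | ha
  · refine ⟨fun ζ => if 0 ≤ 2 * Q.a₂ * ζ + Q.a₁ then 1 else -1, ?_⟩
    intro ι l n k hn hk θ hθ
    have hQa : 0 ≤ Q.a₂ := div_nonneg ha ht.le
    have e : ∀ y ζ, Q.realQuad y = Q.realQuad ζ + (2 * Q.a₂ * ζ + Q.a₁) * (y - ζ) +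
        Q.a₂ * (y - ζ) ^ 2 := fun y ζ => by simp only [Coeffs.realQuad]; ring
    filter_upwards [eventually_realQuad_le hx hr ht hn hk hθ,
      eventually_realQuad_le hx hr ht hn (tendsto_succ_div hn hk) hθ] with i h1 h2 ζ hζ
    split_ifs with hs
    · rw [one_mul]
      have aux : ∀ y, Q.realQuad y ≤ θ → y < ζ := fun y hy => by
        by_contra! h0
        have := e y ζ
        have := mul_nonneg hs (sub_nonneg.2 h0)
        have := mul_nonneg hQa (sq_nonneg (y - ζ))
        linarith
      exact realRatio_pos (fun j hj => aux _ (h1 j hj)) fun j hj => aux _ (h2 j hj)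
    · rw [neg_one_mul, neg_pos]
      have aux : ∀ y, Q.realQuad y ≤ θ → ζ < y := fun y hy => by
        by_contra! h0
        have := e y ζ
        have := mul_nonneg_of_nonpos_of_nonpos (not_le.1 hs).le (sub_nonpos.2 h0)
        have := mul_nonneg hQa (sq_nonneg (y - ζ))
        linarith
      exact realRatio_neg (fun j hj => aux _ (h1 j hj)) fun j hj => aux _ (h2 j hj)
  · set m := -C.a₁ / (2 * C.a₂) with hm
    have hQa : Q.a₂ < 0 := div_neg_of_neg_of_pos ha ht
    have htσ : 0 < t ^ σ := Real.rpow_pos_of_pos ht _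
    have hmax : ∀ ζ, Q.realQuad ζ ≤ Q.realQuad (t ^ σ * m) := by
      intro ζ
      have e : Q.realQuad ζ = Q.realQuad (t ^ σ * m) + Q.a₂ * (ζ - t ^ σ * m) ^ 2 := by
        have := ha.ne
        simp only [Coeffs.realQuad, hQ, Coeffs.dilate, hm]
        field_simp
        ring
      have := mul_nonneg_of_nonpos_of_nonpos hQa.le (neg_nonpos.2 (sq_nonneg (ζ - t ^ σ * m)))
      linarith
    by_cases hpos : 0 < C.realQuad m
    swap
    · refine ⟨fun _ => 1, fun {ι l n k} hn hk {θ} hθ => Eventually.of_forall fun i ζ hζ => ?_⟩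
      have h1 := hmax ζ
      rw [hQ, C.realQuad_dilate_mul ht] at h1
      have := mul_nonpos_of_nonneg_of_nonpos (by positivity : 0 ≤ (t ^ σ) ^ 2 / t)
        (not_lt.1 hpos)
      linarith
    obtain ⟨s, hs⟩ := exists_sign_realRatio hx hr hpos
    refine ⟨fun _ => s, fun {ι l n k} hn hk {θ} hθ => ?_⟩
    by_cases hθm : θ < Q.realQuad (t ^ σ * m)
    swap
    · exact Eventually.of_forall fun i ζ hζ => absurd (hζ.trans_le (hmax ζ)) hθm
    have hk1 := eventually_one_le_of_tendsto_div ht hk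
    have hkt : Tendsto k l atTop := by
      have h1 : Tendsto (fun i => (k i : ℝ) / n i * n i) l atTop :=
        hk.pos_mul_atTop ht (tendsto_natCast_atTop_atTop.comp hn)
      refine tendsto_natCast_atTop_iff.1 (h1.congr' ?_)
      filter_upwards [hn.eventually_ge_atTop 1] with i hi
      have : (n i : ℝ) ≠ 0 := by exact_mod_cast (by omega : n i ≠ 0)
      field_simp
    have hμ : ∀ᶠ i in l, θ < Q.realQuad (φ (k i) / φ (n i) * m) :=
      ((Q.continuous_realQuad.tendsto _).comp
        ((hx.tendsto_scale_div ht hn hk).mul_const m)).eventually (lt_mem_nhds hθm)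
    filter_upwards [eventually_realQuad_le hx hr ht hn hk hθ,
      eventually_realQuad_le hx hr ht hn (tendsto_succ_div hn hk) hθ, hμ, hk1,
      hn.eventually_ge_atTop 1, hkt.eventually hs] with i h1 h2 h3 h4 h5 h6 ζ hζ
    have aux : ∀ y, Q.realQuad y ≤ θ → 0 < (φ (k i) / φ (n i) * m - y) * (ζ - y) := by
      intro y hy
      by_contra! h0
      exact absurd (Coeffs.lt_realQuad_of_concave hQa.le h3 hζ h0) (not_lt.2 hy)
    have h7 := realRatio_mul_pos (x := x) (φ := φ) (n := n i) (k := k i)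
      (fun j hj => aux _ (h1 j hj)) fun j hj => aux _ (h2 j hj)
    rw [realRatio_rescale hx h5 h4] at h7
    have h8 : 0 < φ (k i) / φ (n i) := div_pos (hx.pos _ h4) (hx.pos _ h5)
    have h9 : 0 < realRatio x φ (k i) (k i) m * realRatio x φ (n i) (k i) ζ := by
      rw [mul_assoc] at h7
      exact pos_of_mul_pos_right h7 h8.le
    have h10 := mul_pos h6 h9
    have e : s * realRatio x φ (k i) (k i) m *
        (realRatio x φ (k i) (k i) m * realRatio x φ (n i) (k i) ζ) =
        realRatio x φ (k i) (k i) m ^ 2 * (s * realRatio x φ (n i) (k i) ζ) := by ring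
    rw [e] at h10
    exact pos_of_mul_pos_right h10 (sq_nonneg _)

end

/-- The filter of pairs `(n, k)` with `k < n`, `n` along `l` and `k / n` tending to `t`. -/
noncomputable def ratioFilter (l : Filter ℕ) (t : ℝ) : Filter (ℕ × ℕ) :=
  (l ×ˢ ⊤) ⊓ comap (fun i => (i.2 : ℝ) / i.1) (𝓝 t) ⊓ 𝓟 {i | i.2 < i.1}

theorem tendsto_fst_ratioFilter {l : Filter ℕ} {t : ℝ} :
    Tendsto (fun i : ℕ × ℕ => i.1) (ratioFilter l t) l :=
  tendsto_fst.mono_left (inf_le_left.trans inf_le_left)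

theorem tendsto_div_ratioFilter {l : Filter ℕ} {t : ℝ} :
    Tendsto (fun i : ℕ × ℕ => (i.2 : ℝ) / i.1) (ratioFilter l t) (𝓝 t) :=
  tendsto_comap.mono_left (inf_le_left.trans inf_le_right)

theorem eventually_lt_ratioFilter {l : Filter ℕ} {t : ℝ} :
    ∀ᶠ i in ratioFilter l t, i.2 < i.1 :=
  (le_principal_iff.1 (inf_le_right : ratioFilter l t ≤ _) : _)

theorem exists_forall_of_eventually_ratioFilter {l : Filter ℕ} {t : ℝ} {P : ℕ × ℕ → Prop}
    (h : ∀ᶠ i in ratioFilter l t, P i) :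
    ∃ η > 0, ∀ᶠ n : ℕ in l, ∀ k < n, |(k : ℝ) / n - t| < η → P (n, k) := by
  rw [ratioFilter, eventually_inf_principal] at h
  obtain ⟨A, hA, B, hB, hAB⟩ := mem_inf_iff_superset.1 h
  obtain ⟨B', hB', hBB⟩ := mem_comap.1 hB
  obtain ⟨η, hη, hball⟩ := Metric.mem_nhds_iff.1 hB'
  rw [prod_top, mem_comap] at hA
  obtain ⟨A', hA', hAA⟩ := hA
  refine ⟨η, hη, ?_⟩
  filter_upwards [hA'] with n hn k hk hkt
  exact hAB ⟨hAA hn, hBB (hball (by simpa [Real.dist_eq] using hkt))⟩ hk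

theorem floor_mul_le {t : ℝ} (ht : t ∈ Set.Icc (0 : ℝ) 1) (n : ℕ) : ⌊(n : ℝ) * t⌋₊ ≤ n :=
  Nat.floor_le_of_le (mul_le_of_le_one_right (Nat.cast_nonneg n) ht.2)

theorem tendsto_floor_mul_div {l : Filter ℕ} (hl : l ≤ atTop) {t : ℝ} (ht : 0 ≤ t) :
    Tendsto (fun n : ℕ => (⌊(n : ℝ) * t⌋₊ : ℝ) / n) l (𝓝 t) := by
  have := (tendsto_nat_floor_mul_div_atTop (R := ℝ) ht).comp tendsto_natCast_atTop_atTop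
  refine (this.mono_left hl).congr fun m => ?_
  simp [mul_comm]

theorem abs_floor_mul_div_sub_le {n : ℕ} (hn : 1 ≤ n) {t : ℝ} (ht : 0 ≤ t) :
    |(⌊(n : ℝ) * t⌋₊ : ℝ) / n - t| ≤ 1 / n := by
  have hpos : (0 : ℝ) < n := by exact_mod_cast hn
  have h1 := Nat.floor_le (mul_nonneg hpos.le ht)
  have h2 := Nat.lt_floor_add_one ((n : ℝ) * t)
  have e : (⌊(n : ℝ) * t⌋₊ : ℝ) / n - t = (⌊(n : ℝ) * t⌋₊ - n * t) / n := by field_simp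
  rw [e, abs_div, abs_of_pos hpos]
  gcongr
  rw [abs_le]
  constructor <;> linarith

/-- If the increments `e n k` converge to `G` as `k / n → t`, then the limit of their means has
derivative `G` at `t`. -/
theorem hasDerivWithinAt_of_tendsto_increment {V : Type*} [NormedAddCommGroup V] [NormedSpace ℝ V]
    {l : Filter ℕ} [l.NeBot] (hl : l ≤ atTop) {e : ℕ → ℕ → V} {E : ℝ → V}
    (hE : ∀ t ∈ Set.Icc (0 : ℝ) 1, Tendsto
      (fun n : ℕ => (n : ℝ)⁻¹ • ∑ k ∈ Finset.range ⌊(n : ℝ) * t⌋₊, e n k) l (𝓝 (E t)))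
    {t₀ : ℝ} (ht₀ : t₀ ∈ Set.Icc (0 : ℝ) 1) {G : V}
    (hG : Tendsto (fun i : ℕ × ℕ => e i.1 i.2) (ratioFilter l t₀) (𝓝 G)) :
    HasDerivWithinAt E G (Set.Icc 0 1) t₀ := by
  rw [hasDerivWithinAt_iff_isLittleO, Asymptotics.isLittleO_iff]
  intro δ hδ
  obtain ⟨η, hη, hev⟩ := exists_forall_of_eventually_ratioFilter
    (hG.eventually (Metric.closedBall_mem_nhds G hδ))
  have key : ∀ a ∈ Set.Icc (0 : ℝ) 1, ∀ b ∈ Set.Icc (0 : ℝ) 1, a ≤ b → t₀ - η < a → b < t₀ + η →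
      ‖E b - E a - (b - a) • G‖ ≤ δ * (b - a) := by
    intro a ha b hb hab hal hbu
    have hlim : Tendsto (fun n : ℕ => ‖(n : ℝ)⁻¹ • ∑ k ∈ Finset.range ⌊(n : ℝ) * b⌋₊, e n k -
        (n : ℝ)⁻¹ • ∑ k ∈ Finset.range ⌊(n : ℝ) * a⌋₊, e n k -
        ((⌊(n : ℝ) * b⌋₊ : ℝ) / n - (⌊(n : ℝ) * a⌋₊ : ℝ) / n) • G‖) l
        (𝓝 ‖E b - E a - (b - a) • G‖) :=
      (((hE b hb).sub (hE a ha)).sub (((tendsto_floor_mul_div hl hb.1).sub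
        (tendsto_floor_mul_div hl ha.1)).smul_const G)).norm
    have hlim2 : Tendsto (fun n : ℕ => δ * ((⌊(n : ℝ) * b⌋₊ : ℝ) / n - (⌊(n : ℝ) * a⌋₊ : ℝ) / n)) l
        (𝓝 (δ * (b - a))) :=
      ((tendsto_floor_mul_div hl hb.1).sub (tendsto_floor_mul_div hl ha.1)).const_mul δ
    refine le_of_tendsto_of_tendsto hlim hlim2 ?_
    have h1n : ∀ᶠ n : ℕ in l, 1 / (n : ℝ) < a - (t₀ - η) :=
      hl (tendsto_one_div_atTop_nhds_zero_nat.eventually (gt_mem_nhds (by linarith)))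
    filter_upwards [hev, h1n, hl (eventually_ge_atTop 1)] with n h1 h2 h3
    have hpos : (0 : ℝ) < n := by exact_mod_cast h3
    have hfl : ⌊(n : ℝ) * a⌋₊ ≤ ⌊(n : ℝ) * b⌋₊ := Nat.floor_mono (by gcongr)
    rw [← smul_sub, ← Finset.sum_Ico_eq_sub _ hfl]
    have e1 : ((⌊(n : ℝ) * b⌋₊ : ℝ) / n - (⌊(n : ℝ) * a⌋₊ : ℝ) / n) • G =
        (n : ℝ)⁻¹ • ∑ k ∈ Finset.Ico ⌊(n : ℝ) * a⌋₊ ⌊(n : ℝ) * b⌋₊, G := by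
      rw [Finset.sum_const, Nat.card_Ico, ← Nat.cast_smul_eq_nsmul ℝ, smul_smul, Nat.cast_sub hfl]
      congr 1
      ring
    rw [e1, ← smul_sub, ← Finset.sum_sub_distrib, norm_smul, norm_inv, Real.norm_natCast]
    have h4 : ∀ k ∈ Finset.Ico ⌊(n : ℝ) * a⌋₊ ⌊(n : ℝ) * b⌋₊, ‖e n k - G‖ ≤ δ := by
      intro k hk
      rw [Finset.mem_Ico] at hk
      have hkn : k < n := hk.2.trans_le (floor_mul_le hb n)
      have hkb : (k : ℝ) / n < t₀ + η := by
        rw [div_lt_iff₀ hpos]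
        have : (k : ℝ) ≤ n * b :=
          (by exact_mod_cast hk.2.le : (k : ℝ) ≤ (⌊(n : ℝ) * b⌋₊ : ℝ)).trans
            (Nat.floor_le (mul_nonneg hpos.le hb.1))
        nlinarith
      have hka : t₀ - η < (k : ℝ) / n := by
        have h5 := abs_le.1 (abs_floor_mul_div_sub_le h3 ha.1)
        have h6 : (⌊(n : ℝ) * a⌋₊ : ℝ) / n ≤ (k : ℝ) / n := by
          gcongr
          exact_mod_cast hk.1
        linarith [h5.1]
      have := h1 k hkn (by rw [abs_lt]; constructor <;> linarith)
      simpa [dist_eq_norm] using this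
    have h5 := norm_sum_le_of_le _ h4
    rw [Finset.sum_const, Nat.card_Ico, nsmul_eq_mul, Nat.cast_sub hfl] at h5
    calc _ ≤ (n : ℝ)⁻¹ * (((⌊(n : ℝ) * b⌋₊ : ℝ) - (⌊(n : ℝ) * a⌋₊ : ℝ)) * δ) := by gcongr
      _ = _ := by ring
  have hnear : ∀ᶠ t in 𝓝[Set.Icc 0 1] t₀, t ∈ Set.Icc (0 : ℝ) 1 ∧ |t - t₀| < η :=
    eventually_mem_nhdsWithin.and (nhdsWithin_le_nhds (by
      filter_upwards [Metric.ball_mem_nhds t₀ hη] with t ht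
      simpa [Real.dist_eq] using ht))
  filter_upwards [hnear] with t ht
  have h2 := abs_lt.1 ht.2
  rw [Real.norm_eq_abs]
  rcases le_total t t₀ with h | h
  · have := key t ht.1 t₀ ht₀ h (by linarith) (by linarith)
    rw [abs_of_nonpos (by linarith), neg_sub, ← norm_neg]
    refine le_trans (le_of_eq ?_) this
    congr 1
    rw [sub_smul, sub_smul]
    abel
  · rw [abs_of_nonneg (by linarith)]
    exact key t₀ ht₀ t ht.1 h (by linarith) (by linarith)

section

variable {x : ℕ → ℕ → ℝ} {φ : ℕ → ℝ} {σ p q : ℝ} {c : ℕ → Coeffs} {C : Coeffs}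

theorem scaledMean_eq_sum_range {n N : ℕ} (ψ : ℝ → ℂ) :
    scaledMean x φ n N ψ = (n : ℝ)⁻¹ • ∑ k ∈ Finset.range N,
      (∑ j ∈ Finset.Icc 1 (k + 1), ψ (x (k + 1) j / φ n) -
        ∑ j ∈ Finset.Icc 1 k, ψ (x k j / φ n)) := by
  rw [Finset.sum_range_sub (fun k => ∑ j ∈ Finset.Icc 1 k, ψ (x k j / φ n)), scaledMean]
  simp [Complex.real_smul]

theorem re_scaledMean_log {n N : ℕ} {z : ℂ} (hz : 0 < z.im) :
    (scaledMean x φ n N fun u => Complex.log (z - u)).re =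
      (n : ℝ)⁻¹ • ∑ k ∈ Finset.range N, Real.log ‖zeroRatio x φ n k z‖ := by
  rw [scaledMean_eq_sum_range, Complex.real_smul, Complex.re_ofReal_mul, smul_eq_mul,
    Complex.re_sum]
  congr 1
  refine Finset.sum_congr rfl fun k _ => ?_
  have h : ∀ m, ∀ j ∈ Finset.Icc 1 m, ‖z - (x m j / φ n : ℝ)‖ ≠ 0 := fun m j _ =>
    norm_ne_zero_iff.2 (sub_ofReal_ne_zero hz _)
  rw [zeroRatio, norm_div, norm_prod, norm_prod, Real.log_div (Finset.prod_ne_zero_iff.2 (h _))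
    (Finset.prod_ne_zero_iff.2 (h _)), Real.log_prod (h _), Real.log_prod (h _), Complex.sub_re,
    Complex.re_sum, Complex.re_sum]
  simp only [Complex.log_re]

theorem tendsto_scaledMean_ratioFilter (hx : ScaledZeros x φ σ p q) {l : Filter ℕ}
    (hl : l ≤ atTop) {M Λ : ℝ} {ψ : ℝ → ℂ} (hψ : BddLipschitz p q M Λ ψ) {t : ℝ}
    (ht : t ∈ Set.Icc (0 : ℝ) 1) {v : ℂ}
    (h : Tendsto (fun n : ℕ => scaledMean x φ n ⌊(n : ℝ) * t⌋₊ ψ) l (𝓝 v)) :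
    Tendsto (fun i : ℕ × ℕ => scaledMean x φ i.1 i.2 ψ) (ratioFilter l t) (𝓝 v) := by
  have h1 := h.comp (tendsto_fst_ratioFilter (l := l) (t := t))
  have h2 : Tendsto (fun i : ℕ × ℕ => scaledMean x φ i.1 i.2 ψ -
      scaledMean x φ i.1 ⌊(i.1 : ℝ) * t⌋₊ ψ) (ratioFilter l t) (𝓝 0) := by
    have h3 : Tendsto (fun i : ℕ × ℕ => (M + Λ * (q - p)) *
        |(i.2 : ℝ) / i.1 - (⌊(i.1 : ℝ) * t⌋₊ : ℝ) / i.1|) (ratioFilter l t)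
        (𝓝 ((M + Λ * (q - p)) * |t - t|)) :=
      (tendsto_div_ratioFilter.sub ((tendsto_floor_mul_div hl ht.1).comp
        tendsto_fst_ratioFilter)).abs.const_mul _
    rw [sub_self, abs_zero, mul_zero] at h3
    refine squeeze_zero_norm' ?_ h3
    filter_upwards [eventually_lt_ratioFilter] with i hi
    exact hx.norm_scaledMean_sub_le hψ (floor_mul_le ht i.1) hi.le
  have := h1.add h2
  rw [add_zero] at this
  exact this.congr fun i => by simp

theorem tendsto_zeroRatio {ι : Type*} (hx : ScaledZeros x φ σ p q) (hr : RealRecurrence x φ c C)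
    {l : Filter ι} {n k : ι → ℕ} {t : ℝ} (ht : 0 < t) (hn : Tendsto n l atTop)
    (hk : Tendsto (fun i => (k i : ℝ) / n i) l (𝓝 t)) {z : ℂ} (hz : 0 < z.im) {v : ℂ}
    (h : Tendsto (fun i => scaledMean x φ (n i) (k i) fun u => (z - u)⁻¹) l (𝓝 v)) :
    Tendsto (fun i => zeroRatio x φ (n i) (k i) z) l
      (𝓝 ((C.dilate σ t).quad z * v + (C.dilate σ t).lin z)) := by
  have hs := tendsto_scale hx hr.tendsto ht hn hk
  refine (((hs.quad z).mul h).add (hs.lin z)).congr' ?_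
  filter_upwards [hn.eventually_ge_atTop 1] with i hi
  rw [zeroRatio_eq hx hr hi fun j _ => sub_ofReal_ne_zero hz _]

end

/-- On the upper half plane, `f` and `W` are the limits along `l` of the rescaled logarithmic
derivatives and of the rescaled logarithmic potentials. -/
structure IsLimitPair (x : ℕ → ℕ → ℝ) (φ : ℕ → ℝ) (l : Filter ℕ) (f W : ℝ → ℂ → ℂ) : Prop where
  cauchy : ∀ t ∈ Set.Icc (0 : ℝ) 1, ∀ z : ℂ, 0 < z.im →
    Tendsto (fun n : ℕ => scaledMean x φ n ⌊(n : ℝ) * t⌋₊ fun u => (z - u)⁻¹) l (𝓝 (f t z))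
  log : ∀ t ∈ Set.Icc (0 : ℝ) 1, ∀ z : ℂ, 0 < z.im →
    Tendsto (fun n : ℕ => scaledMean x φ n ⌊(n : ℝ) * t⌋₊ fun u => Complex.log (z - u)) l
      (𝓝 (W t z))

theorem norm_scaledMean_sub_le_of_forall {x : ℕ → ℕ → ℝ} {φ : ℕ → ℝ} {n N : ℕ} (hN : N ≤ n)
    {ψ χ : ℝ → ℂ} {M : ℝ} (hM : 0 ≤ M)
    (h : ∀ j ∈ Finset.Icc 1 N, ‖ψ (x N j / φ n) - χ (x N j / φ n)‖ ≤ M) :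
    ‖scaledMean x φ n N ψ - scaledMean x φ n N χ‖ ≤ M := by
  have h1 := norm_sum_le_of_le _ h
  rw [scaledMean, scaledMean, ← mul_sub, norm_mul, norm_inv, Complex.norm_natCast,
    ← Finset.sum_sub_distrib]
  rw [Finset.sum_const, Nat.card_Icc, add_tsub_cancel_right, nsmul_eq_mul] at h1
  rcases Nat.eq_zero_or_pos n with rfl | hn
  · simpa using hM
  have hpos : (0 : ℝ) < n := by exact_mod_cast hn
  rw [inv_mul_le_iff₀ hpos]
  refine h1.trans (mul_le_mul_of_nonneg_right ?_ hM)
  exact_mod_cast hN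

theorem abs_log_sub_log_le {a b m : ℝ} (hm : 0 < m) (ha : m ≤ a) (hb : m ≤ b) :
    |Real.log a - Real.log b| ≤ |a - b| / m := by
  have key : ∀ a b : ℝ, m ≤ a → m ≤ b → Real.log a - Real.log b ≤ |a - b| / m := by
    intro a b ha hb
    have ha0 := hm.trans_le ha
    have hb0 := hm.trans_le hb
    rw [← Real.log_div ha0.ne' hb0.ne']
    have h1 := Real.log_le_sub_one_of_pos (div_pos ha0 hb0)
    have e : a / b - 1 = (a - b) / b := by field_simp
    rw [e] at h1
    refine h1.trans ((div_le_div_of_nonneg_right (le_abs_self _) hb0.le).trans ?_)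
    exact div_le_div_of_nonneg_left (abs_nonneg _) hm hb
  rw [abs_le]
  have h1 := key a b ha hb
  have h2 := key b a hb ha
  rw [abs_sub_comm] at h2
  constructor <;> linarith

namespace IsLimitPair

variable {x : ℕ → ℕ → ℝ} {φ : ℕ → ℝ} {σ p q : ℝ} {c : ℕ → Coeffs} {C : Coeffs} {l : Filter ℕ}
  {f W : ℝ → ℂ → ℂ}

theorem potential_zero [l.NeBot] (h : IsLimitPair x φ l f W) {z : ℂ} (hz : 0 < z.im) :
    W 0 z = 0 := by
  have h1 := h.log 0 (by simp) z hz
  refine tendsto_nhds_unique h1 ?_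
  simp [scaledMean]

theorem hasDerivAt_potential [l.NeBot] (h : IsLimitPair x φ l f W) {t : ℝ}
    (ht : t ∈ Set.Icc (0 : ℝ) 1) {z : ℂ} (hz : 0 < z.im) : HasDerivAt (W t) (f t z) z := by
  refine hasDerivAt_of_sq_bound (C := (z.im / 2)⁻¹ ^ 2) ?_
  have hε : 0 < z.im / 2 := half_pos hz
  have hnear : ∀ᶠ w : ℂ in 𝓝 z, z.im / 2 < w.im :=
    Complex.continuous_im.continuousAt.eventually (lt_mem_nhds (half_lt_self hz))
  filter_upwards [hnear] with w hw
  have hw0 : 0 < w.im := hε.trans hw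
  have hlim := (((h.log t ht w hw0).sub (h.log t ht z hz)).sub
    ((h.cauchy t ht z hz).mul_const (w - z))).norm
  refine le_of_tendsto hlim (Eventually.of_forall fun n => ?_)
  have e : scaledMean x φ n ⌊(n : ℝ) * t⌋₊ (fun u => Complex.log (w - u)) -
      scaledMean x φ n ⌊(n : ℝ) * t⌋₊ (fun u => Complex.log (z - u)) -
      scaledMean x φ n ⌊(n : ℝ) * t⌋₊ (fun u => (z - u)⁻¹) * (w - z) =
      scaledMean x φ n ⌊(n : ℝ) * t⌋₊ (fun u => Complex.log (w - u)) -
      scaledMean x φ n ⌊(n : ℝ) * t⌋₊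
        (fun u => Complex.log (z - u) + (z - u)⁻¹ * (w - z)) := by
    simp only [scaledMean, Finset.sum_add_distrib, ← Finset.sum_mul]
    ring
  rw [e]
  refine norm_scaledMean_sub_le_of_forall (floor_mul_le ht n) (by positivity) fun j _ => ?_
  have := norm_log_sub_log_sub_le hε (a := w - (x ⌊(n : ℝ) * t⌋₊ j / φ n : ℝ))
    (b := z - (x ⌊(n : ℝ) * t⌋₊ j / φ n : ℝ)) (by simpa using hw.le)
    (by simp; linarith)
  rw [sub_sub_sub_cancel_right] at this
  refine le_trans (le_of_eq ?_) this
  congr 1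
  ring

theorem im_nonpos [l.NeBot] (h : IsLimitPair x φ l f W) {t : ℝ} (ht : t ∈ Set.Icc (0 : ℝ) 1)
    {z : ℂ} (hz : 0 < z.im) : (f t z).im ≤ 0 := by
  have hlim := (Complex.continuous_im.tendsto _).comp (h.cauchy t ht z hz)
  refine le_of_tendsto hlim (Eventually.of_forall fun n => ?_)
  simp only [Function.comp, scaledMean]
  rw [show ((n : ℂ))⁻¹ = (((n : ℝ)⁻¹ : ℝ) : ℂ) by simp, Complex.im_ofReal_mul, Complex.im_sum]
  refine mul_nonpos_of_nonneg_of_nonpos (by positivity) (Finset.sum_nonpos fun j _ => ?_)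
  rw [Complex.inv_im]
  refine div_nonpos_of_nonpos_of_nonneg ?_ (Complex.normSq_nonneg _)
  simpa using hz.le

theorem norm_mul_im_le [l.NeBot] (hl : l ≤ atTop) (hx : ScaledZeros x φ σ p q)
    (h : IsLimitPair x φ l f W) {t : ℝ} (ht : t ∈ Set.Icc (0 : ℝ) 1) {z : ℂ} (hz : 0 < z.im) :
    ‖f t z‖ * z.im ≤ t := by
  have hψ := BddLipschitz.cauchyKernel (p := p) (q := q) hz
    fun u _ => le_norm_sub_ofReal le_rfl u
  have hlim := (h.cauchy t ht z hz).norm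
  have hlim2 := (tendsto_floor_mul_div hl ht.1).const_mul (z.im⁻¹)
  have := le_of_tendsto_of_tendsto hlim hlim2
    (Eventually.of_forall fun n => hx.norm_scaledMean_le hψ (floor_mul_le ht n))
  rw [inv_mul_eq_div, le_div_iff₀ hz] at this
  exact this

theorem continuousOn_potential [l.NeBot] (hl : l ≤ atTop) (hx : ScaledZeros x φ σ p q)
    (h : IsLimitPair x φ l f W) :
    ContinuousOn (fun r : ℝ × ℂ => W r.1 r.2) (Set.Icc 0 1 ×ˢ {z | 0 < z.im}) := by
  rintro ⟨t₀, z₀⟩ ⟨ht₀, hz₀⟩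
  have ht₀ : t₀ ∈ Set.Icc (0 : ℝ) 1 := ht₀
  have hz₀ : 0 < z₀.im := hz₀
  have hε : 0 < z₀.im / 2 := half_pos hz₀
  set ε := z₀.im / 2 with hεdef
  have hψ := BddLipschitz.logKernel (p := p) (q := q) hz₀ le_rfl (le_refl ‖z₀‖)
  set K := |Real.log z₀.im| + |Real.log (‖z₀‖ + max |p| |q|)| + Real.pi + z₀.im⁻¹ * (q - p) with hK
  have hbound : ∀ᶠ r : ℝ × ℂ in 𝓝[Set.Icc 0 1 ×ˢ {z | 0 < z.im}] (t₀, z₀),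
      ‖W r.1 r.2 - W t₀ z₀‖ ≤ ε⁻¹ * ‖r.2 - z₀‖ + K * |r.1 - t₀| := by
    have hnear : ∀ᶠ r : ℝ × ℂ in 𝓝[Set.Icc 0 1 ×ˢ {z | 0 < z.im}] (t₀, z₀), ε < r.2.im :=
      nhdsWithin_le_nhds ((Complex.continuous_im.comp continuous_snd).continuousAt.eventually
        (lt_mem_nhds (half_lt_self hz₀)))
    filter_upwards [hnear, self_mem_nhdsWithin] with r hr hr2
    obtain ⟨ht, hz⟩ := hr2
    have hlim := ((h.log r.1 ht r.2 hz).sub (h.log t₀ ht₀ z₀ hz₀)).norm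
    have hlim2 := (((tendsto_floor_mul_div hl ht.1).sub
      (tendsto_floor_mul_div hl ht₀.1)).abs.const_mul K).const_add (ε⁻¹ * ‖r.2 - z₀‖)
    refine le_of_tendsto_of_tendsto hlim hlim2 (Eventually.of_forall fun n => ?_)
    have h1 : ‖scaledMean x φ n ⌊(n : ℝ) * r.1⌋₊ (fun u => Complex.log (r.2 - u)) -
        scaledMean x φ n ⌊(n : ℝ) * r.1⌋₊ (fun u => Complex.log (z₀ - u))‖ ≤
        ε⁻¹ * ‖r.2 - z₀‖ := by
      refine norm_scaledMean_sub_le_of_forall (floor_mul_le ht n) (by positivity) fun j _ => ?_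
      refine (norm_log_sub_log_le hε (by simpa using hr.le) (by simp; linarith)).trans_eq ?_
      rw [sub_sub_sub_cancel_right]
    have h2 := hx.norm_scaledMean_sub_le hψ (floor_mul_le ht₀ n) (floor_mul_le ht n)
    exact (norm_sub_le_norm_sub_add_norm_sub _ _ _).trans (add_le_add h1 h2)
  have hlim0 : Tendsto (fun r : ℝ × ℂ => ε⁻¹ * ‖r.2 - z₀‖ + K * |r.1 - t₀|)
      (𝓝[Set.Icc 0 1 ×ˢ {z | 0 < z.im}] (t₀, z₀)) (𝓝 0) := by
    have : Continuous fun r : ℝ × ℂ => ε⁻¹ * ‖r.2 - z₀‖ + K * |r.1 - t₀| := by fun_prop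
    have := this.tendsto (t₀, z₀)
    simp only [sub_self, norm_zero, abs_zero, mul_zero, add_zero] at this
    exact this.mono_left nhdsWithin_le_nhds
  rw [ContinuousWithinAt, tendsto_iff_norm_sub_tendsto_zero]
  exact squeeze_zero' (Eventually.of_forall fun _ => norm_nonneg _) hbound hlim0

theorem abs_re_potential_sub_le [l.NeBot] (hl : l ≤ atTop) (hx : ScaledZeros x φ σ p q)
    (h : IsLimitPair x φ l f W) {t : ℝ} (ht : t ∈ Set.Icc (0 : ℝ) 1) {z : ℂ} (hz : 0 < z.im)
    (hR : 2 * max |p| |q| ≤ ‖z‖) :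
    |(W t z).re - t * Real.log ‖z‖| ≤ 2 * max |p| |q| / ‖z‖ := by
  set R := max |p| |q| with hRdef
  have hR0 : 0 ≤ R := le_max_of_le_left (abs_nonneg _)
  have hz0 : 0 < ‖z‖ := norm_pos_iff.2 fun h0 => by simp [h0] at hz
  have hlim := (((Complex.continuous_re.tendsto _).comp (h.log t ht z hz)).sub
    ((tendsto_floor_mul_div hl ht.1).mul_const (Real.log ‖z‖))).abs
  refine le_of_tendsto hlim ?_
  filter_upwards [hl (eventually_ge_atTop 1)] with n hn
  set N := ⌊(n : ℝ) * t⌋₊ with hN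
  have hNn : N ≤ n := floor_mul_le ht n
  have hpos : (0 : ℝ) < n := by exact_mod_cast hn
  have e : (Complex.re ∘ fun n : ℕ => scaledMean x φ n ⌊(n : ℝ) * t⌋₊ fun u => Complex.log (z - u)) n -
      (N : ℝ) / n * Real.log ‖z‖ =
      (n : ℝ)⁻¹ * ∑ j ∈ Finset.Icc 1 N, (Real.log ‖z - (x N j / φ n : ℝ)‖ - Real.log ‖z‖) := by
    simp only [Function.comp, scaledMean, ← hN]
    rw [Finset.sum_sub_distrib, Finset.sum_const, Nat.card_Icc, add_tsub_cancel_right, nsmul_eq_mul,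
      show ((n : ℂ))⁻¹ = (((n : ℝ)⁻¹ : ℝ) : ℂ) by simp, Complex.re_ofReal_mul, Complex.re_sum]
    simp only [Complex.log_re]
    ring
  have hterm : ∀ j ∈ Finset.Icc 1 N,
      ‖Real.log ‖z - (x N j / φ n : ℝ)‖ - Real.log ‖z‖‖ ≤ 2 * R / ‖z‖ := by
    intro j hj
    rw [Finset.mem_Icc] at hj
    have hmem := hx.mem n N j hNn hj.1 hj.2
    have hy : ‖((x N j / φ n : ℝ) : ℂ)‖ ≤ R := by
      rw [Complex.norm_real, Real.norm_eq_abs]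
      exact abs_le_max_abs_abs hmem.1 hmem.2
    generalize ((x N j / φ n : ℝ) : ℂ) = y at hy
    have h1 : ‖z‖ / 2 ≤ ‖z - y‖ := by
      have := norm_sub_norm_le z y
      linarith
    have h2 : |‖z - y‖ - ‖z‖| ≤ R := by
      refine (abs_norm_sub_norm_le _ _).trans ?_
      simpa using hy
    rw [Real.norm_eq_abs]
    refine (abs_log_sub_log_le (half_pos hz0) h1 (by linarith)).trans ?_
    rw [div_div_eq_mul_div, mul_comm]
    gcongr
  rw [e, abs_mul, abs_of_pos (inv_pos.2 hpos), inv_mul_le_iff₀ hpos, ← Real.norm_eq_abs]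
  have h1 := norm_sum_le_of_le _ hterm
  rw [Finset.sum_const, Nat.card_Icc, add_tsub_cancel_right, nsmul_eq_mul] at h1
  refine h1.trans (mul_le_mul_of_nonneg_right (by exact_mod_cast hNn) (by positivity))

end IsLimitPair

section

variable {x : ℕ → ℕ → ℝ} {φ : ℕ → ℝ} {σ p q : ℝ} {c : ℕ → Coeffs} {C : Coeffs}

/-- Imaginary part of the limit quadratic divided by a convex combination of two quotients of
consecutive polynomials. -/
theorem eventually_le_im_quad_div (hx : ScaledZeros x φ σ p q) (hr : RealRecurrence x φ c C)
    {l : Filter (ℕ × ℕ)} {t : ℝ} (ht : 0 < t) {n₁ k₁ n₂ k₂ : ℕ × ℕ → ℕ}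
    (hn₁ : Tendsto n₁ l atTop) (hk₁ : Tendsto (fun i => (k₁ i : ℝ) / n₁ i) l (𝓝 t))
    (hn₂ : Tendsto n₂ l atTop) (hk₂ : Tendsto (fun i => (k₂ i : ℝ) / n₂ i) l (𝓝 t))
    {s : ℝ} (hs : s ∈ Set.Icc (0 : ℝ) 1) {z : ℂ} (hz : 0 < z.im) {θ : ℝ} (hθ : 0 < θ) :
    ∀ᶠ i in l, C.a₂ / t * z.im ≤ (((C.dilate σ t).quad z - θ) /
      ((1 - s) * zeroRatio x φ (n₂ i) (k₂ i) z + s * zeroRatio x φ (n₁ i) (k₁ i) z)).im := by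
  set Q := C.dilate σ t with hQ
  obtain ⟨sg, hsg⟩ := exists_sign_function hx hr ht
  filter_upwards [eventually_realQuad_le hx hr ht hn₁ hk₁ hθ,
    eventually_realQuad_le hx hr ht hn₂ hk₂ hθ, hsg hn₁ hk₁ hθ, hsg hn₂ hk₂ hθ,
    hn₁.eventually_ge_atTop 1, hn₂.eventually_ge_atTop 1] with i y₁ y₂ g₁ g₂ m₁ m₂
  have hs1 : 0 ≤ 1 - s := by linarith [hs.2]
  let w : Finset.Icc 1 (k₂ i) ⊕ Finset.Icc 1 (k₁ i) → ℝ :=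
    Sum.elim (fun j => (1 - s) * ratioWeight x φ c (n₂ i) (k₂ i) j)
      fun j => s * ratioWeight x φ c (n₁ i) (k₁ i) j
  let y : Finset.Icc 1 (k₂ i) ⊕ Finset.Icc 1 (k₁ i) → ℝ :=
    Sum.elim (fun j => x (k₂ i) j / φ (n₂ i)) fun j => x (k₁ i) j / φ (n₁ i)
  let d : ℝ := (1 - s) * ratioShift x φ c (n₂ i) (k₂ i) + s * ratioShift x φ c (n₁ i) (k₁ i)
  have hw : ∀ j, 0 ≤ w j := by
    rintro (j | j)
    · exact mul_nonneg hs1 (ratioWeight_nonneg hx hr m₂ j.2)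
    · exact mul_nonneg hs.1 (ratioWeight_nonneg hx hr m₁ j.2)
  have hyθ : ∀ j, Q.a₂ * y j ^ 2 + Q.a₁ * y j + (Q.a₀ - θ) ≤ 0 := by
    rintro (j | j)
    · have := y₂ j j.2
      simp only [Coeffs.realQuad] at this
      simp only [y, Sum.elim_inl]
      linarith
    · have := y₁ j j.2
      simp only [Coeffs.realQuad] at this
      simp only [y, Sum.elim_inr]
      linarith
  have hreal : ∀ ζ : ℝ, 0 < Q.a₂ * ζ ^ 2 + Q.a₁ * ζ + (Q.a₀ - θ) →
      ζ - d - ∑ j, w j / (ζ - y j) ≠ 0 := by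
    intro ζ hζ
    have hζ' : θ < Q.realQuad ζ := by simp only [Coeffs.realQuad]; linarith
    have e : ζ - d - ∑ j, w j / (ζ - y j) = (1 - s) * realRatio x φ (n₂ i) (k₂ i) ζ +
        s * realRatio x φ (n₁ i) (k₁ i) ζ := by
      rw [realRatio_eq_partialFraction hx hr m₁ fun j hj h => absurd (y₁ j hj) (by
          rw [← h]; exact not_le.2 hζ'),
        realRatio_eq_partialFraction hx hr m₂ fun j hj h => absurd (y₂ j hj) (by
          rw [← h]; exact not_le.2 hζ'), Fintype.sum_sum_type]
      simp only [w, y, d, Sum.elim_inl, Sum.elim_inr]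
      rw [Finset.sum_coe_sort (Finset.Icc 1 (k₂ i)) fun j => (1 - s) *
          ratioWeight x φ c (n₂ i) (k₂ i) j / (ζ - x (k₂ i) j / φ (n₂ i)),
        Finset.sum_coe_sort (Finset.Icc 1 (k₁ i)) fun j => s *
          ratioWeight x φ c (n₁ i) (k₁ i) j / (ζ - x (k₁ i) j / φ (n₁ i))]
      simp only [mul_div_assoc, ← Finset.mul_sum]
      ring
    rw [e]
    intro h0
    have h1 := g₁ ζ hζ'
    have h2 := g₂ ζ hζ'
    have h3 : (1 - s) * (sg ζ * realRatio x φ (n₂ i) (k₂ i) ζ) +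
        s * (sg ζ * realRatio x φ (n₁ i) (k₁ i) ζ) = 0 := by
      linear_combination sg ζ * h0
    rcases eq_or_lt_of_le hs.1 with h | h
    · rw [← h] at h3
      linarith
    · have := mul_pos h h1
      have := mul_nonneg hs1 h2.le
      linarith
  have key := mul_im_le_im_quadratic_div w y hw d Q.a₂ Q.a₁ (Q.a₀ - θ) hyθ hreal z hz
  have e : (z - d - ∑ j, (w j : ℂ) / (z - y j)) =
      (1 - s) * zeroRatio x φ (n₂ i) (k₂ i) z + s * zeroRatio x φ (n₁ i) (k₁ i) z := by
    rw [zeroRatio_eq_partialFraction hx hr m₁ fun j _ => sub_ofReal_ne_zero hz _,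
      zeroRatio_eq_partialFraction hx hr m₂ fun j _ => sub_ofReal_ne_zero hz _,
      Fintype.sum_sum_type]
    simp only [w, y, d, Sum.elim_inl, Sum.elim_inr]
    rw [Finset.sum_coe_sort (Finset.Icc 1 (k₂ i)) fun j => (((1 - s) *
        ratioWeight x φ c (n₂ i) (k₂ i) j : ℝ) : ℂ) / (z - (x (k₂ i) j / φ (n₂ i) : ℝ)),
      Finset.sum_coe_sort (Finset.Icc 1 (k₁ i)) fun j => ((s *
        ratioWeight x φ c (n₁ i) (k₁ i) j : ℝ) : ℂ) / (z - (x (k₁ i) j / φ (n₁ i) : ℝ))]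
    push_cast
    simp only [mul_div_assoc, ← Finset.mul_sum]
    ring
  rw [e] at key
  have e2 : (Q.a₂ * z ^ 2 + Q.a₁ * z + ((Q.a₀ - θ : ℝ) : ℂ)) = Q.quad z - θ := by
    simp only [Coeffs.quad]; push_cast; ring
  rw [e2] at key
  exact key

/-- The limit of the quotients of consecutive polynomials, expressed through the limit `f` of the
rescaled logarithmic derivatives. -/
noncomputable def limitRatio (C : Coeffs) (σ : ℝ) (f : ℝ → ℂ → ℂ) (t : ℝ) (z : ℂ) : ℂ :=
  (C.dilate σ t).quad z * f t z + (C.dilate σ t).lin z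

variable {l l₁ l₂ : Filter ℕ} {f f₁ f₂ W W₁ W₂ : ℝ → ℂ → ℂ}

theorem IsLimitPair.tendsto_zeroRatio (hx : ScaledZeros x φ σ p q) (hr : RealRecurrence x φ c C)
    (hl : l ≤ atTop) (h : IsLimitPair x φ l f W) {t : ℝ} (ht : t ∈ Set.Ioc (0 : ℝ) 1) {z : ℂ}
    (hz : 0 < z.im) : Tendsto (fun n : ℕ => zeroRatio x φ n ⌊(n : ℝ) * t⌋₊ z) l
      (𝓝 (limitRatio C σ f t z)) :=
  _root_.tendsto_zeroRatio hx hr (n := fun n => n) ht.1 hl (tendsto_floor_mul_div hl ht.1.le) hz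
    (h.cauchy t ⟨ht.1.le, ht.2⟩ z hz)

theorem IsLimitPair.im_le_im_limitRatio [l.NeBot] (hx : ScaledZeros x φ σ p q)
    (hr : RealRecurrence x φ c C) (hl : l ≤ atTop) (h : IsLimitPair x φ l f W) {t : ℝ}
    (ht : t ∈ Set.Ioc (0 : ℝ) 1) {z : ℂ} (hz : 0 < z.im) : z.im ≤ (limitRatio C σ f t z).im := by
  refine ge_of_tendsto ((Complex.continuous_im.tendsto _).comp
    (h.tendsto_zeroRatio hx hr hl ht hz)) ?_
  filter_upwards [hl (eventually_ge_atTop 1)] with n hn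
  exact im_le_im_zeroRatio hx hr hn hz

theorem le_im_quad_div_limitRatio [l₁.NeBot] [l₂.NeBot] (hx : ScaledZeros x φ σ p q)
    (hr : RealRecurrence x φ c C) (hl₁ : l₁ ≤ atTop) (hl₂ : l₂ ≤ atTop)
    (h₁ : IsLimitPair x φ l₁ f₁ W₁) (h₂ : IsLimitPair x φ l₂ f₂ W₂) {t : ℝ}
    (ht : t ∈ Set.Ioc (0 : ℝ) 1) {z : ℂ} (hz : 0 < z.im) {s : ℝ} (hs : s ∈ Set.Icc (0 : ℝ) 1) :
    C.a₂ / t * z.im ≤ ((C.dilate σ t).quad z /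
      ((1 - s) * limitRatio C σ f₂ t z + s * limitRatio C σ f₁ t z)).im := by
  set F := (1 - s) * limitRatio C σ f₂ t z + s * limitRatio C σ f₁ t z with hF
  have hF0 : F ≠ 0 := by
    intro h0
    have h1 := h₁.im_le_im_limitRatio hx hr hl₁ ht hz
    have h2 := h₂.im_le_im_limitRatio hx hr hl₂ ht hz
    have h3 := congrArg Complex.im h0
    rw [hF, ← Complex.ofReal_one, ← Complex.ofReal_sub, Complex.add_im, Complex.im_ofReal_mul,
      Complex.im_ofReal_mul, Complex.zero_im] at h3
    have := mul_le_mul_of_nonneg_left h1 hs.1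
    have := mul_le_mul_of_nonneg_left h2 (sub_nonneg.2 hs.2)
    nlinarith
  have key : ∀ θ : ℝ, 0 < θ → C.a₂ / t * z.im ≤ (((C.dilate σ t).quad z - θ) / F).im := by
    intro θ hθ
    have hf1 : Tendsto (Prod.fst : ℕ × ℕ → ℕ) (l₁ ×ˢ l₂) l₁ := tendsto_fst
    have hf2 : Tendsto (Prod.snd : ℕ × ℕ → ℕ) (l₁ ×ˢ l₂) l₂ := tendsto_snd
    have hev := eventually_le_im_quad_div hx hr (l := l₁ ×ˢ l₂) ht.1 (n₁ := Prod.fst)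
      (k₁ := fun i => ⌊(i.1 : ℝ) * t⌋₊) (n₂ := Prod.snd) (k₂ := fun i => ⌊(i.2 : ℝ) * t⌋₊)
      (hf1.mono_right hl₁) ((tendsto_floor_mul_div hl₁ ht.1.le).comp hf1) (hf2.mono_right hl₂)
      ((tendsto_floor_mul_div hl₂ ht.1.le).comp hf2) hs hz hθ
    refine ge_of_tendsto ((Complex.continuous_im.tendsto _).comp (Tendsto.div tendsto_const_nhds
      ((((h₂.tendsto_zeroRatio hx hr hl₂ ht hz).comp hf2).const_mul _).add
      (((h₁.tendsto_zeroRatio hx hr hl₁ ht hz).comp hf1).const_mul _)) hF0)) hev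
  have hcont : ContinuousAt (fun θ : ℝ => (((C.dilate σ t).quad z - θ) / F).im) 0 := by
    have : Continuous fun θ : ℝ => (((C.dilate σ t).quad z - θ) / F).im := by fun_prop
    exact this.continuousAt
  have hlim := hcont.tendsto.mono_left (nhdsWithin_le_nhds (s := Set.Ioi (0 : ℝ)))
  simp only [Complex.ofReal_zero, sub_zero] at hlim
  exact ge_of_tendsto hlim (by filter_upwards [self_mem_nhdsWithin] with θ hθ using key θ hθ)

/-- Growth of the logarithm of the limit ratio between two solutions which differ by a nonnegative
multiple of `i`. -/
theorem log_limitRatio_sub_le [l₁.NeBot] [l₂.NeBot] (hx : ScaledZeros x φ σ p q)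
    (hr : RealRecurrence x φ c C) (hl₁ : l₁ ≤ atTop) (hl₂ : l₂ ≤ atTop)
    (h₁ : IsLimitPair x φ l₁ f₁ W₁) (h₂ : IsLimitPair x φ l₂ f₂ W₂) {t : ℝ}
    (ht : t ∈ Set.Ioc (0 : ℝ) 1) {z : ℂ} (hz : 0 < z.im) {κ : ℝ} (hκ : 0 ≤ κ)
    (hd : f₁ t z - f₂ t z = κ * Complex.I) :
    Real.log ‖limitRatio C σ f₁ t z‖ - Real.log ‖limitRatio C σ f₂ t z‖ ≤
      κ * (|C.a₂| / t * z.im) := by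
  set F₁ := limitRatio C σ f₁ t z with hF₁
  set F₂ := limitRatio C σ f₂ t z with hF₂
  set Q := (C.dilate σ t).quad z with hQ
  have hdiff : F₁ - F₂ = Q * (κ * Complex.I) := by
    rw [← hd, hF₁, hF₂]; simp only [limitRatio]; ring
  have h1 := h₁.im_le_im_limitRatio hx hr hl₁ ht hz
  have h2 := h₂.im_le_im_limitRatio hx hr hl₂ ht hz
  let F : ℝ → ℂ := fun s => F₂ + s * (F₁ - F₂)
  have hFim : ∀ s ∈ Set.Icc (0 : ℝ) 1, 0 < (F s).im := by
    intro s hs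
    have e : F s = ((1 - s : ℝ) : ℂ) * F₂ + s * F₁ := by simp only [F]; push_cast; ring
    rw [e, Complex.add_im, Complex.im_ofReal_mul, Complex.im_ofReal_mul]
    have := mul_le_mul_of_nonneg_left h1 hs.1
    have := mul_le_mul_of_nonneg_left h2 (sub_nonneg.2 hs.2)
    nlinarith
  have hderiv : ∀ s ∈ Set.Icc (0 : ℝ) 1, HasDerivAt (fun s => Real.log ‖F s‖)
      (-(κ * (Q / F s).im)) s := by
    intro s hs
    have g1 : HasDerivAt F (F₁ - F₂) s := by
      have h0' := ((Complex.ofRealCLM.hasDerivAt (x := s)).mul_const (F₁ - F₂)).const_add F₂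
      simp only [Complex.ofRealCLM_apply, Complex.ofReal_one, one_mul] at h0'
      exact h0'
    have g2 := g1.clog_real (Or.inr (hFim s hs).ne')
    have g3 := Complex.reCLM.hasFDerivAt.comp_hasDerivAt s g2
    simp only [Complex.reCLM_apply] at g3
    have e : ((F₁ - F₂) / F s).re = -(κ * (Q / F s).im) := by
      rw [hdiff, show Q * (κ * Complex.I) / F s = (κ : ℂ) * (Complex.I * (Q / F s)) by ring,
        Complex.re_ofReal_mul, Complex.I_mul_re]
      ring
    rw [e] at g3
    refine g3.congr_of_eventuallyEq (Eventually.of_forall fun s => ?_)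
    simp [Complex.log_re]
  have hle : ∀ s ∈ Set.Icc (0 : ℝ) 1, -(κ * (Q / F s).im) ≤ κ * (|C.a₂| / t * z.im) := by
    intro s hs
    have g := le_im_quad_div_limitRatio hx hr hl₁ hl₂ h₁ h₂ ht hz hs
    have e : F s = (1 - s) * limitRatio C σ f₂ t z + s * limitRatio C σ f₁ t z := by
      simp only [F]; ring
    rw [← e] at g
    rw [neg_le, ← mul_neg]
    refine mul_le_mul_of_nonneg_left (le_trans ?_ g) hκ
    rw [← neg_mul, ← neg_div]
    gcongr
    · exact ht.1.le
    · exact neg_abs_le _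
  have := (convex_Icc (0 : ℝ) 1).image_sub_le_mul_sub_of_deriv_le
    (f := fun s => Real.log ‖F s‖) (C := κ * (|C.a₂| / t * z.im))
    (fun s hs => (hderiv s hs).continuousAt.continuousWithinAt)
    (fun s hs => (hderiv s (interior_subset hs)).differentiableAt.differentiableWithinAt)
    (fun s hs => by rw [(hderiv s (interior_subset hs)).deriv]; exact hle s (interior_subset hs))
    0 (by simp) 1 (by simp) zero_le_one
  simpa [F] using this

end

section

variable {x : ℕ → ℕ → ℝ} {φ : ℕ → ℝ} {σ p q : ℝ} {c : ℕ → Coeffs} {C : Coeffs}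
  {l l₁ l₂ : Filter ℕ} {f f₁ f₂ W W₁ W₂ : ℝ → ℂ → ℂ}

theorem IsLimitPair.limitRatio_ne_zero [l.NeBot] (hx : ScaledZeros x φ σ p q)
    (hr : RealRecurrence x φ c C) (hl : l ≤ atTop) (h : IsLimitPair x φ l f W) {t : ℝ}
    (ht : t ∈ Set.Ioc (0 : ℝ) 1) {z : ℂ} (hz : 0 < z.im) : limitRatio C σ f t z ≠ 0 := by
  intro h0
  have := h.im_le_im_limitRatio hx hr hl ht hz
  rw [h0, Complex.zero_im] at this
  linarith

theorem IsLimitPair.hasDerivWithinAt_re_potential [l.NeBot] (hx : ScaledZeros x φ σ p q)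
    (hr : RealRecurrence x φ c C) (hl : l ≤ atTop) (h : IsLimitPair x φ l f W) {t : ℝ}
    (ht : t ∈ Set.Ioc (0 : ℝ) 1) {z : ℂ} (hz : 0 < z.im) :
    HasDerivWithinAt (fun s => (W s z).re) (Real.log ‖limitRatio C σ f t z‖) (Set.Icc 0 1) t := by
  have ht' : t ∈ Set.Icc (0 : ℝ) 1 := ⟨ht.1.le, ht.2⟩
  refine hasDerivWithinAt_of_tendsto_increment hl
    (e := fun n k => Real.log ‖zeroRatio x φ n k z‖) (fun s hs => ?_) ht' ?_
  · refine ((Complex.continuous_re.tendsto _).comp (h.log s hs z hz)).congr fun n => ?_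
    exact re_scaledMean_log hz
  · have h1 := _root_.tendsto_zeroRatio hx hr ht.1
      (tendsto_fst_ratioFilter.mono_right hl) (tendsto_div_ratioFilter (l := l)) hz
      (tendsto_scaledMean_ratioFilter hx hl (BddLipschitz.cauchyKernel hz
        fun u _ => le_norm_sub_ofReal le_rfl u) ht' (h.cauchy t ht' z hz))
    exact h1.norm.log (norm_ne_zero_iff.2 (h.limitRatio_ne_zero hx hr hl ht hz))

theorem IsLimitPair.hasDerivAt_re_potential_line [l.NeBot] (h : IsLimitPair x φ l f W) {t : ℝ}
    (ht : t ∈ Set.Icc (0 : ℝ) 1) {z : ℂ} (hz : 0 < z.im) (d : ℂ) :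
    HasDerivAt (fun r : ℝ => (W t (z + r * d)).re) (f t z * d).re 0 := by
  have h1 : HasDerivAt (fun r : ℝ => z + r * d) d 0 := by
    have h0' := ((Complex.ofRealCLM.hasDerivAt (x := (0 : ℝ))).mul_const d).const_add z
    simp only [Complex.ofRealCLM_apply, Complex.ofReal_one, one_mul] at h0'
    exact h0'
  have h2 : HasDerivAt (W t) (f t z) (z + ((0 : ℝ) : ℂ) * d) := by
    simpa using h.hasDerivAt_potential ht hz
  have h3 := h2.comp (0 : ℝ) h1
  exact Complex.reCLM.hasFDerivAt.comp_hasDerivAt (0 : ℝ) h3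

/-- If the difference of two limit potentials exceeds `K * t` somewhere, then this happens at a
maximum point, where the derivatives are controlled. -/
theorem exists_max_potential_sub [l₁.NeBot] [l₂.NeBot] (hx : ScaledZeros x φ σ p q)
    (hr : RealRecurrence x φ c C) (hl₁ : l₁ ≤ atTop) (hl₂ : l₂ ≤ atTop)
    (h₁ : IsLimitPair x φ l₁ f₁ W₁) (h₂ : IsLimitPair x φ l₂ f₂ W₂) {K : ℝ} (hK : 0 ≤ K)
    {t₀ : ℝ} (ht₀ : t₀ ∈ Set.Icc (0 : ℝ) 1) {z₀ : ℂ} (hz₀ : 0 < z₀.im)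
    (hlt : K * t₀ < (W₁ t₀ z₀).re - (W₂ t₀ z₀).re) :
    ∃ t ∈ Set.Ioc (0 : ℝ) 1, ∃ z : ℂ, 0 < z.im ∧ K * t < (W₁ t z).re - (W₂ t z).re ∧
      ∃ κ : ℝ, 0 ≤ κ ∧ f₁ t z - f₂ t z = κ * Complex.I ∧ K ≤ κ * (|C.a₂| / t * z.im) := by
  set v : ℝ × ℂ → ℝ := fun r => (W₁ r.1 r.2).re - (W₂ r.1 r.2).re - K * r.1 with hv
  set m := v (t₀, z₀) with hm
  have hm0 : 0 < m := by simp only [hm, hv]; linarith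
  set R := max |p| |q| with hR
  have hR0 : 0 ≤ R := le_max_of_le_left (abs_nonneg _)
  set T := 2 * R + 8 * R / m + ‖z₀‖ + 1 with hT
  have hT1 : 0 ≤ 8 * R / m := by positivity
  have hT0 : 0 < T := by positivity
  set S : Set (ℝ × ℂ) := Set.Icc 0 1 ×ˢ (Metric.closedBall 0 T ∩ {z | z₀.im ≤ z.im}) with hS
  have hSc : IsCompact S := isCompact_Icc.prod ((isCompact_closedBall _ _).inter_right
    (isClosed_le continuous_const Complex.continuous_im))
  have hS0 : (t₀, z₀) ∈ S :=
    ⟨ht₀, by simp only [Metric.mem_closedBall, dist_zero_right]; linarith, le_refl z₀.im⟩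
  have hsub : S ⊆ Set.Icc 0 1 ×ˢ {z | 0 < z.im} := fun r hr =>
    ⟨hr.1, lt_of_lt_of_le hz₀ hr.2.2⟩
  have hcont : ContinuousOn v S := by
    have c1 := Complex.continuous_re.comp_continuousOn ((h₁.continuousOn_potential hl₁ hx).mono hsub)
    have c2 := Complex.continuous_re.comp_continuousOn ((h₂.continuousOn_potential hl₂ hx).mono hsub)
    exact (c1.sub c2).sub (continuous_const.mul continuous_fst).continuousOn
  obtain ⟨⟨t, z⟩, htz, hmax⟩ := hSc.exists_isMaxOn ⟨_, hS0⟩ hcont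
  have hmz : m ≤ v (t, z) := hmax hS0
  have hglob : ∀ s ∈ Set.Icc (0 : ℝ) 1, ∀ w : ℂ, z₀.im ≤ w.im → v (s, w) ≤ v (t, z) := by
    intro s hs w hw
    by_cases hwT : ‖w‖ ≤ T
    · exact hmax ⟨hs, by simpa using hwT, hw⟩
    · push Not at hwT
      have hw0 : 0 < w.im := hz₀.trans_le hw
      have hb : 2 * R ≤ ‖w‖ := by linarith [norm_nonneg z₀]
      have a1 := abs_le.1 (h₁.abs_re_potential_sub_le hl₁ hx hs hw0 hb)
      have a2 := abs_le.1 (h₂.abs_re_potential_sub_le hl₂ hx hs hw0 hb)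
      have a3 : 2 * R / ‖w‖ ≤ m / 4 := by
        rw [div_le_iff₀ (hT0.trans hwT)]
        have : 8 * R / m * m = 8 * R := by field_simp
        have : 8 * R / m * m ≤ ‖w‖ * m :=
          mul_le_mul_of_nonneg_right (by linarith [norm_nonneg z₀]) hm0.le
        linarith
      have a4 : 0 ≤ K * s := mul_nonneg hK hs.1
      have : v (s, w) ≤ m := by simp only [hv]; linarith [a1.2, a2.1]
      linarith
  have ht : t ∈ Set.Icc (0 : ℝ) 1 := htz.1
  have hzim : z₀.im ≤ z.im := htz.2.2
  have hz : 0 < z.im := hz₀.trans_le hzim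
  have ht1 : t ∈ Set.Ioc (0 : ℝ) 1 := by
    refine ⟨lt_of_le_of_ne ht.1 fun h0 => ?_, ht.2⟩
    rw [← h0] at hmz
    simp only [hv, h₁.potential_zero hz, h₂.potential_zero hz] at hmz
    simp at hmz
    linarith
  have hline : ∀ d : ℂ, HasDerivAt (fun r : ℝ => v (t, z + r * d)) ((f₁ t z - f₂ t z) * d).re 0 := by
    intro d
    have := ((h₁.hasDerivAt_re_potential_line ht hz d).sub
      (h₂.hasDerivAt_re_potential_line ht hz d)).sub_const (K * t)
    rw [sub_mul, Complex.sub_re]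
    exact this
  have hre : (f₁ t z - f₂ t z).re = 0 := by
    have h1 := hline 1
    rw [mul_one] at h1
    refine IsLocalMax.hasDerivAt_eq_zero (Eventually.of_forall fun r => ?_) h1
    simpa using hglob t ht (z + r * 1) (by simpa using hzim)
  have him : 0 ≤ (f₁ t z - f₂ t z).im := by
    have h1 := (hline Complex.I).hasFDerivAt.hasFDerivWithinAt (s := Set.Ici (0 : ℝ))
    have h2 : IsLocalMaxOn (fun r : ℝ => v (t, z + r * Complex.I)) (Set.Ici 0) 0 := by
      refine IsMaxOn.localize fun r hr => ?_
      have hr : 0 ≤ r := hr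
      simpa using hglob t ht (z + r * Complex.I) (by simp; linarith)
    have h3 := h2.hasFDerivWithinAt_nonpos h1 (y := 1)
      (mem_posTangentConeAt_of_segment_subset (by
        rw [zero_add, segment_eq_Icc zero_le_one]; exact Set.Icc_subset_Ici_self))
    simpa using h3
  refine ⟨t, ht1, z, hz, by have := hm0.trans_le hmz; simp only [hv] at this; linarith,
    (f₁ t z - f₂ t z).im, him, ?_, ?_⟩
  · apply Complex.ext <;> simp [hre]
  · have hd : f₁ t z - f₂ t z = ((f₁ t z - f₂ t z).im : ℂ) * Complex.I := by
      conv_lhs => rw [← Complex.re_add_im (f₁ t z - f₂ t z), hre]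
      simp
    refine le_trans ?_ (log_limitRatio_sub_le hx hr hl₁ hl₂ h₁ h₂ ht1 hz him hd)
    have h1 := ((h₁.hasDerivWithinAt_re_potential hx hr hl₁ ht1 hz).sub
      (h₂.hasDerivWithinAt_re_potential hx hr hl₂ ht1 hz)).sub
      ((hasDerivWithinAt_id t (Set.Icc 0 1)).const_mul K)
    have h2 : IsLocalMaxOn (fun s : ℝ => (W₁ s z).re - (W₂ s z).re - K * s) (Set.Icc 0 1) t :=
      IsMaxOn.localize fun s hs => hglob s hs z hzim
    have h3 := IsLocalMaxOn.hasFDerivWithinAt_nonpos (y := -t) h2 h1.hasFDerivWithinAt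
      (mem_posTangentConeAt_of_segment_subset (by
        rw [add_neg_cancel, segment_symm, segment_eq_Icc ht.1]
        exact Set.Icc_subset_Icc_right ht.2))
    simp at h3
    have := ht1.1
    by_contra! hcon
    nlinarith

theorem re_potential_sub_le_mul [l₁.NeBot] [l₂.NeBot] (hx : ScaledZeros x φ σ p q)
    (hr : RealRecurrence x φ c C) (hl₁ : l₁ ≤ atTop) (hl₂ : l₂ ≤ atTop)
    (h₁ : IsLimitPair x φ l₁ f₁ W₁) (h₂ : IsLimitPair x φ l₂ f₂ W₂) {t : ℝ}
    (ht : t ∈ Set.Icc (0 : ℝ) 1) {z : ℂ} (hz : 0 < z.im) :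
    (W₁ t z).re - (W₂ t z).re ≤ (|C.a₂| + 1) * t := by
  have hg := abs_nonneg C.a₂
  by_contra! hcon
  obtain ⟨s, hs, w, hw, -, κ, hκ, hd, hle⟩ := exists_max_potential_sub hx hr hl₁ hl₂ h₁ h₂
    (by positivity) ht hz hcon
  have hs' : s ∈ Set.Icc (0 : ℝ) 1 := ⟨hs.1.le, hs.2⟩
  have a1 := h₁.im_nonpos hs' hw
  have a2 := h₂.norm_mul_im_le hl₂ hx hs' hw
  have a3 := (abs_le.1 (Complex.abs_im_le_norm (f₂ s w))).1
  have a4 := congrArg Complex.im hd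
  simp at a4
  have a5 : κ * w.im ≤ s := by
    refine le_trans (mul_le_mul_of_nonneg_right ?_ hw.le) a2
    linarith
  have a6 : κ * (|C.a₂| / s * w.im) ≤ |C.a₂| := by
    have e : κ * (|C.a₂| / s * w.im) = |C.a₂| * (κ * w.im) / s := by ring
    rw [e, div_le_iff₀ hs.1]
    exact mul_le_mul_of_nonneg_left a5 hg
  linarith

theorem re_potential_sub_le_mul_of_le_mul [l₁.NeBot] [l₂.NeBot] (hx : ScaledZeros x φ σ p q)
    (hr : RealRecurrence x φ c C) (hl₁ : l₁ ≤ atTop) (hl₂ : l₂ ≤ atTop)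
    (h₁ : IsLimitPair x φ l₁ f₁ W₁) (h₂ : IsLimitPair x φ l₂ f₂ W₂) {K K' : ℝ} (hK' : 0 ≤ K')
    (hKK : 2 * |C.a₂| * K < (1 + 2 * |C.a₂|) * K')
    (h : ∀ t ∈ Set.Icc (0 : ℝ) 1, ∀ z : ℂ, 0 < z.im → (W₁ t z).re - (W₂ t z).re ≤ K * t) {t : ℝ}
    (ht : t ∈ Set.Icc (0 : ℝ) 1) {z : ℂ} (hz : 0 < z.im) :
    (W₁ t z).re - (W₂ t z).re ≤ K' * t := by
  by_contra! hcon
  obtain ⟨s, hs, w, hw, hlt, κ, hκ, hd, hle⟩ := exists_max_potential_sub hx hr hl₁ hl₂ h₁ h₂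
    hK' ht hz hcon
  have hs' : s ∈ Set.Icc (0 : ℝ) 1 := ⟨hs.1.le, hs.2⟩
  have him : ∀ y ∈ Metric.ball w w.im, 0 < y.im := by
    intro y hy
    have h1 := (abs_le.1 (Complex.abs_im_le_norm (y - w))).1
    have h2 : ‖y - w‖ < w.im := by simpa [dist_eq_norm] using hy
    simp at h1
    linarith
  have hD : ∀ y : ℂ, 0 < y.im → HasDerivAt (fun y => W₁ s y - W₂ s y) (f₁ s y - f₂ s y) y :=
    fun y hy => (h₁.hasDerivAt_potential hs' hy).sub (h₂.hasDerivAt_potential hs' hy)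
  have key := norm_deriv_le_of_re_le (D := fun y => W₁ s y - W₂ s y) (M := K * s) hw
    (fun y hy => (hD y (him y hy)).differentiableAt.differentiableWithinAt)
    (fun y hy => by simpa using h s hs' y (him y hy)) (hD w hw)
  rw [hd] at key
  simp [abs_of_nonneg hκ] at key
  have hg := abs_nonneg C.a₂
  have a5 : κ * w.im ≤ 2 * (K - K') * s := by linarith
  have a6 : κ * (|C.a₂| / s * w.im) ≤ |C.a₂| * (2 * (K - K')) := by
    have e : κ * (|C.a₂| / s * w.im) = |C.a₂| * (κ * w.im) / s := by ring
    rw [e, div_le_iff₀ hs.1, mul_assoc]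
    exact mul_le_mul_of_nonneg_left a5 hg
  linarith

theorem re_potential_sub_nonpos [l₁.NeBot] [l₂.NeBot] (hx : ScaledZeros x φ σ p q)
    (hr : RealRecurrence x φ c C) (hl₁ : l₁ ≤ atTop) (hl₂ : l₂ ≤ atTop)
    (h₁ : IsLimitPair x φ l₁ f₁ W₁) (h₂ : IsLimitPair x φ l₂ f₂ W₂) {t : ℝ}
    (ht : t ∈ Set.Icc (0 : ℝ) 1) {z : ℂ} (hz : 0 < z.im) :
    (W₁ t z).re - (W₂ t z).re ≤ 0 := by
  set g := |C.a₂| with hgdef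
  have hg : 0 ≤ g := abs_nonneg _
  set ρ := (2 * g + 1) / (2 * g + 2) with hρ
  have hρ0 : 0 < ρ := by positivity
  have hρ1 : ρ < 1 := by rw [hρ, div_lt_one (by positivity)]; linarith
  have hρg : 2 * g < (1 + 2 * g) * ρ := by
    rw [hρ, ← mul_div_assoc, lt_div_iff₀ (by positivity)]
    nlinarith
  have hstep : ∀ m : ℕ, ∀ t ∈ Set.Icc (0 : ℝ) 1, ∀ z : ℂ, 0 < z.im →
      (W₁ t z).re - (W₂ t z).re ≤ ρ ^ m * (g + 1) * t := by
    intro m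
    induction m with
    | zero =>
      intro t ht z hz
      simpa using re_potential_sub_le_mul hx hr hl₁ hl₂ h₁ h₂ ht hz
    | succ m ih =>
      intro t ht z hz
      refine re_potential_sub_le_mul_of_le_mul hx hr hl₁ hl₂ h₁ h₂ (by positivity) ?_ ih ht hz
      have : 0 < ρ ^ m * (g + 1) := by positivity
      have := mul_lt_mul_of_pos_right hρg this
      rw [← hgdef, pow_succ]
      linarith
  have hlim : Tendsto (fun m : ℕ => ρ ^ m * (g + 1) * t) atTop (𝓝 (0 * (g + 1) * t)) :=
    ((tendsto_pow_atTop_nhds_zero_of_lt_one hρ0.le hρ1).mul_const _).mul_const _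
  rw [zero_mul, zero_mul] at hlim
  exact ge_of_tendsto' hlim fun m => hstep m t ht z hz

/-- Limits along different filters agree on the upper half plane. -/
theorem IsLimitPair.unique [l₁.NeBot] [l₂.NeBot] (hx : ScaledZeros x φ σ p q)
    (hr : RealRecurrence x φ c C) (hl₁ : l₁ ≤ atTop) (hl₂ : l₂ ≤ atTop)
    (h₁ : IsLimitPair x φ l₁ f₁ W₁) (h₂ : IsLimitPair x φ l₂ f₂ W₂) {t : ℝ}
    (ht : t ∈ Set.Icc (0 : ℝ) 1) {z : ℂ} (hz : 0 < z.im) : f₁ t z = f₂ t z := by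
  have heq : ∀ w : ℂ, 0 < w.im → (W₁ t w).re = (W₂ t w).re := fun w hw =>
    le_antisymm (sub_nonpos.1 (re_potential_sub_nonpos hx hr hl₁ hl₂ h₁ h₂ ht hw))
      (sub_nonpos.1 (re_potential_sub_nonpos hx hr hl₂ hl₁ h₂ h₁ ht hw))
  have hline : ∀ d : ℂ, (f₁ t z * d).re = (f₂ t z * d).re := by
    intro d
    refine (h₁.hasDerivAt_re_potential_line ht hz d).unique
      ((h₂.hasDerivAt_re_potential_line ht hz d).congr_of_eventuallyEq ?_)
    have hc : ContinuousAt (fun r : ℝ => (z + r * d).im) 0 := by fun_prop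
    have : ∀ᶠ r : ℝ in 𝓝 0, 0 < (z + r * d).im :=
      hc.eventually (lt_mem_nhds (by simpa using hz))
    filter_upwards [this] with r hr using heq _ hr
  have e1 := hline 1
  have e2 := hline Complex.I
  apply Complex.ext
  · simpa using e1
  · simpa using e2

end

/-- The complement of the real interval `[p, q]` in the complex plane. -/
def intervalCompl (p q : ℝ) : Set ℂ := (((↑) : ℝ → ℂ) '' Set.Icc p q)ᶜ

theorem isOpen_intervalCompl (p q : ℝ) : IsOpen (intervalCompl p q) :=
  (isCompact_Icc.image Complex.continuous_ofReal).isClosed.isOpen_compl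

theorem exists_ball_le_norm_sub {p q : ℝ} {z : ℂ} (hz : z ∈ intervalCompl p q) :
    ∃ δ > 0, ∀ w ∈ Metric.ball z δ, ∀ u ∈ Set.Icc p q, δ ≤ ‖w - u‖ := by
  obtain ⟨ε, hε, hball⟩ := Metric.isOpen_iff.1 (isOpen_intervalCompl p q) z hz
  refine ⟨ε / 2, half_pos hε, fun w hw u hu => ?_⟩
  by_contra! h
  refine hball ?_ ⟨u, hu, rfl⟩
  rw [Metric.mem_ball, dist_comm, dist_eq_norm] at *
  calc ‖z - u‖ = ‖(z - w) + (w - u)‖ := by congr 1; ring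
    _ ≤ _ := norm_add_le _ _
    _ < ε := by linarith

theorem exists_le_norm_sub {p q : ℝ} {z : ℂ} (hz : z ∈ intervalCompl p q) :
    ∃ δ > 0, ∀ u ∈ Set.Icc p q, δ ≤ ‖z - u‖ := by
  obtain ⟨δ, hδ, h⟩ := exists_ball_le_norm_sub hz
  exact ⟨δ, hδ, h z (Metric.mem_ball_self hδ)⟩

/-- The Cauchy transform of `1 / n` times the counting measure of the rescaled zeros of index
`⌊n t⌋`. -/
noncomputable def cauchyMean (x : ℕ → ℕ → ℝ) (φ : ℕ → ℝ) (n : ℕ) (t : ℝ) (z : ℂ) : ℂ :=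
  scaledMean x φ n ⌊(n : ℝ) * t⌋₊ fun u => (z - u)⁻¹

section

variable {x : ℕ → ℕ → ℝ} {φ : ℕ → ℝ} {σ p q : ℝ} {c : ℕ → Coeffs} {C : Coeffs}

theorem exists_tendsto_scaledMean_ultrafilter (hx : ScaledZeros x φ σ p q) (U : Ultrafilter ℕ)
    {M Λ : ℝ} {ψ : ℝ → ℂ} (hψ : BddLipschitz p q M Λ ψ) {t : ℝ} (ht : t ∈ Set.Icc (0 : ℝ) 1) :
    ∃ v, Tendsto (fun n : ℕ => scaledMean x φ n ⌊(n : ℝ) * t⌋₊ ψ) U (𝓝 v) := by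
  have hM : 0 ≤ M := (norm_nonneg _).trans (hψ.bound p ⟨le_rfl, hx.le⟩)
  have h : ∀ n : ℕ, scaledMean x φ n ⌊(n : ℝ) * t⌋₊ ψ ∈ Metric.closedBall (0 : ℂ) M := by
    intro n
    rw [mem_closedBall_zero_iff]
    refine (hx.norm_scaledMean_le hψ (floor_mul_le ht n)).trans (mul_le_of_le_one_right hM ?_)
    exact div_le_one_of_le₀ (by exact_mod_cast floor_mul_le ht n) (Nat.cast_nonneg n)
  obtain ⟨v, -, hv⟩ := (isCompact_closedBall (0 : ℂ) M).ultrafilter_le_nhds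
    (U.map fun n : ℕ => scaledMean x φ n ⌊(n : ℝ) * t⌋₊ ψ)
    (by rw [Ultrafilter.coe_map]; exact tendsto_principal.2 (Eventually.of_forall h))
  exact ⟨v, hv⟩

theorem exists_isLimitPair (hx : ScaledZeros x φ σ p q) (U : Ultrafilter ℕ) :
    ∃ f W, IsLimitPair x φ U f W := by
  classical
  have h1 : ∀ (t : ℝ) (z : ℂ), ∃ v, t ∈ Set.Icc (0 : ℝ) 1 → 0 < z.im →
      Tendsto (fun n : ℕ => scaledMean x φ n ⌊(n : ℝ) * t⌋₊ fun u => (z - u)⁻¹) U (𝓝 v) := by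
    intro t z
    by_cases h : t ∈ Set.Icc (0 : ℝ) 1 ∧ 0 < z.im
    · obtain ⟨v, hv⟩ := exists_tendsto_scaledMean_ultrafilter hx U
        (BddLipschitz.cauchyKernel h.2 fun u _ => le_norm_sub_ofReal le_rfl u) h.1
      exact ⟨v, fun _ _ => hv⟩
    · exact ⟨0, fun a b => absurd ⟨a, b⟩ h⟩
  have h2 : ∀ (t : ℝ) (z : ℂ), ∃ v, t ∈ Set.Icc (0 : ℝ) 1 → 0 < z.im →
      Tendsto (fun n : ℕ => scaledMean x φ n ⌊(n : ℝ) * t⌋₊ fun u => Complex.log (z - u)) U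
        (𝓝 v) := by
    intro t z
    by_cases h : t ∈ Set.Icc (0 : ℝ) 1 ∧ 0 < z.im
    · obtain ⟨v, hv⟩ := exists_tendsto_scaledMean_ultrafilter hx U
        (BddLipschitz.logKernel h.2 le_rfl (le_refl ‖z‖)) h.1
      exact ⟨v, fun _ _ => hv⟩
    · exact ⟨0, fun a b => absurd ⟨a, b⟩ h⟩
  choose f hf using h1
  choose W hW using h2
  exact ⟨f, W, fun t ht z hz => hf t z ht hz, fun t ht z hz => hW t z ht hz⟩

theorem exists_tendsto_cauchyMean_of_im_pos (hx : ScaledZeros x φ σ p q)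
    (hr : RealRecurrence x φ c C) {t : ℝ} (ht : t ∈ Set.Icc (0 : ℝ) 1) {z : ℂ} (hz : 0 < z.im) :
    ∃ v, Tendsto (fun n => cauchyMean x φ n t z) atTop (𝓝 v) := by
  have h0 : (hyperfilter ℕ : Filter ℕ) ≤ atTop := Nat.hyperfilter_le_atTop
  obtain ⟨f, W, hfW⟩ := exists_isLimitPair hx (hyperfilter ℕ)
  refine ⟨f t z, (tendsto_iff_ultrafilter _ _ _).2 fun U hU => ?_⟩
  obtain ⟨f', W', hfW'⟩ := exists_isLimitPair hx U
  rw [hfW.unique hx hr h0 hU hfW' ht hz]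
  exact hfW'.cauchy t ht z hz

theorem cauchyMean_conj (n : ℕ) (t : ℝ) (z : ℂ) :
    cauchyMean x φ n t (starRingEnd ℂ z) = starRingEnd ℂ (cauchyMean x φ n t z) := by
  simp [cauchyMean, scaledMean, map_sum, map_inv₀]

theorem norm_cauchyMean_sub_le (hx : ScaledZeros x φ σ p q) {t : ℝ} (ht : t ∈ Set.Icc (0 : ℝ) 1)
    {δ : ℝ} (hδ : 0 < δ) {z w : ℂ} (hz : ∀ u ∈ Set.Icc p q, δ ≤ ‖z - u‖)
    (hw : ∀ u ∈ Set.Icc p q, δ ≤ ‖w - u‖) (n : ℕ) :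
    ‖cauchyMean x φ n t z - cauchyMean x φ n t w‖ ≤ δ⁻¹ ^ 2 * ‖z - w‖ := by
  refine norm_scaledMean_sub_le_of_forall (floor_mul_le ht n) (by positivity) fun j hj => ?_
  rw [Finset.mem_Icc] at hj
  have hmem := hx.mem n _ j (floor_mul_le ht n) hj.1 hj.2
  have hz' := hz _ hmem
  have hw' := hw _ hmem
  generalize ((x ⌊(n : ℝ) * t⌋₊ j / φ n : ℝ) : ℂ) = u at hz' hw'
  have hz0 : z - u ≠ 0 := norm_pos_iff.1 (hδ.trans_le hz')
  have hw0 : w - u ≠ 0 := norm_pos_iff.1 (hδ.trans_le hw')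
  have e : (z - u)⁻¹ - (w - u)⁻¹ = (w - z) * (z - u)⁻¹ * (w - u)⁻¹ := by
    field_simp; ring
  rw [e, norm_mul, norm_mul, norm_inv, norm_inv, norm_sub_rev]
  calc _ ≤ ‖z - w‖ * δ⁻¹ * δ⁻¹ := by gcongr
    _ = _ := by ring

theorem exists_tendsto_cauchyMean (hx : ScaledZeros x φ σ p q) (hr : RealRecurrence x φ c C)
    {t : ℝ} (ht : t ∈ Set.Icc (0 : ℝ) 1) {z : ℂ} (hz : z ∈ intervalCompl p q) :
    ∃ v, Tendsto (fun n => cauchyMean x φ n t z) atTop (𝓝 v) := by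
  rcases lt_trichotomy z.im 0 with h | h | h
  · obtain ⟨v, hv⟩ := exists_tendsto_cauchyMean_of_im_pos hx hr ht (z := starRingEnd ℂ z)
      (by simpa using h)
    refine ⟨starRingEnd ℂ v, ((Complex.continuous_conj.tendsto v).comp hv).congr fun n => ?_⟩
    simp [cauchyMean_conj]
  · obtain ⟨δ, hδ, hball⟩ := exists_ball_le_norm_sub hz
    refine cauchySeq_tendsto_of_complete (Metric.cauchySeq_iff.2 fun ε hε => ?_)
    obtain ⟨η, hη, hηδ, hηε⟩ : ∃ η : ℝ, 0 < η ∧ η < δ ∧ δ⁻¹ ^ 2 * η < ε / 3 := by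
      refine ⟨min (δ / 2) (ε / 6 * δ ^ 2), by positivity,
        (min_le_left _ _).trans_lt (half_lt_self hδ), ?_⟩
      calc _ ≤ δ⁻¹ ^ 2 * (ε / 6 * δ ^ 2) := by gcongr; exact min_le_right _ _
        _ = ε / 6 := by field_simp
        _ < _ := by linarith
    have hw : z + η * Complex.I ∈ Metric.ball z δ := by
      simpa [dist_eq_norm, abs_of_pos hη] using hηδ
    obtain ⟨v, hv⟩ := exists_tendsto_cauchyMean_of_im_pos hx hr ht (z := z + η * Complex.I)
      (by simpa [h] using hη)
    have hnear : ∀ n, ‖cauchyMean x φ n t z - cauchyMean x φ n t (z + η * Complex.I)‖ < ε / 3 := by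
      intro n
      refine (norm_cauchyMean_sub_le hx ht hδ (hball z (Metric.mem_ball_self hδ))
        (hball _ hw) n).trans_lt ?_
      simpa [abs_of_pos hη] using hηε
    obtain ⟨N, hN⟩ := Metric.cauchySeq_iff.1 hv.cauchySeq (ε / 3) (by positivity)
    refine ⟨N, fun m hm n hn => ?_⟩
    have h1 := hN m hm n hn
    have h2 := hnear m
    have h3 := hnear n
    rw [dist_eq_norm] at h1 ⊢
    rw [norm_sub_rev] at h3
    have e : cauchyMean x φ m t z - cauchyMean x φ n t z =
        (cauchyMean x φ m t z - cauchyMean x φ m t (z + η * Complex.I)) +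
        (cauchyMean x φ m t (z + η * Complex.I) - cauchyMean x φ n t (z + η * Complex.I)) +
        (cauchyMean x φ n t (z + η * Complex.I) - cauchyMean x φ n t z) := by ring
    rw [e]
    refine (norm_add₃_le).trans_lt ?_
    linarith
  · exact exists_tendsto_cauchyMean_of_im_pos hx hr ht h

/-- `f` is the limit of the Cauchy transforms of the rescaled zeros. -/
def IsCauchyLimit (x : ℕ → ℕ → ℝ) (φ : ℕ → ℝ) (p q : ℝ) (f : ℝ → ℂ → ℂ) : Prop :=
  ∀ t ∈ Set.Icc (0 : ℝ) 1, ∀ z ∈ intervalCompl p q,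
    Tendsto (fun n => cauchyMean x φ n t z) atTop (𝓝 (f t z))

theorem exists_isCauchyLimit (hx : ScaledZeros x φ σ p q) (hr : RealRecurrence x φ c C) :
    ∃ f, IsCauchyLimit x φ p q f := by
  classical
  have h : ∀ (t : ℝ) (z : ℂ), ∃ v, t ∈ Set.Icc (0 : ℝ) 1 → z ∈ intervalCompl p q →
      Tendsto (fun n => cauchyMean x φ n t z) atTop (𝓝 v) := by
    intro t z
    by_cases h : t ∈ Set.Icc (0 : ℝ) 1 ∧ z ∈ intervalCompl p q
    · obtain ⟨v, hv⟩ := exists_tendsto_cauchyMean hx hr h.1 h.2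
      exact ⟨v, fun _ _ => hv⟩
    · exact ⟨0, fun a b => absurd ⟨a, b⟩ h⟩
  choose f hf using h
  exact ⟨f, fun t ht z hz => hf t z ht hz⟩

theorem norm_cauchyMean_sub_cauchyMean_le (hx : ScaledZeros x φ σ p q) {s t : ℝ}
    (hs : s ∈ Set.Icc (0 : ℝ) 1) (ht : t ∈ Set.Icc (0 : ℝ) 1)
    {δ : ℝ} (hδ : 0 < δ) {z w : ℂ} (hz : ∀ u ∈ Set.Icc p q, δ ≤ ‖z - u‖)
    (hw : ∀ u ∈ Set.Icc p q, δ ≤ ‖w - u‖) (n : ℕ) :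
    ‖cauchyMean x φ n s w - cauchyMean x φ n t z‖ ≤
      δ⁻¹ ^ 2 * ‖w - z‖ + (δ⁻¹ + δ⁻¹ ^ 2 * (q - p)) *
        |(⌊(n : ℝ) * s⌋₊ : ℝ) / n - (⌊(n : ℝ) * t⌋₊ : ℝ) / n| := by
  have h1 := norm_cauchyMean_sub_le hx hs hδ hw hz n
  have h2 := hx.norm_scaledMean_sub_le (BddLipschitz.cauchyKernel hδ hz) (floor_mul_le ht n)
    (floor_mul_le hs n)
  exact (norm_sub_le_norm_sub_add_norm_sub _ (cauchyMean x φ n s z) _).trans (add_le_add h1 h2)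

namespace IsCauchyLimit

variable {f : ℝ → ℂ → ℂ}

theorem norm_sub_le (hx : ScaledZeros x φ σ p q) (hf : IsCauchyLimit x φ p q f) {s t : ℝ}
    (hs : s ∈ Set.Icc (0 : ℝ) 1) (ht : t ∈ Set.Icc (0 : ℝ) 1)
    {δ : ℝ} (hδ : 0 < δ) {z w : ℂ} (hz : ∀ u ∈ Set.Icc p q, δ ≤ ‖z - u‖)
    (hw : ∀ u ∈ Set.Icc p q, δ ≤ ‖w - u‖) :
    ‖f s w - f t z‖ ≤ δ⁻¹ ^ 2 * ‖w - z‖ + (δ⁻¹ + δ⁻¹ ^ 2 * (q - p)) * |s - t| := by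
  have hmem : ∀ y : ℂ, (∀ u ∈ Set.Icc p q, δ ≤ ‖y - u‖) → y ∈ intervalCompl p q := by
    rintro y hy ⟨u, hu, rfl⟩
    have := hy u hu
    simp at this
    linarith
  refine le_of_tendsto_of_tendsto ((hf s hs w (hmem w hw)).sub (hf t ht z (hmem z hz))).norm
    ((((tendsto_floor_mul_div le_rfl hs.1).sub (tendsto_floor_mul_div le_rfl ht.1)).abs.const_mul
      _).const_add _)
    (Eventually.of_forall fun n => norm_cauchyMean_sub_cauchyMean_le hx hs ht hδ hz hw n)

theorem continuousOn (hx : ScaledZeros x φ σ p q) (hf : IsCauchyLimit x φ p q f) :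
    ContinuousOn (fun r : ℝ × ℂ => f r.1 r.2) (Set.Icc 0 1 ×ˢ intervalCompl p q) := by
  rintro ⟨t, z⟩ ⟨ht, hz⟩
  obtain ⟨δ, hδ, hball⟩ := exists_ball_le_norm_sub hz
  have hlim0 : Tendsto (fun r : ℝ × ℂ => δ⁻¹ ^ 2 * ‖r.2 - z‖ +
      (δ⁻¹ + δ⁻¹ ^ 2 * (q - p)) * |r.1 - t|)
      (𝓝[Set.Icc 0 1 ×ˢ intervalCompl p q] (t, z)) (𝓝 0) := by
    have : Continuous fun r : ℝ × ℂ => δ⁻¹ ^ 2 * ‖r.2 - z‖ +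
      (δ⁻¹ + δ⁻¹ ^ 2 * (q - p)) * |r.1 - t| := by fun_prop
    have := this.tendsto (t, z)
    simp only [sub_self, norm_zero, abs_zero, mul_zero, add_zero] at this
    exact this.mono_left nhdsWithin_le_nhds
  rw [ContinuousWithinAt, tendsto_iff_norm_sub_tendsto_zero]
  refine squeeze_zero' (Eventually.of_forall fun _ => norm_nonneg _) ?_ hlim0
  have hnear : ∀ᶠ r : ℝ × ℂ in 𝓝[Set.Icc 0 1 ×ˢ intervalCompl p q] (t, z),
      r.2 ∈ Metric.ball z δ :=
    nhdsWithin_le_nhds (continuous_snd.continuousAt.eventually (Metric.ball_mem_nhds z hδ))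
  filter_upwards [hnear, self_mem_nhdsWithin] with r hr hr2
  exact hf.norm_sub_le hx hr2.1 ht hδ (hball z (Metric.mem_ball_self hδ)) (hball _ hr)

theorem tendstoLocallyUniformlyOn (hx : ScaledZeros x φ σ p q) (hf : IsCauchyLimit x φ p q f) :
    TendstoLocallyUniformlyOn (fun (n : ℕ) (r : ℝ × ℂ) => cauchyMean x φ n r.1 r.2)
      (fun r => f r.1 r.2) atTop (Set.Icc 0 1 ×ˢ intervalCompl p q) := by
  rw [Metric.tendstoLocallyUniformlyOn_iff]
  rintro ε hε ⟨t, z⟩ ⟨ht, hz⟩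
  obtain ⟨δ, hδ, hball⟩ := exists_ball_le_norm_sub hz
  set K := δ⁻¹ + δ⁻¹ ^ 2 * (q - p) with hK
  have hK0 : 0 ≤ K := by have := sub_nonneg.2 hx.le; positivity
  have hcont : Continuous fun r : ℝ × ℂ => δ⁻¹ ^ 2 * ‖r.2 - z‖ + K * |r.1 - t| := by fun_prop
  have h0 : ∀ᶠ r : ℝ × ℂ in 𝓝 (t, z), δ⁻¹ ^ 2 * ‖r.2 - z‖ + K * |r.1 - t| < ε / 4 :=
    hcont.continuousAt.eventually (gt_mem_nhds (by simpa using by positivity))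
  have hnear : ∀ᶠ r : ℝ × ℂ in 𝓝 (t, z), r.2 ∈ Metric.ball z δ :=
    continuous_snd.continuousAt.eventually (Metric.ball_mem_nhds z hδ)
  refine ⟨_, inter_mem_nhdsWithin _ (h0.and hnear), ?_⟩
  have hn1 : Tendsto (fun n : ℕ => K * (2 * (1 / (n : ℝ)))) atTop (𝓝 (K * (2 * 0))) :=
    (tendsto_one_div_atTop_nhds_zero_nat.const_mul _).const_mul _
  rw [mul_zero, mul_zero] at hn1
  filter_upwards [hn1.eventually (gt_mem_nhds (show 0 < ε / 4 by positivity)),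
    eventually_ge_atTop 1,
    (Metric.tendsto_nhds.1 (hf t ht z hz)) (ε / 4) (by positivity)] with n hn hn' hn''
  rintro ⟨s, w⟩ ⟨⟨hs, -⟩, hsw, hwb⟩
  have hs : s ∈ Set.Icc (0 : ℝ) 1 := hs
  have hwb : w ∈ Metric.ball z δ := hwb
  have hsw : δ⁻¹ ^ 2 * ‖w - z‖ + K * |s - t| < ε / 4 := hsw
  have hz' := hball z (Metric.mem_ball_self hδ)
  have a1 := hf.norm_sub_le hx hs ht hδ hz' (hball w hwb)
  have a2 := norm_cauchyMean_sub_cauchyMean_le hx hs ht hδ hz' (hball w hwb) n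
  have a3 : |(⌊(n : ℝ) * s⌋₊ : ℝ) / n - (⌊(n : ℝ) * t⌋₊ : ℝ) / n| ≤ |s - t| + 2 * (1 / n) := by
    have b1 := abs_le.1 (abs_floor_mul_div_sub_le hn' hs.1)
    have b2 := abs_le.1 (abs_floor_mul_div_sub_le hn' ht.1)
    have b3 := abs_le.1 (le_refl |s - t|)
    rw [abs_le]
    constructor <;> linarith [b1.1, b1.2, b2.1, b2.2, b3.1, b3.2]
  have a4 := mul_le_mul_of_nonneg_left a3 hK0
  rw [mul_add] at a4
  rw [dist_eq_norm] at hn'' ⊢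
  have e : f s w - cauchyMean x φ n s w = (f s w - f t z) -
      (cauchyMean x φ n t z - f t z) - (cauchyMean x φ n s w - cauchyMean x φ n t z) := by ring
  rw [e]
  refine ((_root_.norm_sub_le _ _).trans
    (add_le_add_left (_root_.norm_sub_le _ _) _)).trans_lt ?_
  linarith

theorem tendstoUniformlyOn (hx : ScaledZeros x φ σ p q) (hf : IsCauchyLimit x φ p q f) {K : Set ℂ}
    (hK : IsCompact K) (hKΩ : K ⊆ intervalCompl p q) :
    TendstoUniformlyOn (fun (n : ℕ) (r : ℝ × ℂ) => cauchyMean x φ n r.1 r.2)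
      (fun r => f r.1 r.2) atTop (Set.Icc 0 1 ×ˢ K) :=
  (tendstoLocallyUniformlyOn_iff_tendstoUniformlyOn_of_compact (isCompact_Icc.prod hK)).1
    ((hf.tendstoLocallyUniformlyOn hx).mono (Set.prod_mono le_rfl hKΩ))

theorem tendstoLocallyUniformlyOn_slice (hx : ScaledZeros x φ σ p q)
    (hf : IsCauchyLimit x φ p q f) {t : ℝ} (ht : t ∈ Set.Icc (0 : ℝ) 1) :
    TendstoLocallyUniformlyOn (fun n : ℕ => cauchyMean x φ n t) (f t) atTop
      (intervalCompl p q) :=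
  (hf.tendstoLocallyUniformlyOn hx).comp (fun z => (t, z)) (fun _ hz => ⟨ht, hz⟩)
    (by fun_prop)

end IsCauchyLimit

theorem sub_ne_zero_of_mem_intervalCompl (hx : ScaledZeros x φ σ p q) {z : ℂ}
    (hz : z ∈ intervalCompl p q) {n k : ℕ} (hk : k ≤ n) :
    ∀ j ∈ Finset.Icc 1 k, z - (x k j / φ n : ℝ) ≠ 0 := by
  intro j hj h0
  rw [Finset.mem_Icc] at hj
  exact hz ⟨_, hx.mem n k j hk hj.1 hj.2, (sub_eq_zero.1 h0).symm⟩

theorem hasDerivAt_scaledMean_cauchy (hx : ScaledZeros x φ σ p q) {z : ℂ}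
    (hz : z ∈ intervalCompl p q) {n k : ℕ} (hk : k ≤ n) :
    HasDerivAt (fun z => scaledMean x φ n k fun u => (z - u)⁻¹)
      (scaledMean x φ n k fun u => -((z - u) ^ 2)⁻¹) z := by
  refine (HasDerivAt.fun_sum fun j hj => ?_).const_mul _
  have h := sub_ne_zero_of_mem_intervalCompl hx hz hk j hj
  refine (((hasDerivAt_id z).sub_const _).inv h).congr_deriv ?_
  simp [div_eq_mul_inv]

theorem IsCauchyLimit.differentiableOn {f : ℝ → ℂ → ℂ} (hx : ScaledZeros x φ σ p q)
    (hf : IsCauchyLimit x φ p q f) {t : ℝ} (ht : t ∈ Set.Icc (0 : ℝ) 1) :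
    DifferentiableOn ℂ (f t) (intervalCompl p q) :=
  (hf.tendstoLocallyUniformlyOn_slice hx ht).differentiableOn
    (Eventually.of_forall fun n _ hz => (hasDerivAt_scaledMean_cauchy hx hz
      (floor_mul_le ht n)).differentiableAt.differentiableWithinAt) (isOpen_intervalCompl p q)

theorem IsCauchyLimit.tendsto_deriv {f : ℝ → ℂ → ℂ} (hx : ScaledZeros x φ σ p q)
    (hf : IsCauchyLimit x φ p q f) {t : ℝ} (ht : t ∈ Set.Icc (0 : ℝ) 1) {z : ℂ}
    (hz : z ∈ intervalCompl p q) :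
    Tendsto (fun n : ℕ => scaledMean x φ n ⌊(n : ℝ) * t⌋₊ fun u => -((z - u) ^ 2)⁻¹) atTop
      (𝓝 (deriv (f t) z)) := by
  have h := (hf.tendstoLocallyUniformlyOn_slice hx ht).deriv
    (Eventually.of_forall fun n _ hz => (hasDerivAt_scaledMean_cauchy hx hz
      (floor_mul_le ht n)).differentiableAt.differentiableWithinAt) (isOpen_intervalCompl p q)
  refine (h.tendsto_at hz).congr fun n => ?_
  exact (hasDerivAt_scaledMean_cauchy hx hz (floor_mul_le ht n)).deriv

end

theorem intervalIntegrable_and_eq_integral_of_lipschitz {h g : ℝ → ℂ} {K : ℝ} (hK : 0 ≤ K)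
    (hlip : ∀ s ∈ Set.Icc (0 : ℝ) 1, ∀ t ∈ Set.Icc (0 : ℝ) 1, ‖h s - h t‖ ≤ K * |s - t|)
    (hd : ∀ t ∈ Set.Ioo (0 : ℝ) 1, HasDerivAt h (g t) t) {s : ℝ} (hs : s ∈ Set.Icc (0 : ℝ) 1) :
    IntervalIntegrable g MeasureTheory.volume 0 s ∧ h s - h 0 = ∫ t in (0 : ℝ)..s, g t := by
  have hsub : Set.Ioo 0 s ⊆ Set.Ioo (0 : ℝ) 1 := Set.Ioo_subset_Ioo_right hs.2
  have hsub' : Set.Icc 0 s ⊆ Set.Icc (0 : ℝ) 1 := Set.Icc_subset_Icc_right hs.2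
  have hbound : ∀ t ∈ Set.Ioo (0 : ℝ) 1, ‖deriv h t‖ ≤ K := by
    intro t ht
    rw [(hd t ht).deriv]
    refine (hd t ht).le_of_lip' hK ?_
    filter_upwards [Icc_mem_nhds ht.1 ht.2] with r hr
    exact hlip r hr t (Set.Ioo_subset_Icc_self ht)
  have hint : IntervalIntegrable g MeasureTheory.volume 0 s := by
    rw [intervalIntegrable_iff_integrableOn_Ioo_of_le hs.1]
    refine MeasureTheory.IntegrableOn.congr_fun (f := deriv h) ?_
      (fun t ht => (hd t (hsub ht)).deriv) measurableSet_Ioo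
    refine MeasureTheory.Measure.integrableOn_of_bounded (M := K) (by simp)
      (stronglyMeasurable_deriv h).aestronglyMeasurable ?_
    exact (MeasureTheory.ae_restrict_iff' measurableSet_Ioo).2
      (Eventually.of_forall fun t ht => hbound t (hsub ht))
  refine ⟨hint, (intervalIntegral.integral_eq_sub_of_hasDerivAt_of_le hs.1 ?_
    (fun t ht => hd t (hsub ht)) hint).symm⟩
  have hl : LipschitzOnWith ⟨K, hK⟩ h (Set.Icc 0 1) := by
    refine LipschitzOnWith.of_dist_le_mul fun a ha b hb => ?_
    rw [dist_eq_norm, Real.dist_eq]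
    exact hlip a ha b hb
  exact hl.continuousOn.mono hsub'

theorem BddLipschitz.exists_logNorm {p q δ : ℝ} (hδ : 0 < δ) {z : ℂ}
    (hz : ∀ u ∈ Set.Icc p q, δ ≤ ‖z - u‖) :
    ∃ M Λ, BddLipschitz p q M Λ fun u => (Real.log ‖z - u‖ : ℂ) := by
  refine ⟨|Real.log δ| + |Real.log (‖z‖ + max |p| |q|)|, δ⁻¹, by positivity,
    fun u hu => ?_, fun u hu v hv => ?_⟩
  · have h1 := hz u hu
    have h2 : ‖z - u‖ ≤ ‖z‖ + max |p| |q| := by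
      refine (norm_sub_le _ _).trans (add_le_add le_rfl ?_)
      rw [Complex.norm_real, Real.norm_eq_abs]
      exact abs_le_max_abs_abs hu.1 hu.2
    rw [Complex.norm_real, Real.norm_eq_abs, abs_le]
    have h3 := Real.log_le_log hδ h1
    have h4 := Real.log_le_log (hδ.trans_le h1) h2
    have := neg_abs_le (Real.log δ)
    have := le_abs_self (Real.log (‖z‖ + max |p| |q|))
    have := abs_nonneg (Real.log δ)
    have := abs_nonneg (Real.log (‖z‖ + max |p| |q|))
    constructor <;> linarith
  · rw [← Complex.ofReal_sub, Complex.norm_real, Real.norm_eq_abs]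
    refine (abs_log_sub_log_le hδ (hz u hu) (hz v hv)).trans ?_
    rw [div_eq_inv_mul]
    refine mul_le_mul_of_nonneg_left ?_ (by positivity)
    refine (abs_norm_sub_norm_le (z - u) (z - v)).trans_eq ?_
    rw [sub_sub_sub_cancel_left, ← Complex.ofReal_sub, Complex.norm_real, Real.norm_eq_abs,
      abs_sub_comm]

theorem BddLipschitz.exists_cauchyKernelDeriv {p q δ : ℝ} (hδ : 0 < δ) {z : ℂ}
    (hz : ∀ u ∈ Set.Icc p q, δ ≤ ‖z - u‖) :
    ∃ M Λ, BddLipschitz p q M Λ fun u => -((z - u) ^ 2)⁻¹ := by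
  have h := BddLipschitz.cauchyKernel hδ hz
  have e : ∀ u : ℝ, -((z - u) ^ 2)⁻¹ = -((z - u)⁻¹ * (z - u)⁻¹) := fun u => by
    rw [sq, mul_inv]
  refine ⟨δ⁻¹ * δ⁻¹, δ⁻¹ ^ 2 * (δ⁻¹ + δ⁻¹), by positivity, fun u hu => ?_, fun u hu v hv => ?_⟩
  · have := h.bound u hu
    simp only [e, norm_neg, norm_mul]
    gcongr
  · have h1 := h.bound u hu
    have h2 := h.bound v hv
    have h3 := h.lip u hu v hv
    simp only [e]
    generalize (z - u)⁻¹ = a at *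
    generalize (z - v)⁻¹ = b at *
    rw [show -(a * a) - -(b * b) = -((a - b) * (a + b)) by ring, norm_neg, norm_mul]
    calc _ ≤ (δ⁻¹ ^ 2 * |u - v|) * (δ⁻¹ + δ⁻¹) := by
          gcongr
          exact (norm_add_le _ _).trans (add_le_add h1 h2)
      _ = _ := by ring

namespace Coeffs

/-- The derivative of `Coeffs.quad`. -/
def quadDeriv (c : Coeffs) (z : ℂ) : ℂ := 2 * c.a₂ * z + c.a₁

theorem hasDerivAt_quad (c : Coeffs) (z : ℂ) : HasDerivAt c.quad (c.quadDeriv z) z := by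
  have h := (((hasDerivAt_pow 2 z).const_mul (c.a₂ : ℂ)).add
    ((hasDerivAt_id z).const_mul (c.a₁ : ℂ))).add_const (c.a₀ : ℂ)
  refine h.congr_deriv ?_
  simp [quadDeriv]
  ring

theorem hasDerivAt_lin (c : Coeffs) (z : ℂ) : HasDerivAt c.lin c.b₁ z := by
  have h := ((hasDerivAt_id z).const_mul (c.b₁ : ℂ)).add_const (c.b₀ : ℂ)
  refine h.congr_deriv (by simp)

theorem ConvergesTo.quadDeriv {ι : Type*} {s : ι → Coeffs} {l : Filter ι} {c : Coeffs}
    (h : ConvergesTo s l c) (z : ℂ) :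
    Tendsto (fun i => (s i).quadDeriv z) l (𝓝 (c.quadDeriv z)) :=
  ((((Complex.continuous_ofReal.tendsto _).comp h.a₂).const_mul 2).mul_const _).add
    ((Complex.continuous_ofReal.tendsto _).comp h.a₁)

end Coeffs

theorem neBot_ratioFilter {t : ℝ} (ht : t ∈ Set.Icc (0 : ℝ) 1) : (ratioFilter atTop t).NeBot := by
  have hdiv : Tendsto (fun n : ℕ => ((⌊(n : ℝ) * t⌋₊ - 1 : ℕ) : ℝ) / n) atTop (𝓝 t) := by
    have h1 := tendsto_floor_mul_div le_rfl ht.1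
    have h2 := h1.sub tendsto_one_div_atTop_nhds_zero_nat
    rw [sub_zero] at h2
    refine tendsto_of_tendsto_of_tendsto_of_le_of_le h2 h1 (fun n => ?_) fun n => ?_
    · rw [← sub_div]
      have : (⌊(n : ℝ) * t⌋₊ : ℝ) ≤ ((⌊(n : ℝ) * t⌋₊ - 1 : ℕ) : ℝ) + 1 := by
        exact_mod_cast (by omega : ⌊(n : ℝ) * t⌋₊ ≤ ⌊(n : ℝ) * t⌋₊ - 1 + 1)
      gcongr
      linarith
    · have : ((⌊(n : ℝ) * t⌋₊ - 1 : ℕ) : ℝ) ≤ (⌊(n : ℝ) * t⌋₊ : ℝ) := by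
        exact_mod_cast Nat.sub_le _ _
      simp only
      gcongr
  have : Tendsto (fun n : ℕ => (n, ⌊(n : ℝ) * t⌋₊ - 1)) atTop (ratioFilter atTop t) := by
    rw [ratioFilter, tendsto_inf, tendsto_inf, tendsto_comap_iff, tendsto_principal]
    refine ⟨⟨tendsto_id.prodMk tendsto_top, hdiv⟩, ?_⟩
    filter_upwards [eventually_ge_atTop 1] with n hn
    have := floor_mul_le ht n
    exact (by omega : ⌊(n : ℝ) * t⌋₊ - 1 < n)
  exact this.neBot

section

variable {x : ℕ → ℕ → ℝ} {φ : ℕ → ℝ} {σ p q : ℝ} {c : ℕ → Coeffs} {C : Coeffs}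
  {f : ℝ → ℂ → ℂ}

theorem exists_forall_le_norm_zeroRatio (hx : ScaledZeros x φ σ p q) {z : ℂ}
    (hz : z ∈ intervalCompl p q) :
    ∃ r > 0, ∀ n k : ℕ, k < n → r ≤ ‖zeroRatio x φ n k z‖ := by
  obtain ⟨δ, hδ, hz'⟩ := exists_le_norm_sub hz
  obtain ⟨M, Λ, hψ⟩ := BddLipschitz.exists_logNorm hδ hz'
  refine ⟨Real.exp (-(M + Λ * (q - p))), Real.exp_pos _, fun n k hk => ?_⟩
  have h : ∀ m, m ≤ n → ∀ j ∈ Finset.Icc 1 m, ‖z - (x m j / φ n : ℝ)‖ ≠ 0 := fun m hm j hj =>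
    norm_ne_zero_iff.2 (sub_ne_zero_of_mem_intervalCompl hx hz hm j hj)
  have h1 := hx.norm_sum_succ_sub_le hψ (Nat.succ_le_of_lt hk)
  rw [← Complex.ofReal_sum, ← Complex.ofReal_sum, ← Complex.ofReal_sub, Complex.norm_real,
    ← Real.log_prod (h _ hk), ← Real.log_prod (h _ hk.le),
    ← Real.log_div (Finset.prod_ne_zero_iff.2 (h _ hk)) (Finset.prod_ne_zero_iff.2 (h _ hk.le)),
    ← norm_prod, ← norm_prod, ← norm_div, Real.norm_eq_abs] at h1
  have h2 := (abs_le.1 h1).1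
  rwa [← Real.le_log_iff_exp_le]
  rw [zeroRatio, norm_div, norm_prod, norm_prod]
  exact div_pos (lt_of_le_of_ne (by positivity) (Finset.prod_ne_zero_iff.2 (h _ hk)).symm)
    (lt_of_le_of_ne (by positivity) (Finset.prod_ne_zero_iff.2 (h _ hk.le)).symm)

theorem IsCauchyLimit.tendsto_ratioFilter (hx : ScaledZeros x φ σ p q)
    (hf : IsCauchyLimit x φ p q f) {t : ℝ} (ht : t ∈ Set.Icc (0 : ℝ) 1) {z : ℂ}
    (hz : z ∈ intervalCompl p q) :
    Tendsto (fun i : ℕ × ℕ => scaledMean x φ i.1 i.2 fun u => (z - u)⁻¹) (ratioFilter atTop t)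
      (𝓝 (f t z)) := by
  obtain ⟨δ, hδ, hz'⟩ := exists_le_norm_sub hz
  exact tendsto_scaledMean_ratioFilter hx le_rfl (BddLipschitz.cauchyKernel hδ hz') ht
    (hf t ht z hz)

theorem IsCauchyLimit.tendsto_deriv_ratioFilter (hx : ScaledZeros x φ σ p q)
    (hf : IsCauchyLimit x φ p q f) {t : ℝ} (ht : t ∈ Set.Icc (0 : ℝ) 1) {z : ℂ}
    (hz : z ∈ intervalCompl p q) :
    Tendsto (fun i : ℕ × ℕ => scaledMean x φ i.1 i.2 fun u => -((z - u) ^ 2)⁻¹)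
      (ratioFilter atTop t) (𝓝 (deriv (f t) z)) := by
  obtain ⟨δ, hδ, hz'⟩ := exists_le_norm_sub hz
  obtain ⟨M, Λ, hψ⟩ := BddLipschitz.exists_cauchyKernelDeriv hδ hz'
  exact tendsto_scaledMean_ratioFilter hx le_rfl hψ ht (hf.tendsto_deriv hx ht hz)

theorem tendsto_scale_ratioFilter (hx : ScaledZeros x φ σ p q)
    (hT : Coeffs.ConvergesTo (fun k => (c k).scale k (φ k)) atTop C) {t : ℝ} (ht : 0 < t) :
    Coeffs.ConvergesTo (fun i : ℕ × ℕ => (c i.2).scale i.1 (φ i.1)) (ratioFilter atTop t)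
      (C.dilate σ t) :=
  tendsto_scale hx hT ht tendsto_fst_ratioFilter tendsto_div_ratioFilter

theorem IsCauchyLimit.tendsto_limitRatio (hx : ScaledZeros x φ σ p q)
    (hT : Coeffs.ConvergesTo (fun k => (c k).scale k (φ k)) atTop C)
    (hf : IsCauchyLimit x φ p q f) {t : ℝ} (ht : t ∈ Set.Ioc (0 : ℝ) 1) {z : ℂ}
    (hz : z ∈ intervalCompl p q) :
    Tendsto (fun i : ℕ × ℕ => ((c i.2).scale i.1 (φ i.1)).quad z *
      scaledMean x φ i.1 i.2 (fun u => (z - u)⁻¹) + ((c i.2).scale i.1 (φ i.1)).lin z)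
      (ratioFilter atTop t) (𝓝 (limitRatio C σ f t z)) := by
  have hs := tendsto_scale_ratioFilter hx hT ht.1
  exact ((hs.quad z).mul (hf.tendsto_ratioFilter hx ⟨ht.1.le, ht.2⟩ hz)).add (hs.lin z)

theorem IsCauchyLimit.tendsto_zeroRatio (hx : ScaledZeros x φ σ p q) (hr : RealRecurrence x φ c C)
    (hf : IsCauchyLimit x φ p q f) {t : ℝ} (ht : t ∈ Set.Ioc (0 : ℝ) 1) {z : ℂ}
    (hz : z ∈ intervalCompl p q) :
    Tendsto (fun i : ℕ × ℕ => zeroRatio x φ i.1 i.2 z) (ratioFilter atTop t)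
      (𝓝 (limitRatio C σ f t z)) := by
  refine (hf.tendsto_limitRatio hx hr.tendsto ht hz).congr' ?_
  filter_upwards [eventually_lt_ratioFilter] with i hi
  rw [zeroRatio_eq hx hr (by omega) (sub_ne_zero_of_mem_intervalCompl hx hz hi.le)]

theorem IsCauchyLimit.limitRatio_ne_zero (hx : ScaledZeros x φ σ p q)
    (hr : RealRecurrence x φ c C) (hf : IsCauchyLimit x φ p q f) {t : ℝ}
    (ht : t ∈ Set.Ioc (0 : ℝ) 1) {z : ℂ} (hz : z ∈ intervalCompl p q) :
    limitRatio C σ f t z ≠ 0 := by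
  obtain ⟨r, hr0, h⟩ := exists_forall_le_norm_zeroRatio hx hz
  have := neBot_ratioFilter ⟨ht.1.le, ht.2⟩
  have h1 : r ≤ ‖limitRatio C σ f t z‖ := by
    refine ge_of_tendsto (hf.tendsto_zeroRatio hx hr ht hz).norm ?_
    filter_upwards [eventually_lt_ratioFilter] with i hi using h _ _ hi
  exact norm_pos_iff.1 (hr0.trans_le h1)

theorem sum_inv_succ_sub_eq_div (hx : ScaledZeros x φ σ p q) (hr : RealRecurrence x φ c C)
    {z : ℂ} (hz : z ∈ intervalCompl p q) {n k : ℕ} (hk : k < n) :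
    ∑ j ∈ Finset.Icc 1 (k + 1), (z - (x (k + 1) j / φ n : ℝ))⁻¹ -
      ∑ j ∈ Finset.Icc 1 k, (z - (x k j / φ n : ℝ))⁻¹ =
      (((c k).scale n (φ n)).quadDeriv z * scaledMean x φ n k (fun u => (z - u)⁻¹) +
        ((c k).scale n (φ n)).quad z * scaledMean x φ n k (fun u => -((z - u) ^ 2)⁻¹) +
        ((c k).scale n (φ n)).b₁) / zeroRatio x φ n k z := by
  have hne := sub_ne_zero_of_mem_intervalCompl hx hz hk.le
  have hne' := sub_ne_zero_of_mem_intervalCompl hx hz (Nat.succ_le_of_lt hk)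
  have hdiff : ∀ m j, DifferentiableAt ℂ (fun z : ℂ => z - (x m j / φ n : ℝ)) z := fun m j => by
    fun_prop
  have h1 : HasDerivAt (zeroRatio x φ n k)
      (((c k).scale n (φ n)).quadDeriv z * scaledMean x φ n k (fun u => (z - u)⁻¹) +
        ((c k).scale n (φ n)).quad z * scaledMean x φ n k (fun u => -((z - u) ^ 2)⁻¹) +
        ((c k).scale n (φ n)).b₁) z := by
    refine HasDerivAt.congr_of_eventuallyEq
      (((Coeffs.hasDerivAt_quad _ z).mul (hasDerivAt_scaledMean_cauchy hx hz hk.le)).add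
      (Coeffs.hasDerivAt_lin ((c k).scale n (φ n)) z)) ?_
    filter_upwards [(isOpen_intervalCompl p q).mem_nhds hz] with w hw
    exact zeroRatio_eq hx hr (by omega) (sub_ne_zero_of_mem_intervalCompl hx hw hk.le)
  have h2 : logDeriv (zeroRatio x φ n k) z = ∑ j ∈ Finset.Icc 1 (k + 1),
      (z - (x (k + 1) j / φ n : ℝ))⁻¹ - ∑ j ∈ Finset.Icc 1 k, (z - (x k j / φ n : ℝ))⁻¹ := by
    have hlog : ∀ m j, logDeriv (fun z : ℂ => z - (x m j / φ n : ℝ)) z =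
        (z - (x m j / φ n : ℝ))⁻¹ := fun m j => by
      rw [logDeriv_apply, deriv_sub_const, deriv_id'', one_div]
    have e : zeroRatio x φ n k = fun z : ℂ => (∏ j ∈ Finset.Icc 1 (k + 1),
        (z - (x (k + 1) j / φ n : ℝ))) / ∏ j ∈ Finset.Icc 1 k, (z - (x k j / φ n : ℝ)) := rfl
    rw [e, logDeriv_div z (Finset.prod_ne_zero_iff.2 hne') (Finset.prod_ne_zero_iff.2 hne)
      (DifferentiableAt.fun_finsetProd fun j _ => hdiff _ _)
      (DifferentiableAt.fun_finsetProd fun j _ => hdiff _ _),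
      logDeriv_prod hne' fun j _ => hdiff _ _, logDeriv_prod hne fun j _ => hdiff _ _]
    simp only [hlog]
  rw [← h2, logDeriv_apply, h1.deriv]

theorem IsCauchyLimit.hasDerivAt_limitRatio (hx : ScaledZeros x φ σ p q)
    (hf : IsCauchyLimit x φ p q f) {t : ℝ} (ht : t ∈ Set.Icc (0 : ℝ) 1) {z : ℂ}
    (hz : z ∈ intervalCompl p q) :
    HasDerivAt (limitRatio C σ f t) ((C.dilate σ t).quadDeriv z * f t z +
      (C.dilate σ t).quad z * deriv (f t) z + (C.dilate σ t).b₁) z :=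
  ((Coeffs.hasDerivAt_quad _ z).mul ((hf.differentiableOn hx ht).differentiableAt
    ((isOpen_intervalCompl p q).mem_nhds hz)).hasDerivAt).add
    (Coeffs.hasDerivAt_lin (C.dilate σ t) z)

theorem IsCauchyLimit.hasDerivWithinAt (hx : ScaledZeros x φ σ p q) (hr : RealRecurrence x φ c C)
    (hf : IsCauchyLimit x φ p q f) {t : ℝ} (ht : t ∈ Set.Ioc (0 : ℝ) 1) {z : ℂ}
    (hz : z ∈ intervalCompl p q) :
    HasDerivWithinAt (fun s => f s z) (deriv (limitRatio C σ f t) z / limitRatio C σ f t z)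
      (Set.Icc 0 1) t := by
  have ht' : t ∈ Set.Icc (0 : ℝ) 1 := ⟨ht.1.le, ht.2⟩
  refine hasDerivWithinAt_of_tendsto_increment le_rfl
    (e := fun n k => ∑ j ∈ Finset.Icc 1 (k + 1), (z - (x (k + 1) j / φ n : ℝ))⁻¹ -
      ∑ j ∈ Finset.Icc 1 k, (z - (x k j / φ n : ℝ))⁻¹) (fun s hs => ?_) ht' ?_
  · refine (hf s hs z hz).congr fun n => ?_
    exact scaledMean_eq_sum_range _
  · rw [(hf.hasDerivAt_limitRatio hx ht' hz).deriv]
    have hs := tendsto_scale_ratioFilter hx hr.tendsto ht.1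
    refine (((((hs.quadDeriv z).mul (hf.tendsto_ratioFilter hx ht' hz)).add
      ((hs.quad z).mul (hf.tendsto_deriv_ratioFilter hx ht' hz))).add
      ((Complex.continuous_ofReal.tendsto _).comp hs.b₁)).div
      (hf.tendsto_zeroRatio hx hr ht hz) (hf.limitRatio_ne_zero hx hr ht hz)).congr' ?_
    filter_upwards [eventually_lt_ratioFilter] with i hi
    exact (sum_inv_succ_sub_eq_div hx hr hz hi).symm

theorem IsCauchyLimit.zero (hf : IsCauchyLimit x φ p q f) {z : ℂ} (hz : z ∈ intervalCompl p q) :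
    f 0 z = 0 := by
  refine tendsto_nhds_unique (hf 0 (by simp) z hz) ?_
  simp [cauchyMean, scaledMean]

theorem IsCauchyLimit.eq_integral (hx : ScaledZeros x φ σ p q) (hr : RealRecurrence x φ c C)
    (hf : IsCauchyLimit x φ p q f) {s : ℝ} (hs : s ∈ Set.Icc (0 : ℝ) 1) {z : ℂ}
    (hz : z ∈ intervalCompl p q) {g : ℝ → ℂ}
    (hg : ∀ t ∈ Set.Ioc (0 : ℝ) 1, g t = deriv (limitRatio C σ f t) z / limitRatio C σ f t z) :
    IntervalIntegrable g MeasureTheory.volume 0 s ∧ f s z = ∫ t in (0 : ℝ)..s, g t := by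
  obtain ⟨δ, hδ, hz'⟩ := exists_le_norm_sub hz
  have hpq := sub_nonneg.2 hx.le
  have := intervalIntegrable_and_eq_integral_of_lipschitz (h := fun t => f t z) (g := g)
    (K := δ⁻¹ + δ⁻¹ ^ 2 * (q - p)) (by positivity)
    (fun s hs t ht => by simpa using hf.norm_sub_le hx hs ht hδ hz' hz')
    (fun t ht => by
      rw [hg t ⟨ht.1, ht.2.le⟩]
      exact (hf.hasDerivWithinAt hx hr ⟨ht.1, ht.2.le⟩ hz).hasDerivAt (Icc_mem_nhds ht.1 ht.2)) hs
  simpa only [hf.zero hz, sub_zero] using this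

theorem IsCauchyLimit.tendsto_mul_cobounded (hx : ScaledZeros x φ σ p q)
    (hf : IsCauchyLimit x φ p q f) {s : ℝ} (hs : s ∈ Set.Icc (0 : ℝ) 1) :
    Tendsto (fun z : ℂ => z * f s z) (Bornology.cobounded ℂ) (𝓝 (s : ℂ)) := by
  set R := max |p| |q| with hR
  have hR0 : 0 ≤ R := le_max_of_le_left (abs_nonneg _)
  have hmem : ∀ u ∈ Set.Icc p q, ‖(u : ℂ)‖ ≤ R := fun u hu => by
    rw [Complex.norm_real, Real.norm_eq_abs]
    exact abs_le_max_abs_abs hu.1 hu.2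
  have hbound : ∀ z : ℂ, R < ‖z‖ → ‖z * f s z - s‖ ≤ R / (‖z‖ - R) := by
    intro z hzR
    have hz : z ∈ intervalCompl p q := by
      rintro ⟨u, hu, rfl⟩
      exact absurd (hmem u hu) (not_le.2 hzR)
    have hlim := (((hf s hs z hz).const_mul z).sub ((Complex.continuous_ofReal.tendsto _).comp
      (tendsto_floor_mul_div le_rfl hs.1))).norm
    refine le_of_tendsto hlim (Eventually.of_forall fun n => ?_)
    have e : z * cauchyMean x φ n s z - (Complex.ofReal ∘ fun n : ℕ =>
        (⌊(n : ℝ) * s⌋₊ : ℝ) / n) n = scaledMean x φ n ⌊(n : ℝ) * s⌋₊ (fun u => z * (z - u)⁻¹) -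
          scaledMean x φ n ⌊(n : ℝ) * s⌋₊ fun _ => 1 := by
      simp only [cauchyMean, scaledMean, Function.comp, ← Finset.mul_sum]
      simp
      ring
    rw [e]
    refine norm_scaledMean_sub_le_of_forall (floor_mul_le hs n)
      (div_nonneg hR0 (sub_nonneg.2 hzR.le)) fun j hj => ?_
    rw [Finset.mem_Icc] at hj
    have hu := hmem _ (hx.mem n _ j (floor_mul_le hs n) hj.1 hj.2)
    generalize ((x ⌊(n : ℝ) * s⌋₊ j / φ n : ℝ) : ℂ) = u at hu
    have h1 : ‖z‖ - R ≤ ‖z - u‖ := by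
      have := norm_sub_norm_le z u
      linarith
    have h2 : 0 < ‖z‖ - R := sub_pos.2 hzR
    have h3 : z - u ≠ 0 := norm_pos_iff.1 (h2.trans_le h1)
    rw [show z * (z - u)⁻¹ - 1 = u / (z - u) by field_simp; ring, norm_div]
    gcongr
  rw [tendsto_iff_norm_sub_tendsto_zero]
  have hlim : Tendsto (fun z : ℂ => R / (‖z‖ - R)) (Bornology.cobounded ℂ) (𝓝 0) :=
    (tendsto_norm_cobounded_atTop.atTop_add tendsto_const_nhds).const_div_atTop R
  refine squeeze_zero' (Eventually.of_forall fun _ => norm_nonneg _) ?_ hlim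
  filter_upwards [tendsto_norm_cobounded_atTop.eventually_gt_atTop R] with z hz using hbound z hz

end

theorem eval_derivative_prod_X_sub_C {ι : Type*} (s : Finset ι) (a : ι → ℂ) {w : ℂ}
    (h : ∀ i ∈ s, w - a i ≠ 0) :
    (derivative (∏ i ∈ s, (X - C (a i)))).eval w =
      (∑ i ∈ s, (w - a i)⁻¹) * ∏ i ∈ s, (w - a i) := by
  classical
  induction s using Finset.induction_on with
  | empty => simp
  | insert i s hi ih =>
    have h1 := h i (Finset.mem_insert_self i s)
    rw [Finset.prod_insert hi, Finset.prod_insert hi, Finset.sum_insert hi, derivative_mul,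
      eval_add, eval_mul, eval_mul, ih fun j hj => h j (Finset.mem_insert_of_mem hj)]
    simp only [eval_prod, derivative_sub, derivative_X, derivative_C, eval_sub, eval_X, eval_C,
      sub_zero, eval_one]
    field_simp

theorem eval_eq_of_natDegree_le_two {A : ℂ[X]} (hA : A.natDegree ≤ 2) (w : ℂ) :
    A.eval w = A.coeff 2 * w ^ 2 + A.coeff 1 * w + A.coeff 0 := by
  rw [eval_eq_sum_range' (Nat.lt_succ_of_le hA)]
  simp [Finset.sum_range_succ]
  ring

theorem eval_eq_of_natDegree_le_one {B : ℂ[X]} (hB : B.natDegree ≤ 1) (w : ℂ) :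
    B.eval w = B.coeff 1 * w + B.coeff 0 := by
  rw [eval_eq_sum_range' (Nat.lt_succ_of_le hB)]
  simp [Finset.sum_range_succ]
  ring

/-- If quadratic polynomials converge pointwise to `a`, then `a` is quadratic and the coefficients
converge. -/
theorem tendsto_coeff_of_tendsto_eval {a : ℂ[X]} {u₂ u₁ u₀ : ℕ → ℂ}
    (h : ∀ z : ℂ, Tendsto (fun n => u₂ n * z ^ 2 + u₁ n * z + u₀ n) atTop (𝓝 (a.eval z))) :
    a = C (a.coeff 2) * X ^ 2 + C (a.coeff 1) * X + C (a.coeff 0) ∧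
      Tendsto u₂ atTop (𝓝 (a.coeff 2)) ∧ Tendsto u₁ atTop (𝓝 (a.coeff 1)) ∧
      Tendsto u₀ atTop (𝓝 (a.coeff 0)) := by
  have h0 := h 0
  have h1 := h 1
  have h2 := h (-1)
  have t0 : Tendsto u₀ atTop (𝓝 (a.eval 0)) := h0.congr fun n => by ring
  have t1 : Tendsto u₁ atTop (𝓝 ((a.eval 1 - a.eval (-1)) / 2)) :=
    ((h1.sub h2).div_const 2).congr fun n => by ring
  have t2 : Tendsto u₂ atTop (𝓝 ((a.eval 1 + a.eval (-1)) / 2 - a.eval 0)) :=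
    (((h1.add h2).div_const 2).sub t0).congr fun n => by ring
  have e : a = C ((a.eval 1 + a.eval (-1)) / 2 - a.eval 0) * X ^ 2 +
      C ((a.eval 1 - a.eval (-1)) / 2) * X + C (a.eval 0) := by
    refine Polynomial.funext fun z => ?_
    refine tendsto_nhds_unique (h z) ?_
    simp only [eval_add, eval_mul, eval_C, eval_X, eval_pow]
    exact ((t2.mul_const _).add (t1.mul_const _)).add t0
  have c2 : a.coeff 2 = (a.eval 1 + a.eval (-1)) / 2 - a.eval 0 := by
    conv_lhs => rw [e]
    simp only [coeff_add, coeff_C_mul, coeff_X_pow, coeff_X, coeff_C]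
    norm_num
  have c1 : a.coeff 1 = (a.eval 1 - a.eval (-1)) / 2 := by
    conv_lhs => rw [e]
    simp only [coeff_add, coeff_C_mul, coeff_X_pow, coeff_X, coeff_C]
    norm_num
  have c0 : a.coeff 0 = a.eval 0 := coeff_zero_eq_eval_zero a
  rw [c2, c1, c0]
  exact ⟨e, t2, t1, t0⟩

theorem leadingCoeff_differentialRecurrence {A B : ℂ[X]} {n : ℕ} {κ κ' : ℂ} {y y' : ℕ → ℂ}
    (hA : A.natDegree ≤ 2) (hB : B.natDegree ≤ 1)
    (h : C κ' * ∏ j ∈ Finset.Icc 1 (n + 1), (X - C (y' j)) =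
      A * derivative (C κ * ∏ j ∈ Finset.Icc 1 n, (X - C (y j))) +
        B * (C κ * ∏ j ∈ Finset.Icc 1 n, (X - C (y j)))) :
    κ' = n * A.coeff 2 * κ + B.coeff 1 * κ := by
  have hdeg : ∀ (m : ℕ) (v : ℕ → ℂ), (∏ j ∈ Finset.Icc 1 m, (X - C (v j))).natDegree = m :=
    fun m v => by simp
  have hco : ∀ (m : ℕ) (v : ℕ → ℂ) (r : ℂ),
      (C r * ∏ j ∈ Finset.Icc 1 m, (X - C (v j))).coeff m = r := fun m v r => by
    have := (monic_prod_X_sub_C v (Finset.Icc 1 m)).coeff_natDegree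
    rw [hdeg] at this
    rw [coeff_C_mul, this, mul_one]
  have hdeg' : (C κ * ∏ j ∈ Finset.Icc 1 n, (X - C (y j))).natDegree ≤ n :=
    (natDegree_C_mul_le _ _).trans (hdeg n y).le
  have h1 := congrArg (fun Q => coeff Q (n + 1)) h
  simp only [coeff_add] at h1
  rw [hco, add_comm n 1, coeff_mul_add_eq_of_natDegree_le hB hdeg', hco] at h1
  rw [h1]
  congr 1
  rcases n with _ | m
  · simp
  · have hd : (derivative (C κ * ∏ j ∈ Finset.Icc 1 (m + 1), (X - C (y j)))).natDegree ≤ m :=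
      (natDegree_derivative_le _).trans (by omega)
    rw [show 1 + (m + 1) = 2 + m by ring, coeff_mul_add_eq_of_natDegree_le hA hd, coeff_derivative,
      hco]
    push_cast
    ring

/-- The values of a real functional on the coefficients of `A / r` and `B / r`. -/
noncomputable def coeffsOf (g : ℂ →L[ℝ] ℝ) (A B : ℂ[X]) (r : ℂ) : Coeffs :=
  ⟨g (A.coeff 2 / r), g (A.coeff 1 / r), g (A.coeff 0 / r), g (B.coeff 1 / r), g (B.coeff 0 / r)⟩

theorem mul_quad_coeffsOf (A B : ℂ[X]) {r : ℂ} (hr : r ≠ 0) (w : ℂ) :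
    r * ((coeffsOf Complex.reCLM A B r).quad w + Complex.I * (coeffsOf Complex.imCLM A B r).quad w) =
      A.coeff 2 * w ^ 2 + A.coeff 1 * w + A.coeff 0 := by
  have h : ∀ y : ℂ, r * (((y / r).re : ℂ) + (y / r).im * Complex.I) = y := fun y => by
    rw [Complex.re_add_im]; field_simp
  simp only [coeffsOf, Coeffs.quad, Complex.reCLM_apply, Complex.imCLM_apply]
  linear_combination w ^ 2 * h (A.coeff 2) + w * h (A.coeff 1) + h (A.coeff 0)

theorem mul_lin_coeffsOf (A B : ℂ[X]) {r : ℂ} (hr : r ≠ 0) (w : ℂ) :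
    r * ((coeffsOf Complex.reCLM A B r).lin w + Complex.I * (coeffsOf Complex.imCLM A B r).lin w) =
      B.coeff 1 * w + B.coeff 0 := by
  have h : ∀ y : ℂ, r * (((y / r).re : ℂ) + (y / r).im * Complex.I) = y := fun y => by
    rw [Complex.re_add_im]; field_simp
  simp only [coeffsOf, Coeffs.lin, Complex.reCLM_apply, Complex.imCLM_apply]
  linear_combination w * h (B.coeff 1) + h (B.coeff 0)

theorem Coeffs.quad_conj (c : Coeffs) (w : ℂ) :
    c.quad (starRingEnd ℂ w) = starRingEnd ℂ (c.quad w) := by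
  simp [Coeffs.quad]

theorem Coeffs.lin_conj (c : Coeffs) (w : ℂ) :
    c.lin (starRingEnd ℂ w) = starRingEnd ℂ (c.lin w) := by
  simp [Coeffs.lin]

theorem real_and_imaginary_recurrence {k : ℕ} {y y' : ℕ → ℝ} {R J : Coeffs}
    (h : ∀ w : ℂ, (∀ j ∈ Finset.Icc 1 k, w - y j ≠ 0) →
      ∏ j ∈ Finset.Icc 1 (k + 1), (w - y' j) =
        ((R.quad w + Complex.I * J.quad w) * ∑ j ∈ Finset.Icc 1 k, (w - y j)⁻¹ +
          (R.lin w + Complex.I * J.lin w)) * ∏ j ∈ Finset.Icc 1 k, (w - y j))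
    {w : ℂ} (hw : ∀ j ∈ Finset.Icc 1 k, w - y j ≠ 0) :
    ∏ j ∈ Finset.Icc 1 (k + 1), (w - y' j) = (R.quad w * ∑ j ∈ Finset.Icc 1 k, (w - y j)⁻¹ +
      R.lin w) * ∏ j ∈ Finset.Icc 1 k, (w - y j) ∧
    J.quad w * ∑ j ∈ Finset.Icc 1 k, (w - y j)⁻¹ + J.lin w = 0 := by
  have hconj : ∀ j, starRingEnd ℂ w - y j = starRingEnd ℂ (w - y j) := fun j => by simp
  have h1 := h w hw
  have h2 := congrArg (starRingEnd ℂ) (h (starRingEnd ℂ w) fun j hj => by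
    rw [hconj]; exact (_root_.map_ne_zero _).2 (hw j hj))
  simp only [map_mul, map_add, map_prod, map_sum, map_sub, map_inv₀, Complex.conj_conj,
    Complex.conj_ofReal, Complex.conj_I, Coeffs.quad_conj, Coeffs.lin_conj] at h2
  have h3 : J.quad w * ∑ j ∈ Finset.Icc 1 k, (w - y j)⁻¹ + J.lin w = 0 := by
    have hI : (2 * Complex.I) * ∏ j ∈ Finset.Icc 1 k, (w - y j) ≠ 0 :=
      mul_ne_zero (mul_ne_zero two_ne_zero Complex.I_ne_zero) (Finset.prod_ne_zero_iff.2 hw)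
    refine (mul_eq_zero.1 ?_).resolve_left hI
    linear_combination h2 - h1
  refine ⟨?_, h3⟩
  linear_combination h1 + Complex.I * (∏ j ∈ Finset.Icc 1 k, (w - y j)) * h3

theorem convergesTo_coeffsOf {A B : ℕ → ℂ[X]} {a b : ℂ[X]} {φ : ℕ → ℝ} {r : ℕ → ℂ} {μ : ℂ}
    (hμ : μ ≠ 0) (hr : Tendsto r atTop (𝓝 μ))
    (h2 : Tendsto (fun n : ℕ => (n : ℂ) * (A n).coeff 2) atTop (𝓝 (a.coeff 2)))
    (h1 : Tendsto (fun n : ℕ => (n : ℂ) * (A n).coeff 1 / φ n) atTop (𝓝 (a.coeff 1)))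
    (h0 : Tendsto (fun n : ℕ => (n : ℂ) * (A n).coeff 0 / φ n ^ 2) atTop (𝓝 (a.coeff 0)))
    (g1 : Tendsto (fun n : ℕ => (B n).coeff 1) atTop (𝓝 (b.coeff 1)))
    (g0 : Tendsto (fun n : ℕ => (B n).coeff 0 / φ n) atTop (𝓝 (b.coeff 0))) (g : ℂ →L[ℝ] ℝ) :
    Coeffs.ConvergesTo (fun k => (coeffsOf g (A k) (B k) (r k)).scale k (φ k)) atTop
      (coeffsOf g a b μ) := by
  have key : ∀ {s : ℕ → ℝ} {u v : ℕ → ℂ} {w : ℂ}, Tendsto v atTop (𝓝 w) →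
      (∀ n, v n = s n * u n) → Tendsto (fun n => s n * g (u n / r n)) atTop (𝓝 (g (w / μ))) := by
    intro s u v w hv e
    refine ((g.continuous.tendsto _).comp (hv.div hr hμ)).congr fun n => ?_
    simp only [Function.comp, Pi.div_apply]
    rw [e, mul_div_assoc, ← Complex.real_smul, map_smul, smul_eq_mul]
  refine ⟨?_, ?_, ?_, ?_, ?_⟩
  · exact key (s := fun n => n) (u := fun n => (A n).coeff 2) h2 fun n => by simp
  · refine (key (s := fun n => n / φ n) (u := fun n => (A n).coeff 1) h1
      fun n => ?_).congr fun n => ?_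
    · push_cast; ring
    · simp only [Coeffs.scale, coeffsOf]; ring
  · refine (key (s := fun n => n / φ n ^ 2) (u := fun n => (A n).coeff 0) h0
      fun n => ?_).congr fun n => ?_
    · push_cast; ring
    · simp only [Coeffs.scale, coeffsOf]; ring
  · refine (key (s := fun n => 1) (u := fun n => (B n).coeff 1) g1 fun n => ?_).congr fun n => ?_
    · simp
    · simp only [Coeffs.scale, coeffsOf]; ring
  · refine (key (s := fun n => 1 / φ n) (u := fun n => (B n).coeff 0) g0
      fun n => ?_).congr fun n => ?_
    · push_cast; ring
    · simp only [Coeffs.scale, coeffsOf]; ring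

theorem exists_scaledZeros {x : ℕ → ℕ → ℝ} {φ : ℕ → ℝ} {σ α β : ℝ} (hinter : ZerosInterlace x)
    (hφpos : ∀ n, 1 ≤ n → 0 < φ n) (hφmono : ∀ m n, 1 ≤ m → m ≤ n → φ m ≤ φ n)
    (hbdd : ∀ n k, 1 ≤ k → k ≤ n → x n k / φ n ∈ Set.Icc α β) (hφ : IsRegularlyVarying φ σ) :
    ∃ p q, limitDomain φ α β = intervalCompl p q ∧ ScaledZeros x φ σ p q := by
  by_cases hc : ∀ n, 1 ≤ n → φ n = φ 1
  · refine ⟨α, β, by rw [limitDomain, if_pos hc, intervalCompl], hinter, hφpos, hφmono, hφ,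
      fun n N j hN hj hjN => ?_⟩
    rw [hc n (by omega), ← hc N (by omega)]
    exact hbdd N j hj hjN
  · refine ⟨min 0 α, max 0 β, by rw [limitDomain, if_neg hc, intervalCompl], hinter, hφpos, hφmono,
      hφ, fun n N j hN hj hjN => ?_⟩
    have hn := hφpos n (by omega)
    have hN' := hφpos N (by omega)
    obtain ⟨h1, h2⟩ := hbdd N j hj hjN
    have hle : φ N / φ n ≤ 1 := (div_le_one hn).2 (hφmono N n (by omega) hN)
    have h0 : 0 ≤ φ N / φ n := div_nonneg hN'.le hn.le
    have e : x N j / φ n = x N j / φ N * (φ N / φ n) := by field_simp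
    rw [e]
    generalize φ N / φ n = r at *
    generalize x N j / φ N = y at *
    have m1 := min_le_left 0 α
    have m2 := min_le_right 0 α
    have m3 := le_max_left 0 β
    have m4 := le_max_right 0 β
    constructor <;> nlinarith

section

variable {x : ℕ → ℕ → ℝ} {φ : ℕ → ℝ} {σ p q : ℝ}

theorem scaledLogDeriv_eq_cauchyMean {P : ℕ → ℂ[X]} (hx : ScaledZeros x φ σ p q)
    (hP : HasRealZeros P x) {n : ℕ} (hn : 1 ≤ n) {t : ℝ} (ht : t ∈ Set.Icc (0 : ℝ) 1) {z : ℂ}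
    (hz : z ∈ intervalCompl p q) : scaledLogDeriv φ P n t z = cauchyMean x φ n t z := by
  set N := ⌊(n : ℝ) * t⌋₊ with hN
  obtain ⟨κ, hκ, hPN⟩ := hP N
  have hφ : (φ n : ℂ) ≠ 0 := by exact_mod_cast (hx.pos n hn).ne'
  have hs : ∀ j, (φ n : ℂ) * z - (x N j : ℝ) = φ n * (z - (x N j / φ n : ℝ)) := by
    intro j
    push_cast
    field_simp
  have hne : ∀ j ∈ Finset.Icc 1 N, (φ n : ℂ) * z - (x N j : ℝ) ≠ 0 := fun j hj => by
    rw [hs]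
    exact mul_ne_zero hφ (sub_ne_zero_of_mem_intervalCompl hx hz (floor_mul_le ht n) j hj)
  have hprod : ∏ j ∈ Finset.Icc 1 N, ((φ n : ℂ) * z - (x N j : ℝ)) ≠ 0 :=
    Finset.prod_ne_zero_iff.2 hne
  rw [scaledLogDeriv, ← hN, hPN, derivative_C_mul, eval_mul, eval_mul, eval_C,
    eval_derivative_prod_X_sub_C _ _ hne, eval_prod]
  simp only [eval_sub, eval_X, eval_C]
  rw [mul_div_mul_left _ _ hκ, mul_div_cancel_right₀ _ hprod, cauchyMean, scaledMean, ← hN]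
  simp_rw [hs, mul_inv, ← Finset.mul_sum]
  push_cast
  field_simp

theorem ratioExpr_eq_limitRatio {a b : ℂ[X]} {μ : ℂ} (hμ : μ ≠ 0)
    (ha : a = C (a.coeff 2) * X ^ 2 + C (a.coeff 1) * X + C (a.coeff 0))
    (hb : b = C (b.coeff 1) * X + C (b.coeff 0)) (f : ℝ → ℂ → ℂ) {t : ℝ} (ht : 0 < t) (z : ℂ) :
    ratioExpr a b σ f t z = μ * (limitRatio (coeffsOf Complex.reCLM a b μ) σ f t z +
      Complex.I * limitRatio (coeffsOf Complex.imCLM a b μ) σ f t z) := by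
  have hτ : 0 < t ^ σ := Real.rpow_pos_of_pos ht σ
  have e1 : t ^ (2 * σ - 1) = (t ^ σ) ^ 2 / t := by
    rw [Real.rpow_sub ht, Real.rpow_one, mul_comm, Real.rpow_mul ht.le, Real.rpow_two]
  have e2 : t ^ (-σ) = (t ^ σ)⁻¹ := Real.rpow_neg ht.le σ
  have h : ∀ y : ℂ, μ * (((y / μ).re : ℂ) + (y / μ).im * Complex.I) = y := fun y => by
    rw [Complex.re_add_im]; field_simp
  have ea : ∀ w, a.eval w = a.coeff 2 * w ^ 2 + a.coeff 1 * w + a.coeff 0 := fun w => by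
    conv_lhs => rw [ha]
    simp
  have eb : ∀ w, b.eval w = b.coeff 1 * w + b.coeff 0 := fun w => by
    conv_lhs => rw [hb]
    simp
  rw [ratioExpr, e1, e2, ea, eb]
  have ht' : (t : ℂ) ≠ 0 := by exact_mod_cast ht.ne'
  have hτ' : ((t ^ σ : ℝ) : ℂ) ≠ 0 := by exact_mod_cast hτ.ne'
  simp only [limitRatio, Coeffs.dilate, Coeffs.quad, Coeffs.lin, coeffsOf, Complex.reCLM_apply,
    Complex.imCLM_apply]
  push_cast
  generalize ((t ^ σ : ℝ) : ℂ) = τ at *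
  have ha2 := h (a.coeff 2)
  have ha1 := h (a.coeff 1)
  have ha0 := h (a.coeff 0)
  have hb1 := h (b.coeff 1)
  have hb0 := h (b.coeff 0)
  have key : τ ^ 2 / t * (a.coeff 2 * (z * τ⁻¹) ^ 2 + a.coeff 1 * (z * τ⁻¹) + a.coeff 0) * f t z +
      τ * (b.coeff 1 * (z * τ⁻¹) + b.coeff 0) =
      (a.coeff 2 / t * z ^ 2 + a.coeff 1 * τ / t * z + a.coeff 0 * τ ^ 2 / t) * f t z +
        (b.coeff 1 * z + b.coeff 0 * τ) := by
    field_simp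
  rw [key]
  linear_combination (-(z ^ 2 / t * f t z)) * ha2 - τ / t * z * f t z * ha1 -
    τ ^ 2 / t * f t z * ha0 - z * hb1 - τ * hb0

theorem limitRatio_eq_zero {f : ℝ → ℂ → ℂ} {d : ℕ → Coeffs} {D : Coeffs}
    (hx : ScaledZeros x φ σ p q)
    (hD : Coeffs.ConvergesTo (fun k => (d k).scale k (φ k)) atTop D)
    (hd : ∀ k (w : ℂ), (∀ j ∈ Finset.Icc 1 k, w - x k j ≠ 0) →
      (d k).quad w * ∑ j ∈ Finset.Icc 1 k, (w - x k j)⁻¹ + (d k).lin w = 0)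
    (hf : IsCauchyLimit x φ p q f) {t : ℝ} (ht : t ∈ Set.Ioc (0 : ℝ) 1) {z : ℂ}
    (hz : z ∈ intervalCompl p q) : limitRatio D σ f t z = 0 := by
  have := neBot_ratioFilter ⟨ht.1.le, ht.2⟩
  refine tendsto_nhds_unique (hf.tendsto_limitRatio hx hD ht hz) (tendsto_const_nhds.congr' ?_)
  filter_upwards [eventually_lt_ratioFilter] with i hi
  obtain ⟨n, k⟩ := i
  have hi : k < n := hi
  have hn : 1 ≤ n := by omega
  have hφ : (φ n : ℂ) ≠ 0 := by exact_mod_cast (hx.pos n hn).ne'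
  have hn0 : (n : ℂ) ≠ 0 := by exact_mod_cast (by omega : n ≠ 0)
  have hs : ∀ j, (φ n : ℂ) * z - x k j = φ n * (z - (x k j / φ n : ℝ)) := by
    intro j
    push_cast
    field_simp
  have h := hd k (φ n * z) fun j hj => by
    rw [hs]; exact mul_ne_zero hφ (sub_ne_zero_of_mem_intervalCompl hx hz hi.le j hj)
  simp_rw [hs, mul_inv, ← Finset.mul_sum] at h
  simp only [Coeffs.quad, Coeffs.lin, Coeffs.scale, scaledMean] at h ⊢
  refine (mul_eq_zero.1 (?_ : (φ n : ℂ) * _ = 0)).resolve_left hφ |>.symm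
  rw [← h]
  push_cast
  field_simp

end

theorem exists_recurrences {P A B : ℕ → ℂ[X]} {x : ℕ → ℕ → ℝ} {φ : ℕ → ℝ} {a b : ℂ[X]}
    (hA : ∀ n, (A n).natDegree ≤ 2) (hB : ∀ n, (B n).natDegree ≤ 1)
    (hP : ∀ n, P (n + 1) = A n * derivative (P n) + B n * P n)
    (hzeros : HasRealZeros P x)
    (h2 : Tendsto (fun n : ℕ => (n : ℂ) * (A n).coeff 2) atTop (𝓝 (a.coeff 2)))
    (h1 : Tendsto (fun n : ℕ => (n : ℂ) * (A n).coeff 1 / φ n) atTop (𝓝 (a.coeff 1)))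
    (h0 : Tendsto (fun n : ℕ => (n : ℂ) * (A n).coeff 0 / φ n ^ 2) atTop (𝓝 (a.coeff 0)))
    (g1 : Tendsto (fun n : ℕ => (B n).coeff 1) atTop (𝓝 (b.coeff 1)))
    (g0 : Tendsto (fun n : ℕ => (B n).coeff 0 / φ n) atTop (𝓝 (b.coeff 0)))
    (hab : a.coeff 2 + b.coeff 1 ≠ 0) :
    ∃ c d : ℕ → Coeffs,
      RealRecurrence x φ c (coeffsOf Complex.reCLM a b (a.coeff 2 + b.coeff 1)) ∧
      Coeffs.ConvergesTo (fun k => (d k).scale k (φ k)) atTop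
        (coeffsOf Complex.imCLM a b (a.coeff 2 + b.coeff 1)) ∧
      ∀ k (w : ℂ), (∀ j ∈ Finset.Icc 1 k, w - x k j ≠ 0) →
        (d k).quad w * ∑ j ∈ Finset.Icc 1 k, (w - x k j)⁻¹ + (d k).lin w = 0 := by
  choose κ hκ hPκ using hzeros
  set r : ℕ → ℂ := fun n => κ (n + 1) / κ n with hr
  have hr0 : ∀ n, r n ≠ 0 := fun n => div_ne_zero (hκ _) (hκ _)
  have hlead : ∀ n : ℕ, r n = n * (A n).coeff 2 + (B n).coeff 1 := by
    intro n
    have h := hP n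
    rw [hPκ, hPκ] at h
    have := leadingCoeff_differentialRecurrence (hA n) (hB n) h
    have hκn := hκ n
    simp only [hr]
    rw [this]
    field_simp
  have hrlim : Tendsto r atTop (𝓝 (a.coeff 2 + b.coeff 1)) :=
    (h2.add g1).congr fun n => (hlead n).symm
  have hconv := convergesTo_coeffsOf (a := a) (b := b) hab hrlim h2 h1 h0 g1 g0
  have hboth : ∀ k (w : ℂ), (∀ j ∈ Finset.Icc 1 k, w - x k j ≠ 0) →
      ∏ j ∈ Finset.Icc 1 (k + 1), (w - x (k + 1) j) =
        (((coeffsOf Complex.reCLM (A k) (B k) (r k)).quad w +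
          Complex.I * (coeffsOf Complex.imCLM (A k) (B k) (r k)).quad w) *
          ∑ j ∈ Finset.Icc 1 k, (w - x k j)⁻¹ +
        ((coeffsOf Complex.reCLM (A k) (B k) (r k)).lin w +
          Complex.I * (coeffsOf Complex.imCLM (A k) (B k) (r k)).lin w)) *
        ∏ j ∈ Finset.Icc 1 k, (w - x k j) := by
    intro k w hw
    have h := congrArg (eval w) (hP k)
    rw [hPκ, hPκ, eval_add, eval_mul, eval_mul, eval_mul, derivative_C_mul, eval_mul, eval_mul,
      eval_C, eval_C, eval_derivative_prod_X_sub_C _ _ hw, eval_prod, eval_prod,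
      eval_eq_of_natDegree_le_two (hA k), eval_eq_of_natDegree_le_one (hB k),
      ← mul_quad_coeffsOf (A k) (B k) (hr0 k), ← mul_lin_coeffsOf (A k) (B k) (hr0 k)] at h
    simp only [eval_sub, eval_X, eval_C] at h
    have hκ' : κ (k + 1) = r k * κ k := by
      have := hκ k
      simp only [hr]
      field_simp
    refine mul_left_cancel₀ (hκ (k + 1)) (h.trans ?_)
    rw [hκ']
    ring
  refine ⟨fun k => coeffsOf Complex.reCLM (A k) (B k) (r k),
    fun k => coeffsOf Complex.imCLM (A k) (B k) (r k),
    ⟨fun k w hw => (real_and_imaginary_recurrence (hboth k) hw).1, fun k => ?_,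
      hconv Complex.reCLM⟩, hconv Complex.imCLM,
    fun k w hw => (real_and_imaginary_recurrence (hboth k) hw).2⟩
  have h := congrArg Complex.re (div_self (hr0 k))
  nth_rewrite 1 [hlead k] at h
  rw [add_div, mul_div_assoc, Complex.add_re, Complex.one_re] at h
  simpa [coeffsOf, ← Complex.ofReal_natCast, Complex.re_ofReal_mul] using h

theorem theorem3
    (P A B : ℕ → ℂ[X]) (x : ℕ → ℕ → ℝ) (φ : ℕ → ℝ) (σ α β : ℝ) (a b : ℂ[X])
    -- the differential-difference equation
    (hP0 : P 0 = 1)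
    (hA : ∀ n, (A n).natDegree ≤ 2) (hB : ∀ n, (B n).natDegree ≤ 1)
    (hP : ∀ n, P (n + 1) = A n * derivative (P n) + B n * P n)
    -- real interlacing zeros whose rescalings stay in `[α, β]`
    (hzeros : HasRealZeros P x) (hinter : ZerosInterlace x)
    (hφpos : ∀ n, 1 ≤ n → 0 < φ n)
    (hφmono : ∀ m n, 1 ≤ m → m ≤ n → φ m ≤ φ n)
    (hbdd : ∀ n k, 1 ≤ k → k ≤ n → x n k / φ n ∈ Set.Icc α β)
    -- regular variation of `φ` and the limits of the coefficients
    (hφ : IsRegularlyVarying φ σ)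
    (ha : ∀ z : ℂ, Tendsto
      (fun n : ℕ => ((n / φ n ^ 2 : ℝ) : ℂ) * (A n).eval ((φ n : ℂ) * z))
      atTop (𝓝 (a.eval z)))
    (hb : ∀ z : ℂ, Tendsto
      (fun n : ℕ => ((1 / φ n : ℝ) : ℂ) * (B n).eval ((φ n : ℂ) * z))
      atTop (𝓝 (b.eval z)))
    -- the limits of the coefficients are not degenerate
    (hab : a.coeff 2 + b.coeff 1 ≠ 0) :
    ∃ f : ℝ → ℂ → ℂ,
      -- `f` is the limit of the whole sequence, uniformly on `[0,1] × K` for compact `K`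
      (∀ K : Set ℂ, IsCompact K → K ⊆ limitDomain φ α β →
        TendstoUniformlyOn
          (fun (n : ℕ) (p : ℝ × ℂ) => scaledLogDeriv φ P n p.1 p.2)
          (fun p => f p.1 p.2) atTop (Set.Icc 0 1 ×ˢ K)) ∧
      -- hence the limit along any infinite set `Λ` of indices is this same `f`
      (∀ (Λ : Set ℕ), Λ.Infinite → ∀ g : ℝ → ℂ → ℂ,
        (∀ t ∈ Set.Icc (0 : ℝ) 1, ∀ z ∈ limitDomain φ α β,
          Tendsto (fun n => scaledLogDeriv φ P n t z) (atTop ⊓ 𝓟 Λ) (𝓝 (g t z))) →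
        ∀ t ∈ Set.Icc (0 : ℝ) 1, ∀ z ∈ limitDomain φ α β, g t z = f t z) ∧
      -- regularity of `f`
      ContinuousOn (fun p : ℝ × ℂ => f p.1 p.2) (Set.Icc 0 1 ×ˢ limitDomain φ α β) ∧
      (∀ t ∈ Set.Icc (0 : ℝ) 1, DifferentiableOn ℂ (f t) (limitDomain φ α β)) ∧
      -- the integral equation, whose integrand is well defined and integrable
      (∀ t ∈ Set.Ioc (0 : ℝ) 1, ∀ z ∈ limitDomain φ α β, ratioExpr a b σ f t z ≠ 0) ∧
      (∀ s ∈ Set.Icc (0 : ℝ) 1, ∀ z ∈ limitDomain φ α β,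
        IntervalIntegrable
          (fun t => deriv (ratioExpr a b σ f t) z / ratioExpr a b σ f t z)
          MeasureTheory.volume 0 s ∧
        f s z = ∫ t in (0 : ℝ)..s, deriv (ratioExpr a b σ f t) z / ratioExpr a b σ f t z) ∧
      -- the initial condition and the behaviour at infinity
      (∀ z ∈ limitDomain φ α β, f 0 z = 0) ∧
      (∀ s ∈ Set.Icc (0 : ℝ) 1,
        Tendsto (fun z : ℂ => z * f s z) (Bornology.cobounded ℂ) (𝓝 (s : ℂ))) := by
  obtain ⟨p, q, hΩ, hx⟩ := exists_scaledZeros hinter hφpos hφmono hbdd hφ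
  have hφ0 : ∀ n, 1 ≤ n → (φ n : ℂ) ≠ 0 := fun n hn => by exact_mod_cast (hφpos n hn).ne'
  obtain ⟨ea, h2, h1, h0⟩ := tendsto_coeff_of_tendsto_eval (a := a)
    (u₂ := fun n : ℕ => (n : ℂ) * (A n).coeff 2) (u₁ := fun n : ℕ => (n : ℂ) * (A n).coeff 1 / φ n)
    (u₀ := fun n : ℕ => (n : ℂ) * (A n).coeff 0 / φ n ^ 2) fun z => by
      refine (ha z).congr' ?_
      filter_upwards [eventually_ge_atTop 1] with n hn
      have := hφ0 n hn
      rw [eval_eq_of_natDegree_le_two (hA n)]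
      push_cast
      field_simp
  obtain ⟨eb, hz2, g1, g0⟩ := tendsto_coeff_of_tendsto_eval (a := b)
    (u₂ := fun _ => 0) (u₁ := fun n : ℕ => (B n).coeff 1)
    (u₀ := fun n : ℕ => (B n).coeff 0 / φ n) fun z => by
      refine (hb z).congr' ?_
      filter_upwards [eventually_ge_atTop 1] with n hn
      have := hφ0 n hn
      rw [eval_eq_of_natDegree_le_one (hB n)]
      push_cast
      field_simp
      ring
  rw [← tendsto_nhds_unique tendsto_const_nhds hz2, C_0, zero_mul, zero_add] at eb
  obtain ⟨c, d, hr, hd, hd0⟩ := exists_recurrences hA hB hP hzeros h2 h1 h0 g1 g0 hab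
  obtain ⟨f, hf⟩ := exists_isCauchyLimit hx hr
  rw [hΩ]
  have hseq : ∀ n : ℕ, 1 ≤ n → ∀ t ∈ Set.Icc (0 : ℝ) 1, ∀ z ∈ intervalCompl p q,
      scaledLogDeriv φ P n t z = cauchyMean x φ n t z := fun n hn t ht z hz =>
    scaledLogDeriv_eq_cauchyMean hx hzeros hn ht hz
  have hratio : ∀ t ∈ Set.Ioc (0 : ℝ) 1, ∀ z ∈ intervalCompl p q, ratioExpr a b σ f t z =
      (a.coeff 2 + b.coeff 1) *
        limitRatio (coeffsOf Complex.reCLM a b (a.coeff 2 + b.coeff 1)) σ f t z := by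
    intro t ht z hz
    rw [ratioExpr_eq_limitRatio hab ea eb f ht.1, limitRatio_eq_zero hx hd hd0 hf ht hz, mul_zero,
      add_zero]
  refine ⟨f, fun K hK hKΩ => ?_, fun Λ hΛ g hg t ht z hz => ?_, hf.continuousOn hx,
    fun t ht => hf.differentiableOn hx ht, fun t ht z hz => ?_, fun s hs z hz => ?_,
    fun z hz => hf.zero hz, fun s hs => hf.tendsto_mul_cobounded hx hs⟩
  · refine (hf.tendstoUniformlyOn hx hK hKΩ).congr ?_
    filter_upwards [eventually_ge_atTop 1] with n hn r hr
    exact (hseq n hn r.1 hr.1 r.2 (hKΩ hr.2)).symm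
  · have : (atTop ⊓ 𝓟 Λ).NeBot :=
      frequently_mem_iff_neBot.1 (Nat.frequently_atTop_iff_infinite.2 hΛ)
    refine tendsto_nhds_unique (hg t ht z hz) (((hf t ht z hz).mono_left inf_le_left).congr' ?_)
    filter_upwards [(eventually_ge_atTop 1).filter_mono inf_le_left] with n hn
    exact (hseq n hn t ht z hz).symm
  · rw [hratio t ht z hz]
    exact mul_ne_zero hab (hf.limitRatio_ne_zero hx hr ht hz)
  · refine hf.eq_integral hx hr hs hz fun t ht => ?_
    have hev : ratioExpr a b σ f t =ᶠ[𝓝 z] fun z => (a.coeff 2 + b.coeff 1) *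
        limitRatio (coeffsOf Complex.reCLM a b (a.coeff 2 + b.coeff 1)) σ f t z := by
      filter_upwards [(isOpen_intervalCompl p q).mem_nhds hz] with w hw using hratio t ht w hw
    rw [hev.deriv_eq, hratio t ht z hz,
      ((hf.hasDerivAt_limitRatio hx ⟨ht.1.le, ht.2⟩ hz).const_mul _).deriv,
      (hf.hasDerivAt_limitRatio hx ⟨ht.1.le, ht.2⟩ hz).deriv, mul_div_mul_left _ _ hab]
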